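/- **Notation.** For a category $C$, let $\boldsymbol\beta C$ be the category whose objects (ultrafamilies) are triples $(X,h,\nu)$ of a set $X$, a family $h\colon X\to C$ of objects and an ultrafilter $\nu$ on $X$; an arrow $(X,h,\nu)\to(X',h',\nu')$ is represented by a function $g\colon X'\to X$ with $g_*\nu'=\nu$ and arrows $\alpha_x\colon h(g(x))\to h'(x)$ $(x\in X')$, two representatives being identified when they agree on a set in $\nu'$. Every functor $f$ induces a functor $\boldsymbol\beta f$, there is the unit $\eta_C\colon C\to\boldsymbol\beta C$, $c\mapsto(1,c,1)$, and the multiplication $\mu_C\colon\boldsymbol\beta^2C\to\boldsymbol\beta C$ sends $(X,(Y_x,c_x,\xi_x)_x,\nu)$ to its direct sum $\bigl(\sum_xY_x,(c_{x,y})_{(x,y)},\sum_{x:\nu}\xi_x\bigr)$; re-indexing gives isomorphisms $\mathfrak l\colon\mu\circ\eta\boldsymbol\beta\cong1$, $\mathfrak r\colon\mu\circ\boldsymbol\beta\eta\cong1$ and $\mathfrak m\colon\mu\circ\boldsymbol\beta\mu\cong\mu\circ\mu\boldsymbol\beta$. A profunctor $F\colon C⇸D$ is a functor $D^{op}\times C\to\mathbf{Set}$;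 composition is by coends; $F$ is small if every $F(-,c)$ is a small colimit of representables. For a functor $f\colon C\to D$ put $f_\diamond(d,c)=D(d,fc)$ and $f^\diamond(c,d)=D(fc,d)$. The extension $\underline{\boldsymbol\beta}$ of $\boldsymbol\beta$ to profunctors sends $F\colon C⇸D$ to $\underline{\boldsymbol\beta}F=(\boldsymbol\beta\,\mathrm{dom})_\diamond\circ(\boldsymbol\beta\,\mathrm{cod})^\diamond\colon\boldsymbol\beta C⇸\boldsymbol\beta D$, where $D\xleftarrow{\mathrm{dom}}R\xrightarrow{\mathrm{cod}}C$ is the two-sided discrete fibration of the elements of $F$. Equivalently, the elements of $\underline{\boldsymbol\beta}F((X,d,\nu),(Y,c,\xi))$ are classes, modulo equality $\xi$-almost everywhere, of families $(x_y,s_y)_{y\in Y}$ with $x_y\in X$, $s_y\in F(d_{x_y},c_y)$ such that $y\mapsto x_y$ carries $\xi$ to $\nu$. With the evident comparison cells $1\Rightarrow\underline{\boldsymbol\beta}1$ and $\underline{\boldsymbol\beta}G\circ\underline{\boldsymbol\beta}F\Rightarrow\underline{\boldsymbol\beta}(G\circ F)$ (elementwise composition of families; invertible when $F=f_\diamond$),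 $\underline{\boldsymbol\beta}$ is a lax functor with $\underline{\boldsymbol\beta}(f_\diamond)\cong(\boldsymbol\beta f)_\diamond$, and $\eta_\diamond$, $\mu_\diamond$ are oplax transformations $1\Rightarrow\underline{\boldsymbol\beta}$, $\underline{\boldsymbol\beta}^2\Rightarrow\underline{\boldsymbol\beta}$, with cells $\eta_\diamond\circ F\Rightarrow\underline{\boldsymbol\beta}F\circ\eta_\diamond$ and $\mu_\diamond\circ\underline{\boldsymbol\beta}^2F\Rightarrow\underline{\boldsymbol\beta}F\circ\mu_\diamond$ sending an element to the corresponding family indexed by a point, and a family of families to the corresponding family indexed by the direct sum. **Theorem.** Let $A_0$ be a discrete category and let $A\colon\boldsymbol\beta A_0⇸A_0$ be a small profunctor. There is a bijection between: 1. *ultraconvergence structures based on $A$*: families of elements $\mathrm{id}_a\in A(a,\eta a)$ $(a\in A_0)$ and of operations sending $r\in A(a,(X,b,\nu))$ and $s_x\in A(b_x,(Y_x,c_x,\xi_x))$ $(x\in X)$ to $(s_x)_{x:\nu}\cdot r\in A\bigl(a,\mu(X,(Y_x,c_x,\xi_x)_x,\nu)\bigr)$, such that, writing $r[g]=A(1,g)(r)$,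 * $(s_{g(y)})_{y:\xi}\cdot r[g]=((s_x)_{x:\nu}\cdot r)[g\otimes\mathrm{id}]$ for all ultrafilters $\xi$ on sets $Y$ and all functions $g\colon Y\to X$ with $g_*\xi=\nu$; * $(s_x[g_x])_{x:\nu}\cdot r=((s_x)_{x:\nu}\cdot r)[\mathrm{id}\otimes(g_x)_{x:\nu}]$ for all families of arrows $g_x$ of $\boldsymbol\beta A_0$ out of $(Y_x,c_x,\xi_x)$; * $(r)_{*:1}\cdot\mathrm{id}_a=r$, $\;(\mathrm{id}_{b_x})_{x:\nu}\cdot r=r$ and $(t_{x,y})_{(x,y):\sum_{x:\nu}\xi_x}\cdot((s_x)_{x:\nu}\cdot r)=((t_{x,y})_{y:\xi_x}\cdot s_x)_{x:\nu}\cdot r$, where the sides are compared along $\mathfrak l$, $\mathfrak r$ and $\mathfrak m$; here $g\otimes\mathrm{id}$ and $\mathrm{id}\otimes(g_x)_{x:\nu}$ are the arrows of direct sums induced by $g$ and by $(g_x)_x$; 2. *lax $\underline{\boldsymbol\beta}$-algebra structures based on $A$*: pairs of transformations $\Gamma\colon1\Rightarrow A\circ(\eta_{A_0})_\diamond$ and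 $\Delta\colon A\circ\underline{\boldsymbol\beta}A\Rightarrow A\circ(\mu_{A_0})_\diamond$ such that the pasting of $\Gamma$, the cell of $\eta_\diamond$ at $A$, $\Delta$ and $\mathfrak l$, and the pasting of $\underline{\boldsymbol\beta}\Gamma$, $\Delta$ and $\mathfrak r$, are both the identity of $A$, and such that the pasting of $\underline{\boldsymbol\beta}\Delta$, $\Delta$ and $\mathfrak m$ equals the pasting of $\Delta$, the cell of $\mu_\diamond$ at $A$ and $\Delta$. The bijection can be chosen so that $(\Gamma,\Delta)$ corresponds to the structure in which $\mathrm{id}_a$ is the value of $\Gamma$ at the identity of $a$ and $(s_x)_{x:\nu}\cdot r$ is the value of $\Delta$ at the element of $(A\circ\underline{\boldsymbol\beta}A)(a,(X,(Y_x,c_x,\xi_x)_x,\nu))$ represented by $r$, by the ultrafamily $(b_x,(Y_x,c_x,\xi_x),s_x)_{x:\nu}$ of elements of $A$ and by two identities. -/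

import Mathlib

open CategoryTheory Opposite

universe w t

noncomputable section

namespace CategoryTheory.Profunctor

section Elements

variable {C D E : Type (w + 1)} [LargeCategory C] [LargeCategory D] [LargeCategory E]

/-- The set `F(d, c)` of elements of a profunctor `F : C ⇸ D`. -/
abbrev El (F : Profunctor.{t} C D) (d : D) (c : C) : Type t := (F.obj c).obj (op d)

/-- The action `F(f, g) : F(d, c) → F(d', c')` of a profunctor on a pair of arrows. -/
def act (F : Profunctor.{t} C D) {d' d : D} {c c' : C} (f : d' ⟶ d) (g : c ⟶ c')
    (x : F.El d c) : F.El d' c' :=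
  (F.map g).app (op d') ((F.obj c).map f.op x)

@[simp] theorem act_id (F : Profunctor.{t} C D) {d : D} {c : C} (x : F.El d c) :
    F.act (𝟙 d) (𝟙 c) x = x := by
  simp [act]

@[simp] theorem act_act (F : Profunctor.{t} C D) {d'' d' d : D} {c c' c'' : C}
    (f' : d'' ⟶ d') (f : d' ⟶ d) (g : c ⟶ c') (g' : c' ⟶ c'') (x : F.El d c) :
    F.act f' g' (F.act f g x) = F.act (f' ≫ f) (g ≫ g') x := by
  simp [act, NatTrans.naturality_apply]

/-- The component of a transformation of profunctors, applied to an element. -/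
def ap {F G : Profunctor.{t} C D} (σ : F ⟶ G) {d : D} {c : C} (x : F.El d c) : G.El d c :=
  (σ.app c).app (op d) x

@[simp] theorem ap_act {F G : Profunctor.{t} C D} (σ : F ⟶ G) {d' d : D} {c c' : C}
    (f : d' ⟶ d) (g : c ⟶ c') (x : F.El d c) :
    ap σ (F.act f g x) = G.act f g (ap σ x) := by
  have h := congrArg (fun k => k.app (op d')) (σ.naturality g)
  have h' := ConcreteCategory.congr_hom h ((F.obj c).map f.op x)
  simp only [ap, act]
  rw [← NatTrans.naturality_apply]
  exact h'

@[simp] theorem ap_id {F : Profunctor.{t} C D} {d : D} {c : C} (x : F.El d c) :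
    ap (𝟙 F) x = x := rfl

@[simp] theorem ap_comp {F G H : Profunctor.{t} C D} (σ : F ⟶ G) (τ : G ⟶ H) {d : D} {c : C}
    (x : F.El d c) : ap (σ ≫ τ) x = ap τ (ap σ x) := rfl

theorem hom_ext {F G : Profunctor.{t} C D} {σ τ : F ⟶ G}
    (h : ∀ (d : D) (c : C) (x : F.El d c), ap σ x = ap τ x) : σ = τ := by
  ext c d x
  exact h d.unop c x

/-- A transformation of profunctors from its action on elements. -/
def mkHom {F G : Profunctor.{t} C D} (φ : ∀ (d : D) (c : C), F.El d c → G.El d c)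
    (h : ∀ (d' d : D) (c c' : C) (f : d' ⟶ d) (g : c ⟶ c') (x : F.El d c),
      φ d' c' (F.act f g x) = G.act f g (φ d c x)) : F ⟶ G where
  app c :=
    { app := fun d => ↾(φ d.unop c)
      naturality := fun d d' f => by
        ext x
        have := h d'.unop d.unop c c f.unop (𝟙 c) x
        simpa [act] using this }
  naturality c c' g := by
    ext d x
    have := h d.unop d.unop c c' (𝟙 _) g x
    simpa [act] using this

@[simp] theorem ap_mkHom {F G : Profunctor.{t} C D}
    (φ : ∀ (d : D) (c : C), F.El d c → G.El d c) (h) {d : D} {c : C} (x : F.El d c) :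
    ap (mkHom φ h) x = φ d c x := rfl

/-- A profunctor from sets of elements and an action on them. -/
def ofAct (T : D → C → Type t)
    (a : ∀ {d' d : D} {c c' : C}, (d' ⟶ d) → (c ⟶ c') → T d c → T d' c')
    (a_id : ∀ (d : D) (c : C) (x : T d c), a (𝟙 d) (𝟙 c) x = x)
    (a_comp : ∀ (d'' d' d : D) (c c' c'' : C) (f' : d'' ⟶ d') (f : d' ⟶ d) (g : c ⟶ c')
      (g' : c' ⟶ c'') (x : T d c), a f' g' (a f g x) = a (f' ≫ f) (g ≫ g') x) :
    Profunctor.{t} C D :=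
  ofCore
    { obj := fun c d => T d c
      map := fun g f => ↾(a f g)
      map_id := fun c d => by ext x; exact a_id d c x
      map_comp := fun f f' g g' => by ext x; exact (a_comp _ _ _ _ _ _ _ _ _ _ x).symm }

theorem act_ofAct (T : D → C → Type t)
    (a : ∀ {d' d : D} {c c' : C}, (d' ⟶ d) → (c ⟶ c') → T d c → T d' c') (a_id) (a_comp)
    {d' d : D} {c c' : C} (f : d' ⟶ d) (g : c ⟶ c') (x : T d c) :
    (ofAct T a a_id a_comp).act f g x = a f g x := by
  change a (𝟙 d') g (a f (𝟙 c) x) = _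
  rw [a_comp, Category.id_comp, Category.id_comp]

/-! Companions and conjoints, identities -/

/-- `f_⋄`, the profunctor `C ⇸ D` with elements `d ⟶ f c`. -/
def companion (f : C ⥤ D) : Profunctor.{w + 1} C D := Profunctor.ulift.{w + 1} f.toProfunctor

/-- `f^⋄`, the profunctor `D ⇸ C` with elements `f c ⟶ d`. -/
def conjoint (f : C ⥤ D) : Profunctor.{w + 1} D C := Profunctor.ulift.{w + 1} f.toProfunctorRev


/-- The arrow underlying an element of `f_⋄`. -/
def companion.arr {f : C ⥤ D} {d : D} {c : C} (x : (companion f).El d c) : d ⟶ f.obj c := x.down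

/-- The element of `f_⋄` given by an arrow. -/
def companion.mk {f : C ⥤ D} {d : D} {c : C} (k : d ⟶ f.obj c) : (companion f).El d c := ⟨k⟩

@[simp] theorem companion.arr_mk {f : C ⥤ D} {d : D} {c : C} (k : d ⟶ f.obj c) :
    companion.arr (companion.mk (f := f) k) = k := rfl

@[simp] theorem companion.mk_arr {f : C ⥤ D} {d : D} {c : C} (x : (companion f).El d c) :
    companion.mk (companion.arr x) = x := rfl

@[simp] theorem act_companion (f : C ⥤ D) {d' d : D} {c c' : C} (k : d' ⟶ d) (g : c ⟶ c')
    (x : (companion f).El d c) :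
    (companion f).act k g x = companion.mk (k ≫ companion.arr x ≫ f.map g) :=
  ULift.ext _ _ (Category.assoc _ _ _)

/-- The arrow underlying an element of `f^⋄`. -/
def conjoint.arr {f : C ⥤ D} {d : D} {c : C} (x : (conjoint f).El c d) : f.obj c ⟶ d := x.down

/-- The element of `f^⋄` given by an arrow. -/
def conjoint.mk {f : C ⥤ D} {d : D} {c : C} (k : f.obj c ⟶ d) : (conjoint f).El c d := ⟨k⟩

@[simp] theorem conjoint.arr_mk {f : C ⥤ D} {d : D} {c : C} (k : f.obj c ⟶ d) :
    conjoint.arr (conjoint.mk (f := f) k) = k := rfl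

@[simp] theorem conjoint.mk_arr {f : C ⥤ D} {d : D} {c : C} (x : (conjoint f).El c d) :
    conjoint.mk (conjoint.arr x) = x := rfl

@[simp] theorem act_conjoint (f : C ⥤ D) {d' d : D} {c c' : C} (k : d ⟶ d') (g : c' ⟶ c)
    (x : (conjoint f).El c d) :
    (conjoint f).act g k x = conjoint.mk (f.map g ≫ conjoint.arr x ≫ k) :=
  ULift.ext _ _ (Category.assoc _ _ _)

/-- The identity profunctor, with elements `d ⟶ c`. -/
def ident (C : Type (w + 1)) [LargeCategory C] : Profunctor.{w + 1} C C :=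
  Profunctor.ulift.{w + 1} Profunctor.id

/-- The arrow underlying an element of the identity profunctor. -/
def ident.arr {d c : C} (x : (ident C).El d c) : d ⟶ c := x.down

/-- The element of the identity profunctor given by an arrow. -/
def ident.mk {d c : C} (k : d ⟶ c) : (ident C).El d c := ⟨k⟩

@[simp] theorem ident.arr_mk {d c : C} (k : d ⟶ c) : ident.arr (ident.mk k) = k := rfl

@[simp] theorem ident.mk_arr {d c : C} (x : (ident C).El d c) : ident.mk (ident.arr x) = x := rfl

@[simp] theorem act_ident {d' d c c' : C} (k : d' ⟶ d) (g : c ⟶ c') (x : (ident C).El d c) :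
    (ident C).act k g x = ident.mk (k ≫ ident.arr x ≫ g) :=
  ULift.ext _ _ (Category.assoc _ _ _)

/-! Composition of profunctors by coends -/

/-- A representative `(d, x ∈ G(e, d), y ∈ F(d, c))` of an element of `(G ∘ F)(e, c)`. -/
structure CompRep (F : Profunctor.{w + 1} C D) (G : Profunctor.{w + 1} D E) (e : E) (c : C) :
    Type (w + 1) where
  mid : D
  fst : G.El e mid
  snd : F.El mid c

/-- The relation generating the identifications in the coend `∫^d G(e, d) × F(d, c)`. -/
inductive CompRel (F : Profunctor.{w + 1} C D) (G : Profunctor.{w + 1} D E) (e : E) (c : C) :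
    CompRep F G e c → CompRep F G e c → Prop
  | slide {d d' : D} (h : d ⟶ d') (x : G.El e d) (y : F.El d' c) :
      CompRel F G e c ⟨d', G.act (𝟙 e) h x, y⟩ ⟨d, x, F.act h (𝟙 c) y⟩

/-- The set `(G ∘ F)(e, c) = ∫^d G(e, d) × F(d, c)`. -/
def CompEl (F : Profunctor.{w + 1} C D) (G : Profunctor.{w + 1} D E) (e : E) (c : C) :
    Type (w + 1) := Quot (CompRel F G e c)

/-- The class of `(d, x, y)` in `(G ∘ F)(e, c)`. -/
def CompEl.mk {F : Profunctor.{w + 1} C D} {G : Profunctor.{w + 1} D E} {e : E} {c : C} (d : D)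
    (x : G.El e d) (y : F.El d c) : CompEl F G e c := Quot.mk _ ⟨d, x, y⟩

theorem CompEl.slide {F : Profunctor.{w + 1} C D} {G : Profunctor.{w + 1} D E} {e : E} {c : C}
    {d d' : D} (h : d ⟶ d') (x : G.El e d) (y : F.El d' c) :
    CompEl.mk (F := F) d' (G.act (𝟙 e) h x) y = CompEl.mk d x (F.act h (𝟙 c) y) :=
  Quot.sound (CompRel.slide h x y)

theorem CompEl.ind {F : Profunctor.{w + 1} C D} {G : Profunctor.{w + 1} D E} {e : E} {c : C}
    {p : CompEl F G e c → Prop} (h : ∀ d x y, p (CompEl.mk d x y)) (z : CompEl F G e c) : p z :=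
  Quot.ind (fun ⟨d, x, y⟩ => h d x y) z

/-- Functions out of a coend. -/
def CompEl.lift {F : Profunctor.{w + 1} C D} {G : Profunctor.{w + 1} D E} {e : E} {c : C}
    {S : Type*} (φ : ∀ d, G.El e d → F.El d c → S)
    (h : ∀ {d d' : D} (h : d ⟶ d') (x : G.El e d) (y : F.El d' c),
      φ d' (G.act (𝟙 e) h x) y = φ d x (F.act h (𝟙 c) y)) : CompEl F G e c → S :=
  Quot.lift (fun r => φ r.mid r.fst r.snd) (by rintro _ _ ⟨k, x, y⟩; exact h k x y)

@[simp] theorem CompEl.lift_mk {F : Profunctor.{w + 1} C D} {G : Profunctor.{w + 1} D E} {e : E}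
    {c : C} {S : Type*} (φ : ∀ d, G.El e d → F.El d c → S) (h) (d : D) (x : G.El e d)
    (y : F.El d c) : CompEl.lift φ h (CompEl.mk d x y) = φ d x y := rfl

/-- The composite `G ∘ F : C ⇸ E` of `F : C ⇸ D` and `G : D ⇸ E`. -/
def comp (F : Profunctor.{w + 1} C D) (G : Profunctor.{w + 1} D E) : Profunctor.{w + 1} C E :=
  ofAct (CompEl F G)
    (fun {_ _ _ c'} f g => CompEl.lift
      (fun d x y => CompEl.mk d (G.act f (𝟙 d) x) (F.act (𝟙 d) g y))
      (fun h x y => by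
        have := CompEl.slide (F := F) h (G.act f (𝟙 _) x) (F.act (𝟙 _) g y)
        simpa using this))
    (fun e c x => by induction x using CompEl.ind; simp)
    (fun _ _ _ _ _ _ _ _ _ _ x => by induction x using CompEl.ind; simp)

/-- The element of a composite given by two elements. -/
def pair {F : Profunctor.{w + 1} C D} {G : Profunctor.{w + 1} D E} {e : E} {c : C} {d : D}
    (x : G.El e d) (y : F.El d c) : (comp F G).El e c := CompEl.mk d x y

theorem pair_slide {F : Profunctor.{w + 1} C D} {G : Profunctor.{w + 1} D E} {e : E} {c : C}
    {d d' : D} (h : d ⟶ d') (x : G.El e d) (y : F.El d' c) :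
    pair (G.act (𝟙 e) h x) y = pair x (F.act h (𝟙 c) y) := CompEl.slide h x y

theorem pair_ind {F : Profunctor.{w + 1} C D} {G : Profunctor.{w + 1} D E} {e : E} {c : C}
    {p : (comp F G).El e c → Prop} (h : ∀ (d : D) (x : G.El e d) (y : F.El d c), p (pair x y))
    (z : (comp F G).El e c) : p z := CompEl.ind h z

/-- Functions out of the set of elements of a composite. -/
def pairLift {F : Profunctor.{w + 1} C D} {G : Profunctor.{w + 1} D E} {e : E} {c : C}
    {S : Type*} (φ : ∀ {d : D}, G.El e d → F.El d c → S)
    (h : ∀ {d d' : D} (h : d ⟶ d') (x : G.El e d) (y : F.El d' c),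
      φ (G.act (𝟙 e) h x) y = φ x (F.act h (𝟙 c) y)) : (comp F G).El e c → S :=
  CompEl.lift (fun _ x y => φ x y) h

@[simp] theorem pairLift_pair {F : Profunctor.{w + 1} C D} {G : Profunctor.{w + 1} D E} {e : E}
    {c : C} {S : Type*} (φ : ∀ {d : D}, G.El e d → F.El d c → S) (h) {d : D} (x : G.El e d)
    (y : F.El d c) : pairLift φ h (pair x y) = φ x y := rfl

@[simp] theorem act_pair {F : Profunctor.{w + 1} C D} {G : Profunctor.{w + 1} D E} {e e' : E}
    {c c' : C} {d : D} (f : e' ⟶ e) (g : c ⟶ c') (x : G.El e d) (y : F.El d c) :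
    (comp F G).act f g (pair x y) = pair (G.act f (𝟙 d) x) (F.act (𝟙 d) g y) := by
  exact act_ofAct _ _ _ _ f g (CompEl.mk d x y)

/-- Transformations out of a composite of profunctors. -/
def compHom {F : Profunctor.{w + 1} C D} {G : Profunctor.{w + 1} D E} {H : Profunctor.{w + 1} C E}
    (φ : ∀ {e : E} {d : D} {c : C}, G.El e d → F.El d c → H.El e c)
    (slide : ∀ {e : E} {d d' : D} {c : C} (h : d ⟶ d') (x : G.El e d) (y : F.El d' c),
      φ (G.act (𝟙 e) h x) y = φ x (F.act h (𝟙 c) y))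
    (nat : ∀ {e e' : E} {d : D} {c c' : C} (f : e' ⟶ e) (g : c ⟶ c') (x : G.El e d)
      (y : F.El d c), φ (G.act f (𝟙 d) x) (F.act (𝟙 d) g y) = H.act f g (φ x y)) :
    comp F G ⟶ H :=
  mkHom (fun _ _ => CompEl.lift (fun _ x y => φ x y) slide) (by
    intro e' e c c' f g z
    induction z using pair_ind with
    | h d x y => rw [act_pair]; exact nat f g x y)

@[simp] theorem ap_compHom {F : Profunctor.{w + 1} C D} {G : Profunctor.{w + 1} D E}
    {H : Profunctor.{w + 1} C E} (φ : ∀ {e : E} {d : D} {c : C}, G.El e d → F.El d c → H.El e c)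
    (slide) (nat) {e : E} {d : D} {c : C} (x : G.El e d) (y : F.El d c) :
    ap (compHom (F := F) (G := G) (H := H) φ slide nat) (pair x y) = φ x y := rfl

theorem compHom_ext {F : Profunctor.{w + 1} C D} {G : Profunctor.{w + 1} D E}
    {H : Profunctor.{w + 1} C E} {σ τ : comp F G ⟶ H}
    (h : ∀ {e : E} {d : D} {c : C} (x : G.El e d) (y : F.El d c),
      ap σ (pair x y) = ap τ (pair x y)) : σ = τ := by
  apply hom_ext
  intro e c z
  induction z using pair_ind with
  | h d x y => exact h x y

end Elements

end CategoryTheory.Profunctor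

open CategoryTheory.Profunctor

/-- The objects of the bicategory of profunctors: locally small categories. -/
structure PROF : Type (w + 2) where
  carrier : Type (w + 1)
  [str : LargeCategory carrier]

attribute [instance] PROF.str

namespace PROF

instance : CategoryStruct PROF.{w} where
  Hom C D := Profunctor.{w + 1} C.carrier D.carrier
  id C := ident C.carrier
  comp F G := Profunctor.comp F G

instance homCat (C D : PROF.{w}) : Category (C ⟶ D) :=
  inferInstanceAs (Category (Profunctor.{w + 1} C.carrier D.carrier))

section
variable {C D E : Type (w + 1)} [LargeCategory C] [LargeCategory D] [LargeCategory E]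
variable {E' : Type (w + 1)} [LargeCategory E']

def whiskerL (F : Profunctor.{w + 1} C D) {G G' : Profunctor.{w + 1} D E} (σ : G ⟶ G') :
    Profunctor.comp F G ⟶ Profunctor.comp F G' :=
  compHom (fun x y => pair (ap σ x) y) (by intros; simp [pair_slide]) (by intros; simp)

def whiskerR {F F' : Profunctor.{w + 1} C D} (σ : F ⟶ F') (G : Profunctor.{w + 1} D E) :
    Profunctor.comp F G ⟶ Profunctor.comp F' G :=
  compHom (fun x y => pair x (ap σ y)) (by intros; simp [pair_slide]) (by intros; simp)

def assocHom (F : Profunctor.{w + 1} C D) (G : Profunctor.{w + 1} D E)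
    (H : Profunctor.{w + 1} E E') :
    Profunctor.comp (Profunctor.comp F G) H ⟶ Profunctor.comp F (Profunctor.comp G H) :=
  compHom (fun x => pairLift (fun y z => pair (pair x y) z)
      (by intro d d' h y z; rw [← pair_slide]; simp))
    (by
      intro e d d' c h x y
      induction y using pair_ind with
      | h y z => simp only [act_pair, pairLift_pair]; rw [pair_slide]; simp)
    (by
      intro d' d e c c' f g x y
      induction y using pair_ind with
      | h y z => simp)

def assocInv (F : Profunctor.{w + 1} C D) (G : Profunctor.{w + 1} D E)
    (H : Profunctor.{w + 1} E E') :
    Profunctor.comp F (Profunctor.comp G H) ⟶ Profunctor.comp (Profunctor.comp F G) H :=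
  compHom (fun x z => pairLift (fun x y => pair x (pair y z))
      (by intro d d' h x y; rw [pair_slide]; simp) x)
    (by
      intro e d d' c h x z
      induction x using pair_ind with
      | h x y => simp only [act_pair, pairLift_pair]; rw [← pair_slide]; simp)
    (by
      intro d' d e c c' f g x z
      induction x using pair_ind with
      | h x y => simp)

def lunit (F : Profunctor.{w + 1} C D) : Profunctor.comp (ident C) F ≅ F where
  hom := compHom (fun x y => F.act (𝟙 _) (ident.arr y) x) (by intros; simp) (by intros; simp)
  inv := mkHom (fun _ c x => pair x (ident.mk (𝟙 c))) (by
    intro d' d c c' f g x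
    have := pair_slide (F := ident C) g (F.act f (𝟙 _) x) (ident.mk (𝟙 c'))
    simpa using this)
  hom_inv_id := by
    apply compHom_ext
    intro e d c x y
    have := pair_slide (F := ident _) (ident.arr y) x (ident.mk (𝟙 c))
    simpa using this
  inv_hom_id := by
    apply hom_ext
    intro e c x
    simp

def runit (F : Profunctor.{w + 1} C D) : Profunctor.comp F (ident D) ≅ F where
  hom := compHom (fun x y => F.act (ident.arr x) (𝟙 _) y) (by intros; simp) (by intros; simp)
  inv := mkHom (fun d _ x => pair (ident.mk (𝟙 d)) x) (by
    intro d' d c c' f g x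
    have := pair_slide (G := ident D) f (ident.mk (𝟙 d')) (F.act (𝟙 _) g x)
    simpa using this.symm)
  hom_inv_id := by
    apply compHom_ext
    intro e d c x y
    have := pair_slide (G := ident _) (ident.arr x) (ident.mk (𝟙 e)) y
    simpa using this.symm
  inv_hom_id := by
    apply hom_ext
    intro e c x
    simp

theorem ident_whiskerL {F G : Profunctor.{w + 1} C D} (σ : F ⟶ G) :
    whiskerL (ident C) σ = (lunit F).hom ≫ σ ≫ (lunit G).inv := by
  apply compHom_ext
  intro e d c x y
  have := pair_slide (F := ident _) (ident.arr y) (ap σ x) (ident.mk (𝟙 c))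
  simpa [lunit, whiskerL] using this.symm

theorem whiskerR_ident {F G : Profunctor.{w + 1} C D} (σ : F ⟶ G) :
    whiskerR σ (ident D) = (runit F).hom ≫ σ ≫ (runit G).inv := by
  apply compHom_ext
  intro e d c x y
  have := pair_slide (G := ident _) (ident.arr x) (ident.mk (𝟙 e)) (ap σ y)
  simpa [runit, whiskerR] using this

theorem triangle_aux (F : Profunctor.{w + 1} C D) (G : Profunctor.{w + 1} D E) :
    assocHom F (ident D) G ≫ whiskerL F (lunit G).hom = whiskerR (runit F).hom G := by
  apply compHom_ext
  intro e d c x y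
  induction y using pair_ind with
  | h d' y z =>
    have := pair_slide (F := F) (G := G) (ident.arr y) x z
    simpa [lunit, runit, whiskerL, whiskerR, assocHom] using this

theorem pentagon_aux {E'' : Type (w + 1)} [LargeCategory E''] (F : Profunctor.{w + 1} C D)
    (G : Profunctor.{w + 1} D E) (H : Profunctor.{w + 1} E E') (K : Profunctor.{w + 1} E' E'') :
    whiskerR (assocHom F G H) K ≫ assocHom F (Profunctor.comp G H) K ≫
      whiskerL F (assocHom G H K) =
    assocHom (Profunctor.comp F G) H K ≫ assocHom F G (Profunctor.comp H K) := by
  apply compHom_ext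
  intro e d c x y
  induction y using pair_ind with
  | h d' y z =>
    induction z using pair_ind with
    | h d'' z u => rfl

end

instance : Bicategory PROF.{w} where
  homCategory := homCat
  whiskerLeft F _ _ σ := whiskerL F σ
  whiskerRight σ G := whiskerR σ G
  associator F G H :=
    { hom := assocHom F G H
      inv := assocInv F G H
      hom_inv_id := by
        apply compHom_ext
        intro e d c x y
        induction y using pair_ind with
        | h y z => rfl
      inv_hom_id := by
        apply compHom_ext
        intro e d c x y
        induction x using pair_ind with
        | h y z => rfl }
  leftUnitor F := lunit F
  rightUnitor F := runit F
  whiskerLeft_id _ _ := compHom_ext fun _ _ => rfl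
  whiskerLeft_comp _ _ _ _ _ _ := compHom_ext fun _ _ => rfl
  id_whiskerLeft σ := ident_whiskerL σ
  comp_whiskerLeft _ _ _ _ _ := by
    apply compHom_ext
    intro e d c x y
    induction y using pair_ind with
    | h y z => rfl
  id_whiskerRight _ _ := compHom_ext fun _ _ => rfl
  comp_whiskerRight _ _ _ := compHom_ext fun _ _ => rfl
  whiskerRight_id σ := whiskerR_ident σ
  whiskerRight_comp _ _ _ := by
    apply compHom_ext
    intro e d c x y
    induction x using pair_ind with
    | h y z => rfl
  whisker_assoc _ _ _ _ _ := by
    apply compHom_ext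
    intro e d c x y
    induction y using pair_ind with
    | h y z => rfl
  whisker_exchange _ _ := compHom_ext fun _ _ => rfl
  pentagon F G H K := pentagon_aux F G H K
  triangle F G := triangle_aux F G

end PROF

/-! The category `𝛃 C` of ultrafamilies -/

section Beta

variable {C D E : Type (w + 1)} [LargeCategory C] [LargeCategory D] [LargeCategory E]

/-- An ultrafamily `(X, h, ν)` of objects of `C`. -/
structure Beta (C : Type (w + 1)) [LargeCategory C] : Type (w + 1) where
  X : Type w
  fam : X → C
  ν : Ultrafilter X

namespace Beta

/-- A pair `(g, α)` of a function `g : Q.X → P.X` carrying `Q.ν` to `P.ν` and of arrows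
`α y : P.fam (g y) ⟶ Q.fam y`, packed as `y ↦ ⟨g y, α y⟩`. -/
structure PreHom (P Q : Beta C) : Type w where
  toFun : ∀ y : Q.X, Σ x : P.X, (P.fam x ⟶ Q.fam y)
  map_eq : Q.ν.map (fun y => (toFun y).1) = P.ν

/-- Two pairs `(g, α)` and `(g', α')` are identified when they agree on a set in `Q.ν`. -/
instance PreHom.setoid (P Q : Beta C) : Setoid (PreHom P Q) where
  r φ ψ := ∀ᶠ y in (Q.ν : Filter Q.X), φ.toFun y = ψ.toFun y
  iseqv :=
    ⟨fun _ => Filter.Eventually.of_forall fun _ => rfl,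
      fun h => h.mono fun _ hy => hy.symm,
      fun h h' => by filter_upwards [h, h'] with y hy hy' using hy.trans hy'⟩

/-- Properties that hold almost everywhere pull back along arrows of ultrafamilies. -/
theorem eventually_comap {X Y : Type w} {ν : Ultrafilter X} {ξ : Ultrafilter Y} {g : Y → X}
    (hg : ξ.map g = ν) {p : X → Prop} (h : ∀ᶠ x in (ν : Filter X), p x) :
    ∀ᶠ y in (ξ : Filter Y), p (g y) := by
  subst hg
  exact h

/-- The identity pair. -/
def PreHom.id (P : Beta C) : PreHom P P := ⟨fun x => ⟨x, 𝟙 _⟩, rfl⟩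

/-- Composition of pairs. -/
def PreHom.comp {P Q S : Beta C} (φ : PreHom P Q) (ψ : PreHom Q S) : PreHom P S where
  toFun z := ⟨(φ.toFun (ψ.toFun z).1).1, (φ.toFun (ψ.toFun z).1).2 ≫ (ψ.toFun z).2⟩
  map_eq := by rw [← φ.map_eq, ← ψ.map_eq]; rfl

theorem PreHom.comp_congr {P Q S : Beta C} {φ φ' : PreHom P Q} {ψ ψ' : PreHom Q S}
    (h : φ ≈ φ') (h' : ψ ≈ ψ') : φ.comp ψ ≈ φ'.comp ψ' := by
  have h1 := eventually_comap ψ.map_eq h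
  filter_upwards [h1, h'] with z h1 h2
  simp only [PreHom.comp]
  rw [h1, h2]

instance : LargeCategory (Beta C) where
  Hom P Q := Quotient (PreHom.setoid P Q)
  id P := Quotient.mk _ (PreHom.id P)
  comp := Quotient.map₂ PreHom.comp fun _ _ h _ _ h' => PreHom.comp_congr h h'
  id_comp f := by
    induction f using Quotient.ind
    exact Quotient.sound (Filter.Eventually.of_forall fun _ => by simp [PreHom.comp, PreHom.id])
  comp_id f := by
    induction f using Quotient.ind
    exact Quotient.sound (Filter.Eventually.of_forall fun _ => by simp [PreHom.comp, PreHom.id])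
  assoc f g h := by
    induction f using Quotient.ind
    induction g using Quotient.ind
    induction h using Quotient.ind
    exact Quotient.sound (Filter.Eventually.of_forall fun _ => by simp [PreHom.comp])

/-- The arrow of ultrafamilies represented by a pair. -/
def PreHom.toHom {P Q : Beta C} (φ : PreHom P Q) : P ⟶ Q := Quotient.mk _ φ

theorem hom_ind {P Q : Beta C} {p : (P ⟶ Q) → Prop} (h : ∀ φ : PreHom P Q, p φ.toHom)
    (f : P ⟶ Q) : p f := Quotient.ind h f

/-- A representative of an arrow of ultrafamilies. -/
def rep {P Q : Beta C} (f : P ⟶ Q) : PreHom P Q := Quotient.out f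

@[simp] theorem toHom_rep {P Q : Beta C} (f : P ⟶ Q) : (rep f).toHom = f := Quotient.out_eq f

theorem toHom_eq {P Q : Beta C} {φ ψ : PreHom P Q} :
    φ.toHom = ψ.toHom ↔ ∀ᶠ y in (Q.ν : Filter Q.X), φ.toFun y = ψ.toFun y :=
  Quotient.eq (r := PreHom.setoid P Q)

theorem toHom_comp {P Q S : Beta C} (φ : PreHom P Q) (ψ : PreHom Q S) :
    φ.toHom ≫ ψ.toHom = (φ.comp ψ).toHom := rfl

theorem toHom_id (P : Beta C) : (PreHom.id P).toHom = 𝟙 P := rfl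

theorem rep_toHom {P Q : Beta C} (φ : PreHom P Q) :
    ∀ᶠ y in (Q.ν : Filter Q.X), (rep φ.toHom).toFun y = φ.toFun y :=
  toHom_eq.1 (toHom_rep _)

theorem rep_id (P : Beta C) :
    ∀ᶠ x in (P.ν : Filter P.X), (rep (𝟙 P)).toFun x = ⟨x, 𝟙 _⟩ :=
  rep_toHom (PreHom.id P)

theorem rep_comp {P Q S : Beta C} (f : P ⟶ Q) (g : Q ⟶ S) :
    ∀ᶠ z in (S.ν : Filter S.X), (rep (f ≫ g)).toFun z = ((rep f).comp (rep g)).toFun z :=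
  toHom_eq.1 (by rw [← toHom_comp]; simp)

/-- The ultrafamily `(X, f ∘ h, ν)`. -/
def mapObj (f : C ⥤ D) (P : Beta C) : Beta D := ⟨P.X, fun x => f.obj (P.fam x), P.ν⟩

/-- The pair `(g, f * α)`. -/
def PreHom.map (f : C ⥤ D) {P Q : Beta C} (φ : PreHom P Q) :
    PreHom (mapObj f P) (mapObj f Q) :=
  ⟨fun y => ⟨(φ.toFun y).1, f.map (φ.toFun y).2⟩, φ.map_eq⟩

theorem PreHom.map_congr (f : C ⥤ D) {P Q : Beta C} {φ ψ : PreHom P Q} (h : φ ≈ ψ) :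
    φ.map f ≈ ψ.map f := by
  filter_upwards [h] with y hy
  simp only [PreHom.map]
  rw [hy]

/-- The functor `𝛃 f : 𝛃 C ⥤ 𝛃 D`. -/
def map (f : C ⥤ D) : Beta C ⥤ Beta D where
  obj P := mapObj f P
  map {P Q} := Quotient.map (PreHom.map f) fun _ _ h => PreHom.map_congr f h
  map_id P := Quotient.sound (Filter.Eventually.of_forall fun _ => by
    simp [PreHom.id, PreHom.map, mapObj])
  map_comp g h := by
    induction g using Quotient.ind
    induction h using Quotient.ind
    exact Quotient.sound (Filter.Eventually.of_forall fun _ => by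
      simp only [PreHom.comp, PreHom.map, Functor.map_comp]; rfl)

theorem map_toHom (f : C ⥤ D) {P Q : Beta C} (φ : PreHom P Q) :
    (map f).map φ.toHom = (φ.map f).toHom := rfl

/-- The unit `η : C ⥤ 𝛃 C`, with `η c = (1, c, 1)`. -/
def unit (C : Type (w + 1)) [LargeCategory C] : C ⥤ Beta C where
  obj c := ⟨PUnit, fun _ => c, pure PUnit.unit⟩
  map t := PreHom.toHom ⟨fun x => ⟨x, t⟩, rfl⟩
  map_comp _ _ := rfl

/-- The direct sum `∑_{x : ν} ξ x` of ultrafilters: a subset `S` of `Σ x, Y x` belongs to it if and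
only if, for `ν`-almost all `x`, for `ξ x`-almost all `y`, the pair `(x, y)` is in `S`. -/
def sumUltrafilter {X : Type w} (ν : Ultrafilter X) {Y : X → Type w} (ξ : ∀ x, Ultrafilter (Y x)) :
    Ultrafilter (Σ x, Y x) := ν.bind fun x => (ξ x).map (Sigma.mk x)

theorem eventually_sum {X : Type w} (ν : Ultrafilter X) {Y : X → Type w}
    (ξ : ∀ x, Ultrafilter (Y x)) {p : (Σ x, Y x) → Prop} :
    (∀ᶠ z in (sumUltrafilter ν ξ : Filter (Σ x, Y x)), p z) ↔
      ∀ᶠ x in (ν : Filter X), ∀ᶠ y in (ξ x : Filter (Y x)), p ⟨x, y⟩ := Iff.rfl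

theorem ultrafilter_ext {X : Type w} {ν ν' : Ultrafilter X}
    (h : ∀ p : X → Prop, (∀ᶠ x in (ν : Filter X), p x) → ∀ᶠ x in (ν' : Filter X), p x) :
    ν' = ν := by
  apply Ultrafilter.coe_injective
  exact le_antisymm (fun s hs => h (· ∈ s) hs) (by
    have : (ν' : Filter X) ≤ ν := fun s hs => h (· ∈ s) hs
    exact (Ultrafilter.coe_le_coe.1 this).symm ▸ le_rfl)

/-- The direct sum `μ (X, H, ν)` of an ultrafamily of ultrafamilies. -/
def sum (P : Beta (Beta C)) : Beta C :=
  ⟨Σ x : P.X, (P.fam x).X, fun z => (P.fam z.1).fam z.2, sumUltrafilter P.ν fun x => (P.fam x).ν⟩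

theorem sum_map_eq {X X' : Type w} {ν : Ultrafilter X} {ν' : Ultrafilter X'} {Y : X → Type w}
    {Y' : X' → Type w} {ξ : ∀ x, Ultrafilter (Y x)} {ξ' : ∀ x, Ultrafilter (Y' x)}
    (g : X' → X) (hg : ν'.map g = ν) (a : ∀ x', Y' x' → Y (g x'))
    (ha : ∀ x', (ξ' x').map (a x') = ξ (g x')) :
    (sumUltrafilter ν' ξ').map (fun z => (⟨g z.1, a z.1 z.2⟩ : Σ x, Y x)) = sumUltrafilter ν ξ := by
  apply ultrafilter_ext
  intro p hp
  have hp' := eventually_comap hg ((eventually_sum _ _).1 hp)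
  refine (eventually_sum _ _).2 ?_
  filter_upwards [hp'] with x hx
  exact eventually_comap (ha x) hx

/-- The pair on direct sums induced by a pair of ultrafamilies of ultrafamilies. -/
def PreHom.sum {P Q : Beta (Beta C)} (φ : PreHom P Q) : PreHom (Beta.sum P) (Beta.sum Q) where
  toFun z := ⟨⟨(φ.toFun z.1).1, ((rep (φ.toFun z.1).2).toFun z.2).1⟩,
    ((rep (φ.toFun z.1).2).toFun z.2).2⟩
  map_eq := sum_map_eq (ξ := fun x => (P.fam x).ν) (ξ' := fun y => (Q.fam y).ν)
    (fun y => (φ.toFun y).1) φ.map_eq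
    (fun y z => ((rep (φ.toFun y).2).toFun z).1) (fun y => (rep (φ.toFun y).2).map_eq)

theorem PreHom.sum_congr {P Q : Beta (Beta C)} {φ ψ : PreHom P Q} (h : φ ≈ ψ) :
    φ.sum ≈ ψ.sum := by
  refine (eventually_sum _ _).2 ?_
  filter_upwards [h] with y hy
  refine Filter.Eventually.of_forall fun z => ?_
  simp only [PreHom.sum]
  rw [hy]

/-- The multiplication `μ : 𝛃 (𝛃 C) ⥤ 𝛃 C`. -/
def mult (C : Type (w + 1)) [LargeCategory C] : Beta (Beta C) ⥤ Beta C where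
  obj := sum
  map := Quotient.map PreHom.sum fun _ _ h => PreHom.sum_congr h
  map_id P := Quotient.sound ((eventually_sum _ _).2 (Filter.Eventually.of_forall fun x => by
    filter_upwards [rep_id (P.fam x)] with z hz
    simp only [PreHom.sum, PreHom.id]
    rw [hz]; rfl))
  map_comp f g := by
    induction f using Quotient.ind with | _ φ
    induction g using Quotient.ind with | _ ψ
    refine Quotient.sound ((eventually_sum _ _).2 (Filter.Eventually.of_forall fun x => ?_))
    filter_upwards [rep_comp (φ.toFun (ψ.toFun x).1).2 (ψ.toFun x).2] with z hz
    simp only [PreHom.sum, PreHom.comp]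
    rw [hz]; rfl

theorem mult_map_toHom {P Q : Beta (Beta C)} (φ : PreHom P Q) :
    (mult C).map φ.toHom = φ.sum.toHom := rfl

theorem sigma_eqToHom {X : Type w} {b : X → C} {c : C} {x x' : X} (h : x = x') (k : b x ⟶ c) :
    (⟨x, k⟩ : Σ x, b x ⟶ c) = ⟨x', eqToHom (by rw [h]) ≫ k⟩ := by
  subst h
  simp

/-- Reindexing an ultrafamily along a bijection is an isomorphism. -/
def reindexIso {P Q : Beta C} (e : Q.X ≃ P.X) (h : Q.ν.map e = P.ν)
    (hfam : ∀ y, P.fam (e y) = Q.fam y) : P ≅ Q where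
  hom := PreHom.toHom ⟨fun y => ⟨e y, eqToHom (hfam y)⟩, h⟩
  inv := PreHom.toHom ⟨fun x => ⟨e.symm x, eqToHom (by rw [← hfam, e.apply_symm_apply])⟩, by
    rw [← h, Ultrafilter.map_map]
    exact (congrArg (Ultrafilter.map · Q.ν) (funext fun y => e.symm_apply_apply y)).trans
      (Ultrafilter.map_id _)⟩
  hom_inv_id := toHom_eq.2 (Filter.Eventually.of_forall fun x => by
    simp only [PreHom.comp, PreHom.id, eqToHom_trans]
    rw [sigma_eqToHom (e.apply_symm_apply x)]
    simp)
  inv_hom_id := toHom_eq.2 (Filter.Eventually.of_forall fun x => by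
    simp only [PreHom.comp, PreHom.id, eqToHom_trans]
    rw [sigma_eqToHom (e.symm_apply_apply x)]
    simp)

/-- The direct sum indexed by a point: `μ (1, P, 1) ≅ P`. -/
def sumUnitIso (P : Beta C) : sum ((unit (Beta C)).obj P) ≅ P :=
  reindexIso (Equiv.mk (fun x => ⟨PUnit.unit, x⟩) (fun z => z.2) (fun _ => rfl) (fun _ => rfl))
    rfl (fun _ => rfl)

/-- A direct sum of points: `μ (X, (1, h x, 1)_x, ν) ≅ (X, h, ν)`. -/
def sumMapUnitIso (P : Beta C) : sum ((map (unit C)).obj P) ≅ P :=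
  reindexIso (Equiv.mk (fun x => ⟨x, PUnit.unit⟩) (fun z => z.1) (fun _ => rfl) (fun _ => rfl))
    rfl (fun _ => rfl)

/-- The two iterated direct sums of an ultrafamily of ultrafamilies of ultrafamilies, indexed by
triples `(x, (y, z))` and by triples `((x, y), z)`, are isomorphic. -/
def sumSumIso (P : Beta (Beta (Beta C))) : sum ((map (mult C)).obj P) ≅ sum (sum P) :=
  reindexIso (Equiv.mk (fun z => ⟨z.1.1, ⟨z.1.2, z.2⟩⟩) (fun z => ⟨⟨z.1, z.2.1⟩, z.2.2⟩)
    (fun _ => rfl) (fun _ => rfl)) rfl (fun _ => rfl)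

/-- `𝔩 : μ ∘ η 𝛃 ≅ 1`. -/
def unitMult (C : Type (w + 1)) [LargeCategory C] : unit (Beta C) ⋙ mult C ≅ 𝟭 (Beta C) :=
  NatIso.ofComponents sumUnitIso (by
    intro P Q f
    induction f using hom_ind with | _ φ
    refine Quotient.sound ?_
    filter_upwards [rep_toHom φ] with x hx
    have key : ∀ s s' : (Σ y, P.fam y ⟶ Q.fam x), s = s' →
      (⟨⟨PUnit.unit, s.1⟩, s.2 ≫ 𝟙 _⟩ : Σ z : (Σ _ : PUnit, P.X), P.fam z.2 ⟶ Q.fam x) =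
        ⟨⟨PUnit.unit, s'.1⟩, 𝟙 _ ≫ s'.2⟩ := by
      rintro s _ rfl
      simp
    exact key _ _ hx)

/-- `𝔯 : μ ∘ 𝛃 η ≅ 1`. -/
def mapUnitMult (C : Type (w + 1)) [LargeCategory C] : map (unit C) ⋙ mult C ≅ 𝟭 (Beta C) :=
  NatIso.ofComponents sumMapUnitIso (by
    intro P Q f
    induction f using hom_ind with | _ φ
    refine Quotient.sound (Filter.Eventually.of_forall fun x => ?_)
    have hx := rep_toHom (PreHom.mk (P := (unit C).obj (P.fam (φ.toFun x).1))
      (Q := (unit C).obj (Q.fam x)) (fun u => ⟨u, (φ.toFun x).2⟩) rfl)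
    have hx' := Filter.eventually_pure.1 hx
    have key : ∀ s s' : (Σ _ : PUnit.{w + 1}, P.fam (φ.toFun x).1 ⟶ Q.fam x), s = s' →
      (⟨⟨(φ.toFun x).1, s.1⟩, s.2 ≫ 𝟙 _⟩ :
        Σ z : (Σ _ : P.X, PUnit.{w + 1}), P.fam z.1 ⟶ Q.fam x) =
        ⟨⟨(φ.toFun x).1, s'.1⟩, 𝟙 _ ≫ s'.2⟩ := by
      rintro s _ rfl
      simp
    exact key _ _ hx')

/-- `𝔪 : μ ∘ 𝛃 μ ≅ μ ∘ μ 𝛃`. -/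
def multMult (C : Type (w + 1)) [LargeCategory C] :
    map (mult C) ⋙ mult C ≅ mult (Beta C) ⋙ mult C :=
  NatIso.ofComponents sumSumIso (by
    intro P Q f
    induction f using hom_ind with | _ φ
    refine Quotient.sound ((eventually_sum _ _).2 ((eventually_sum _ _).2
      (Filter.Eventually.of_forall fun x => ?_)))
    have h2 : ∀ᶠ u in ((sum (Q.fam x)).ν : Filter (sum (Q.fam x)).X),
        (rep ((mult C).map (φ.toFun x).2)).toFun u = (rep (φ.toFun x).2).sum.toFun u :=
      toHom_eq.1 ((toHom_rep _).trans ((congrArg (mult C).map (toHom_rep (φ.toFun x).2)).symm))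
    filter_upwards [(eventually_sum _ _).1 h2] with y hy
    filter_upwards [hy] with z hz
    have key : ∀ s s' : (Σ u : (Σ y' : (P.fam (φ.toFun x).1).X, ((P.fam (φ.toFun x).1).fam y').X),
        ((P.fam (φ.toFun x).1).fam u.1).fam u.2 ⟶ ((Q.fam x).fam y).fam z), s = s' →
      (⟨⟨(φ.toFun x).1, s.1⟩, s.2 ≫ 𝟙 _⟩ :
        Σ v : (Σ x' : P.X, Σ y' : (P.fam x').X, ((P.fam x').fam y').X),
          ((P.fam v.1).fam v.2.1).fam v.2.2 ⟶ ((Q.fam x).fam y).fam z) =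
        ⟨⟨(φ.toFun x).1, s'.1⟩, 𝟙 _ ≫ s'.2⟩ := by
      rintro s _ rfl
      simp
    exact key _ _ hz)

end Beta

end Beta

/-! Ultrafamilies of elements of a profunctor -/

section Fam

variable {C D E : Type (w + 1)} [LargeCategory C] [LargeCategory D] [LargeCategory E]

/-- A function `P.X → Q.X` carrying `P.ν` to `Q.ν` and elements `s y ∈ F(Q.fam x, P.fam y)`, where
`x` is the image of `y`, packed as `y ↦ ⟨x, s y⟩`. -/
structure Fam (F : Profunctor.{w + 1} C D) (Q : Beta D) (P : Beta C) : Type (w + 1) where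
  toFun : ∀ y : P.X, Σ x : Q.X, F.El (Q.fam x) (P.fam y)
  map_eq : P.ν.map (fun y => (toFun y).1) = Q.ν

namespace Fam

open Beta (rep PreHom)

/-- Families are identified when they agree on a set in `P.ν`. -/
instance setoid (F : Profunctor.{w + 1} C D) (Q : Beta D) (P : Beta C) : Setoid (Fam F Q P) where
  r φ ψ := ∀ᶠ y in (P.ν : Filter P.X), φ.toFun y = ψ.toFun y
  iseqv :=
    ⟨fun _ => Filter.Eventually.of_forall fun _ => rfl,
      fun h => h.mono fun _ hy => hy.symm,
      fun h h' => by filter_upwards [h, h'] with y hy hy' using hy.trans hy'⟩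

/-- The action of arrows of ultrafamilies on families. -/
def act {F : Profunctor.{w + 1} C D} {Q' Q : Beta D} {P P' : Beta C} (k : PreHom Q' Q)
    (l : PreHom P P') (φ : Fam F Q P) : Fam F Q' P' where
  toFun z := ⟨(k.toFun (φ.toFun (l.toFun z).1).1).1,
    F.act (k.toFun (φ.toFun (l.toFun z).1).1).2 (l.toFun z).2 (φ.toFun (l.toFun z).1).2⟩
  map_eq := by rw [← k.map_eq, ← φ.map_eq, ← l.map_eq]; rfl

theorem act_congr {F : Profunctor.{w + 1} C D} {Q' Q : Beta D} {P P' : Beta C} {k k' : PreHom Q' Q}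
    {l l' : PreHom P P'} {φ φ' : Fam F Q P} (hk : k ≈ k') (hl : l ≈ l') (h : φ ≈ φ') :
    φ.act k l ≈ φ'.act k' l' := by
  have h1 := Beta.eventually_comap l.map_eq h
  have h2 := Beta.eventually_comap l.map_eq (Beta.eventually_comap φ.map_eq hk)
  filter_upwards [h1, h2, hl] with y h1 h2 hl
  simp only [act]
  rw [← hl, ← h1, ← h2]

theorem rep_id (P : Beta C) : rep (𝟙 P) ≈ PreHom.id P := Beta.rep_id P

theorem rep_toHom {P Q : Beta C} (φ : PreHom P Q) : rep φ.toHom ≈ φ := Beta.rep_toHom φ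

theorem rep_comp {P Q S : Beta C} (f : P ⟶ Q) (g : Q ⟶ S) :
    rep (f ≫ g) ≈ (rep f).comp (rep g) := Beta.rep_comp f g

/-- The profunctor `𝛃 C ⇸ 𝛃 D` of classes of families of elements of `F : C ⇸ D`. -/
def prof (F : Profunctor.{w + 1} C D) : Profunctor.{w + 1} (Beta C) (Beta D) :=
  ofAct (fun Q P => Quotient (setoid F Q P))
    (fun k l => Quotient.map (act (rep k) (rep l))
      fun _ _ h => act_congr (Setoid.refl _) (Setoid.refl _) h)
    (fun Q P φ => by
      induction φ using Quotient.ind with | _ φ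
      refine Quotient.sound (Setoid.trans (act_congr (rep_id _) (rep_id _) (Setoid.refl φ)) ?_)
      exact Filter.Eventually.of_forall fun y => by simp [act, PreHom.id])
    (fun _ _ _ _ _ _ k' k l l' φ => by
      induction φ using Quotient.ind with | _ φ
      refine Quotient.sound (Setoid.symm
        (Setoid.trans (act_congr (rep_comp _ _) (rep_comp _ _) (Setoid.refl φ)) ?_))
      exact Filter.Eventually.of_forall fun y => by simp [act, PreHom.comp])

/-- The class of a family. -/
def cls {F : Profunctor.{w + 1} C D} {Q : Beta D} {P : Beta C} (φ : Fam F Q P) :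
    (prof F).El Q P := Quotient.mk (setoid F Q P) φ

theorem ind {F : Profunctor.{w + 1} C D} {Q : Beta D} {P : Beta C} {p : (prof F).El Q P → Prop}
    (h : ∀ φ : Fam F Q P, p φ.cls) (s : (prof F).El Q P) : p s := Quotient.ind h s

theorem cls_eq {F : Profunctor.{w + 1} C D} {Q : Beta D} {P : Beta C} {φ ψ : Fam F Q P} :
    φ.cls = ψ.cls ↔ ∀ᶠ y in (P.ν : Filter P.X), φ.toFun y = ψ.toFun y :=
  Quotient.eq (r := setoid F Q P)

/-- Functions out of the set of classes of families. -/
def lift {F : Profunctor.{w + 1} C D} {Q : Beta D} {P : Beta C} {S : Type*} (φ : Fam F Q P → S)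
    (h : ∀ s s' : Fam F Q P, s ≈ s' → φ s = φ s') : (prof F).El Q P → S := Quotient.lift φ h

@[simp] theorem lift_cls {F : Profunctor.{w + 1} C D} {Q : Beta D} {P : Beta C} {S : Type*}
    (φ : Fam F Q P → S) (h) (s : Fam F Q P) : lift φ h s.cls = φ s := rfl

theorem act_cls {F : Profunctor.{w + 1} C D} {Q' Q : Beta D} {P P' : Beta C} (k : PreHom Q' Q)
    (l : PreHom P P') (φ : Fam F Q P) :
    (prof F).act k.toHom l.toHom φ.cls = (φ.act k l).cls := by
  refine (act_ofAct _ _ _ _ _ _ _).trans ?_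
  exact Quotient.sound (act_congr (rep_toHom k) (rep_toHom l) (Setoid.refl φ))

theorem act_id_cls {F : Profunctor.{w + 1} C D} {Q : Beta D} {P P' : Beta C}
    (l : PreHom P P') (φ : Fam F Q P) :
    (prof F).act (𝟙 Q) l.toHom φ.cls = (φ.act (PreHom.id Q) l).cls := act_cls (PreHom.id Q) l φ

theorem act_cls_id {F : Profunctor.{w + 1} C D} {Q' Q : Beta D} {P : Beta C} (k : PreHom Q' Q)
    (φ : Fam F Q P) :
    (prof F).act k.toHom (𝟙 P) φ.cls = (φ.act k (PreHom.id P)).cls := act_cls k (PreHom.id P) φ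

end Fam

/-! The two-sided discrete fibration of a profunctor, and the extension of `𝛃` -/

/-- The objects of the two-sided discrete fibration of `F`: triples `(d, c, x ∈ F(d, c))`. -/
structure TwoSided (F : Profunctor.{w + 1} C D) : Type (w + 1) where
  d : D
  c : C
  el : F.El d c

/-- An arrow `(d, c, x) ⟶ (d', c', x')` is a pair of arrows `f : d ⟶ d'` and `g : c ⟶ c'` with
`F(1, g) x = F(f, 1) x'`. -/
@[ext] structure TwoSided.Hom {F : Profunctor.{w + 1} C D} (r r' : TwoSided F) : Type w where
  f : r.d ⟶ r'.d
  g : r.c ⟶ r'.c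
  w : F.act (𝟙 r.d) g r.el = F.act f (𝟙 r'.c) r'.el

namespace TwoSided

instance (F : Profunctor.{w + 1} C D) : LargeCategory (TwoSided F) where
  Hom := TwoSided.Hom
  id r := ⟨𝟙 _, 𝟙 _, rfl⟩
  comp {r r' r''} u v := ⟨u.f ≫ v.f, u.g ≫ v.g, by
    have h1 := congrArg (F.act (𝟙 _) v.g) u.w
    have h2 := congrArg (F.act u.f (𝟙 _)) v.w
    simp only [act_act, Category.id_comp, Category.comp_id] at h1 h2
    exact h1.trans h2⟩

/-- The projection to the domain of the elements. -/
def dom (F : Profunctor.{w + 1} C D) : TwoSided F ⥤ D where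
  obj r := r.d
  map u := TwoSided.Hom.f u

/-- The projection to the codomain of the elements. -/
def cod (F : Profunctor.{w + 1} C D) : TwoSided F ⥤ C where
  obj r := r.c
  map u := TwoSided.Hom.g u

end TwoSided

/-- The extension of `𝛃` to profunctors: `(𝛃 dom)_⋄ ∘ (𝛃 cod)^⋄`, for `dom` and `cod` the projections
of the two-sided discrete fibration of `F`. -/
def betaProf (F : Profunctor.{w + 1} C D) : Profunctor.{w + 1} (Beta C) (Beta D) :=
  Profunctor.comp (conjoint (Beta.map (TwoSided.cod F))) (companion (Beta.map (TwoSided.dom F)))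

namespace BetaProf

open Beta (PreHom)

/-- The tautological family of elements of `F` indexed by an ultrafamily in the two-sided
fibration. -/
def taut {F : Profunctor.{w + 1} C D} (T : Beta (TwoSided F)) :
    Fam F ((Beta.map (TwoSided.dom F)).obj T) ((Beta.map (TwoSided.cod F)).obj T) :=
  ⟨fun t => ⟨t, (T.fam t).el⟩, rfl⟩

theorem taut_slide {F : Profunctor.{w + 1} C D} {T T' : Beta (TwoSided F)} (m : T ⟶ T') :
    (Fam.prof F).act ((Beta.map (TwoSided.dom F)).map m) (𝟙 _) (taut T').cls =
      (Fam.prof F).act (𝟙 _) ((Beta.map (TwoSided.cod F)).map m) (taut T).cls := by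
  induction m using Beta.hom_ind with | _ m
  refine (Fam.act_cls_id (m.map (TwoSided.dom F)) (taut T')).trans
    (Eq.trans ?_ (Fam.act_id_cls (m.map (TwoSided.cod F)) (taut T)).symm)
  refine Fam.cls_eq.2 (Filter.Eventually.of_forall fun t => ?_)
  exact congrArg (Sigma.mk _) (m.toFun t).2.w.symm

/-- The class of families represented by a pair of arrows. -/
def toFam (F : Profunctor.{w + 1} C D) : betaProf F ⟶ Fam.prof F :=
  compHom (fun {_ T _} k l =>
      (Fam.prof F).act (companion.arr k) (conjoint.arr l) (taut T).cls)
    (by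
      intro Q T T' P m k l
      have h := congrArg ((Fam.prof F).act (companion.arr k) (conjoint.arr l)) (taut_slide m)
      rw [act_act, act_act, Category.id_comp, Category.comp_id] at h
      simpa using h)
    (by intro _ _ _ _ _ f g k l; rw [act_act]; simp)

/-- The object of the two-sided fibration given by an element. -/
def point {F : Profunctor.{w + 1} C D} {Q : Beta D} {P : Beta C} {y : P.X}
    (s : Σ x : Q.X, F.El (Q.fam x) (P.fam y)) : TwoSided F := ⟨Q.fam s.1, P.fam y, s.2⟩

/-- The ultrafamily of elements of a family. -/
def total {F : Profunctor.{w + 1} C D} {Q : Beta D} {P : Beta C} (φ : Fam F Q P) :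
    Beta (TwoSided F) := ⟨P.X, fun y => point (φ.toFun y), P.ν⟩

/-- The arrow from the domain of a family to the ultrafamily of the domains of its elements. -/
def toDom {F : Profunctor.{w + 1} C D} {Q : Beta D} {P : Beta C} (φ : Fam F Q P) :
    PreHom Q ((Beta.map (TwoSided.dom F)).obj (total φ)) :=
  ⟨fun y => ⟨(φ.toFun y).1, 𝟙 _⟩, φ.map_eq⟩

/-- The element of `betaProf F` given by a family, with both arrows identities over the points. -/
def ofFamPre {F : Profunctor.{w + 1} C D} {Q : Beta D} {P : Beta C} (φ : Fam F Q P) :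
    (betaProf F).El Q P :=
  pair (d := total φ) (companion.mk (toDom φ).toHom) (conjoint.mk (𝟙 P))

theorem pair_mk_slide {F : Profunctor.{w + 1} C D} {Q : Beta D} {P : Beta C}
    {T T' : Beta (TwoSided F)} (m : T ⟶ T') (k : Q ⟶ (Beta.map (TwoSided.dom F)).obj T)
    (l : (Beta.map (TwoSided.cod F)).obj T' ⟶ P) :
    (pair (companion.mk (k ≫ (Beta.map (TwoSided.dom F)).map m)) (conjoint.mk l) :
        (betaProf F).El Q P) =
      pair (companion.mk k) (conjoint.mk ((Beta.map (TwoSided.cod F)).map m ≫ l)) := by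
  have := pair_slide (F := conjoint (Beta.map (TwoSided.cod F)))
    (G := companion (Beta.map (TwoSided.dom F))) m (companion.mk k) (conjoint.mk l)
  simpa using this

/-- The disjoint union of two families, as an ultrafamily in the two-sided fibration supported on
the first. -/
def glue {F : Profunctor.{w + 1} C D} {Q : Beta D} {P : Beta C} (φ ψ : Fam F Q P) :
    Beta (TwoSided F) :=
  ⟨P.X × Bool, fun z => bif z.2 then point (φ.toFun z.1) else point (ψ.toFun z.1),
    P.ν.map fun y => (y, true)⟩

/-- The projection to the first family. -/
def glueFst {F : Profunctor.{w + 1} C D} {Q : Beta D} {P : Beta C} (φ ψ : Fam F Q P) :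
    PreHom (glue φ ψ) (total φ) := ⟨fun y => ⟨(y, true), 𝟙 (point (φ.toFun y))⟩, rfl⟩

open Classical in
/-- The projection to a second family that agrees with the first almost everywhere. -/
def glueSnd {F : Profunctor.{w + 1} C D} {Q : Beta D} {P : Beta C} (φ ψ : Fam F Q P) (h : φ ≈ ψ) :
    PreHom (glue φ ψ) (total ψ) where
  toFun y := if h : φ.toFun y = ψ.toFun y then
      ⟨(y, true), eqToHom (congrArg point h)⟩ else ⟨(y, false), 𝟙 (point (ψ.toFun y))⟩
  map_eq := by
    apply Ultrafilter.coe_injective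
    refine Filter.map_congr ?_
    filter_upwards [h] with y hy
    exact congrArg Sigma.fst (dif_pos (c := φ.toFun y = ψ.toFun y) hy)

/-- The arrow from the domain of two families to the glued family. -/
def glueDom {F : Profunctor.{w + 1} C D} {Q : Beta D} {P : Beta C} (φ ψ : Fam F Q P) :
    PreHom Q ((Beta.map (TwoSided.dom F)).obj (glue φ ψ)) where
  toFun
    | (y, true) => ⟨(φ.toFun y).1, 𝟙 (Q.fam (φ.toFun y).1)⟩
    | (y, false) => ⟨(ψ.toFun y).1, 𝟙 (Q.fam (ψ.toFun y).1)⟩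
  map_eq := φ.map_eq

theorem ofFamPre_congr {F : Profunctor.{w + 1} C D} {Q : Beta D} {P : Beta C} {φ ψ : Fam F Q P}
    (h : φ ≈ ψ) : ofFamPre φ = ofFamPre ψ := by
  have e1 : (toDom φ).toHom =
      (glueDom φ ψ).toHom ≫ (Beta.map (TwoSided.dom F)).map (glueFst φ ψ).toHom := by
    refine Beta.toHom_eq.2 (Filter.Eventually.of_forall fun y => ?_)
    exact congrArg (Sigma.mk _) (Category.comp_id _).symm
  have e2 : (toDom ψ).toHom =
      (glueDom φ ψ).toHom ≫ (Beta.map (TwoSided.dom F)).map (glueSnd φ ψ h).toHom := by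
    refine Beta.toHom_eq.2 ?_
    filter_upwards [h] with y hy
    have e : (glueSnd φ ψ h).toFun y = ⟨(y, true), eqToHom (congrArg point hy)⟩ := dif_pos hy
    refine Eq.trans ?_ (congrArg (fun u : Σ z, (glue φ ψ).fam z ⟶ point (ψ.toFun y) =>
      (⟨((glueDom φ ψ).toFun u.1).1, ((glueDom φ ψ).toFun u.1).2 ≫ (TwoSided.dom F).map u.2⟩ :
        Σ x : Q.X, Q.fam x ⟶ (point (ψ.toFun y)).d)) e).symm
    have key : ∀ (s s' : Σ x : Q.X, F.El (Q.fam x) (P.fam y)) (hs : s = s'),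
        (⟨s'.1, 𝟙 (Q.fam s'.1)⟩ : Σ x : Q.X, Q.fam x ⟶ (point s').d) =
          ⟨s.1, 𝟙 (Q.fam s.1) ≫ (TwoSided.dom F).map (eqToHom (congrArg point hs))⟩ := by
      rintro s _ rfl
      exact congrArg (Sigma.mk _) (Category.comp_id _).symm
    exact key _ _ hy
  have e3 : ((Beta.map (TwoSided.cod F)).map (glueFst φ ψ).toHom :
        (Beta.map (TwoSided.cod F)).obj (glue φ ψ) ⟶ P) =
      (Beta.map (TwoSided.cod F)).map (glueSnd φ ψ h).toHom := by
    refine Beta.toHom_eq.2 ?_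
    filter_upwards [h] with y hy
    have e : (glueSnd φ ψ h).toFun y = ⟨(y, true), eqToHom (congrArg point hy)⟩ := dif_pos hy
    refine Eq.trans ?_ (congrArg (fun u : Σ z, (glue φ ψ).fam z ⟶ point (ψ.toFun y) =>
      (⟨u.1, (TwoSided.cod F).map u.2⟩ :
        Σ z, ((glue φ ψ).fam z).c ⟶ P.fam y)) e).symm
    have key : ∀ (s s' : Σ x : Q.X, F.El (Q.fam x) (P.fam y)) (hs : s = s'),
        𝟙 (P.fam y) = (TwoSided.cod F).map (eqToHom (congrArg point hs)) := by
      rintro s _ rfl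
      rfl
    exact congrArg (Sigma.mk _) (key _ _ hy)
  have h1 : ofFamPre φ = pair (companion.mk (glueDom φ ψ).toHom) (conjoint.mk
      ((Beta.map (TwoSided.cod F)).map (glueFst φ ψ).toHom ≫ 𝟙 P)) :=
    (congrArg (fun k => (pair (d := total φ) (companion.mk k) (conjoint.mk (𝟙 P)) :
      (betaProf F).El Q P)) e1).trans (pair_mk_slide _ _ _)
  have h2 : ofFamPre ψ = pair (companion.mk (glueDom φ ψ).toHom) (conjoint.mk
      ((Beta.map (TwoSided.cod F)).map (glueSnd φ ψ h).toHom ≫ 𝟙 P)) :=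
    (congrArg (fun k => (pair (d := total ψ) (companion.mk k) (conjoint.mk (𝟙 P)) :
      (betaProf F).El Q P)) e2).trans (pair_mk_slide _ _ _)
  rw [h1, h2]
  exact congrArg (fun k => pair (companion.mk (glueDom φ ψ).toHom) (conjoint.mk (k ≫ 𝟙 P))) e3

theorem act_split (F : Profunctor.{w + 1} C D) {d' d : D} {c c' : C} (f : d' ⟶ d) (g : c ⟶ c')
    (x : F.El d c) : F.act f (𝟙 c') (F.act (𝟙 d) g x) = F.act f g x := by simp

/-- Every element of `betaProf F` is represented by a family. -/
theorem pair_eq_ofFamPre {F : Profunctor.{w + 1} C D} {Q : Beta D} {P : Beta C}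
    (T : Beta (TwoSided F)) (k : PreHom Q ((Beta.map (TwoSided.dom F)).obj T))
    (l : PreHom ((Beta.map (TwoSided.cod F)).obj T) P) :
    (pair (d := T) (companion.mk k.toHom) (conjoint.mk l.toHom) : (betaProf F).El Q P) =
      ofFamPre ((taut T).act k l) := by
  let mid (y : P.X) : TwoSided F :=
    ⟨(T.fam (l.toFun y).1).d, P.fam y, F.act (𝟙 _) (l.toFun y).2 (T.fam (l.toFun y).1).el⟩
  let R : Beta (TwoSided F) := ⟨P.X, mid, P.ν⟩
  let m : PreHom T R := ⟨fun y => ⟨(l.toFun y).1, ⟨𝟙 _, (l.toFun y).2, (act_id _ _).symm⟩⟩, l.map_eq⟩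
  let n : PreHom (total ((taut T).act k l)) R :=
    ⟨fun y => ⟨y, ⟨(k.toFun (l.toFun y).1).2, 𝟙 _, (act_id _ _).trans (act_split _ _ _ _).symm⟩⟩, rfl⟩
  have h1 := pair_mk_slide m.toHom k.toHom (𝟙 P)
  have h2 := pair_mk_slide n.toHom (toDom ((taut T).act k l)).toHom (𝟙 P)
  have e1 : l.toHom = (Beta.map (TwoSided.cod F)).map m.toHom ≫ 𝟙 P := (Category.comp_id _).symm
  have e2 : 𝟙 P = (Beta.map (TwoSided.cod F)).map n.toHom ≫ 𝟙 P := (Category.comp_id _).symm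
  have e3 : k.toHom ≫ (Beta.map (TwoSided.dom F)).map m.toHom =
      (toDom ((taut T).act k l)).toHom ≫ (Beta.map (TwoSided.dom F)).map n.toHom := by
    refine Beta.toHom_eq.2 (Filter.Eventually.of_forall fun y => ?_)
    exact congrArg (Sigma.mk _) ((Category.comp_id _).trans (Category.id_comp _).symm)
  have h3 := congrArg (fun u => (pair (d := R) (companion.mk u) (conjoint.mk (𝟙 P)) :
      (betaProf F).El Q P)) e3
  have h4 := congrArg (fun u => (pair (d := T) (companion.mk k.toHom) (conjoint.mk u) :
      (betaProf F).El Q P)) e1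
  have h5 := congrArg (fun u => (pair (d := total ((taut T).act k l))
    (companion.mk (toDom ((taut T).act k l)).toHom) (conjoint.mk u) : (betaProf F).El Q P)) e2
  exact h4.trans (h1.symm.trans (h3.trans (h2.trans h5.symm)))

theorem act_taut_total {F : Profunctor.{w + 1} C D} {Q : Beta D} {P : Beta C} (φ : Fam F Q P) :
    (Fam.prof F).act (toDom φ).toHom (𝟙 P) (taut (total φ)).cls = φ.cls := by
  refine (Fam.act_cls_id (toDom φ) (taut (total φ))).trans ?_
  refine Fam.cls_eq.2 (Filter.Eventually.of_forall fun y => ?_)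
  exact congrArg (Sigma.mk _) (act_id _ _)

/-- The element of `betaProf F` given by a class of families. -/
def ofFamEl {F : Profunctor.{w + 1} C D} {Q : Beta D} {P : Beta C} :
    (Fam.prof F).El Q P → (betaProf F).El Q P := Fam.lift ofFamPre fun _ _ => ofFamPre_congr

theorem ofFamEl_toFam {F : Profunctor.{w + 1} C D} {Q : Beta D} {P : Beta C}
    (z : (betaProf F).El Q P) : ofFamEl (ap (toFam F) z) = z := by
  induction z using pair_ind with | _ T k l
  obtain ⟨k, rfl⟩ : ∃ k', k = companion.mk k' := ⟨companion.arr k, rfl⟩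
  obtain ⟨l, rfl⟩ : ∃ l', l = conjoint.mk l' := ⟨conjoint.arr l, rfl⟩
  induction k using Beta.hom_ind with | _ k
  induction l using Beta.hom_ind with | _ l
  refine Eq.trans ?_ (pair_eq_ofFamPre T k l).symm
  exact congrArg ofFamEl (Fam.act_cls k l (taut T))

theorem toFam_ofFamEl {F : Profunctor.{w + 1} C D} {Q : Beta D} {P : Beta C}
    (s : (Fam.prof F).El Q P) : ap (toFam F) (ofFamEl s) = s := by
  induction s using Fam.ind with | _ φ
  exact act_taut_total φ

/-- The elements of `betaProf F` are the classes of families of elements of `F`. -/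
def famIso (F : Profunctor.{w + 1} C D) : betaProf F ≅ Fam.prof F where
  hom := toFam F
  inv := mkHom (fun _ _ => ofFamEl) (by
    intro Q' Q P P' k l s
    rw [← ofFamEl_toFam ((betaProf F).act k l (ofFamEl s)), ap_act, toFam_ofFamEl])
  hom_inv_id := hom_ext fun _ _ z => ofFamEl_toFam z
  inv_hom_id := hom_ext fun _ _ s => toFam_ofFamEl s

end BetaProf

end Fam

/-! Structural cells of the extension, on classes of families -/

section FamCells

variable {C D E : Type (w + 1)} [LargeCategory C] [LargeCategory D] [LargeCategory E]

namespace Fam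

open Beta (rep PreHom)

/-- A transformation of profunctors acts on families elementwise. -/
def push {F G : Profunctor.{w + 1} C D} (σ : F ⟶ G) {Q : Beta D} {P : Beta C} (φ : Fam F Q P) :
    Fam G Q P := ⟨fun y => ⟨(φ.toFun y).1, ap σ (φ.toFun y).2⟩, φ.map_eq⟩

theorem push_congr {F G : Profunctor.{w + 1} C D} (σ : F ⟶ G) {Q : Beta D} {P : Beta C}
    {φ ψ : Fam F Q P} (h : φ ≈ ψ) : φ.push σ ≈ ψ.push σ := by
  filter_upwards [h] with y hy
  simp only [push]
  rw [hy]

/-- The action of the extension on transformations. -/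
def map₂ {F G : Profunctor.{w + 1} C D} (σ : F ⟶ G) : prof F ⟶ prof G :=
  mkHom (fun _ _ => lift (fun φ => (φ.push σ).cls) fun _ _ h => Quotient.sound (push_congr σ h)) (by
    intro Q' Q P P' k l φ
    induction φ using Fam.ind with | _ φ
    induction k using Beta.hom_ind with | _ k
    induction l using Beta.hom_ind with | _ l
    rw [act_cls]
    refine Eq.trans ?_ (act_cls k l (φ.push σ)).symm
    refine cls_eq.2 (Filter.Eventually.of_forall fun y => ?_)
    exact congrArg (Sigma.mk _) (ap_act σ _ _ _))

@[simp] theorem ap_map₂ {F G : Profunctor.{w + 1} C D} (σ : F ⟶ G) {Q : Beta D} {P : Beta C}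
    (φ : Fam F Q P) : ap (map₂ σ) φ.cls = (φ.push σ).cls := rfl

/-- A pair of a function and arrows, as a family of elements of the identity profunctor. -/
def ofPre {Q P : Beta C} (k : PreHom Q P) : Fam (ident C) Q P :=
  ⟨fun y => ⟨(k.toFun y).1, ident.mk (k.toFun y).2⟩, k.map_eq⟩

theorem ofPre_congr {Q P : Beta C} {k k' : PreHom Q P} (h : k ≈ k') : ofPre k ≈ ofPre k' := by
  filter_upwards [h] with y hy
  simp only [ofPre]
  rw [hy]

/-- The comparison of the identity of `𝛃 C` with the extension of the identity of `C`. -/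
def mapId (C : Type (w + 1)) [LargeCategory C] : ident (Beta C) ⟶ prof (ident C) :=
  mkHom (fun _ _ k => (ofPre (rep (ident.arr k))).cls) (by
    intro Q' Q P P' k l m
    obtain ⟨m, rfl⟩ : ∃ m', m = ident.mk m' := ⟨ident.arr m, rfl⟩
    induction m using Beta.hom_ind with | _ m
    induction k using Beta.hom_ind with | _ k
    induction l using Beta.hom_ind with | _ l
    rw [act_ident]
    refine Eq.trans (Quotient.sound (ofPre_congr (rep_toHom (k.comp (m.comp l))))) ?_
    refine Eq.trans ?_ (act_cls k l (ofPre (rep m.toHom))).symm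
    refine Quotient.sound (Setoid.trans ?_ (act_congr (Setoid.refl k) (Setoid.refl l)
      (ofPre_congr (Setoid.symm (rep_toHom m)))))
    exact Filter.Eventually.of_forall fun y => congrArg (Sigma.mk _) (by rw [act_ident]; rfl))

theorem ap_mapId {Q P : Beta C} (k : PreHom Q P) :
    ap (mapId C) (ident.mk k.toHom) = (ofPre k).cls :=
  Quotient.sound (ofPre_congr (rep_toHom k))

/-- Composition of families. -/
def mul {F : Profunctor.{w + 1} C D} {G : Profunctor.{w + 1} D E} {R : Beta E} {Q : Beta D}
    {P : Beta C} (ψ : Fam G R Q) (φ : Fam F Q P) : Fam (Profunctor.comp F G) R P where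
  toFun y := ⟨(ψ.toFun (φ.toFun y).1).1, pair (ψ.toFun (φ.toFun y).1).2 (φ.toFun y).2⟩
  map_eq := by rw [← ψ.map_eq, ← φ.map_eq]; rfl

theorem mul_congr {F : Profunctor.{w + 1} C D} {G : Profunctor.{w + 1} D E} {R : Beta E}
    {Q : Beta D} {P : Beta C} {ψ ψ' : Fam G R Q} {φ φ' : Fam F Q P} (h : ψ ≈ ψ') (h' : φ ≈ φ') :
    ψ.mul φ ≈ ψ'.mul φ' := by
  have h1 := Beta.eventually_comap φ.map_eq h
  filter_upwards [h1, h'] with y h1 h2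
  simp only [mul]
  rw [← h2, ← h1]

/-- The comparison of the composite of extensions with the extension of the composite. -/
def mapComp (F : Profunctor.{w + 1} C D) (G : Profunctor.{w + 1} D E) :
    Profunctor.comp (prof F) (prof G) ⟶ prof (Profunctor.comp F G) :=
  compHom (fun s t => Quotient.map₂ mul (fun _ _ h _ _ h' => mul_congr h h') s t)
    (by
      intro R Q Q' P h ψ φ
      induction ψ using Fam.ind with | _ ψ
      induction φ using Fam.ind with | _ φ
      induction h using Beta.hom_ind with | _ h
      rw [act_id_cls, act_cls_id]
      refine cls_eq.2 (Filter.Eventually.of_forall fun y => ?_)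
      exact congrArg (Sigma.mk _) (pair_slide _ _ _))
    (by
      intro R R' Q P P' k l ψ φ
      induction ψ using Fam.ind with | _ ψ
      induction φ using Fam.ind with | _ φ
      induction k using Beta.hom_ind with | _ k
      induction l using Beta.hom_ind with | _ l
      rw [act_id_cls, act_cls_id]
      refine Eq.trans ?_ (act_cls k l (ψ.mul φ)).symm
      refine cls_eq.2 (Filter.Eventually.of_forall fun y => ?_)
      exact congrArg (Sigma.mk _) (act_pair _ _ _ _).symm)

@[simp] theorem ap_mapComp {F : Profunctor.{w + 1} C D} {G : Profunctor.{w + 1} D E} {R : Beta E}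
    {Q : Beta D} {P : Beta C} (ψ : Fam G R Q) (φ : Fam F Q P) :
    ap (mapComp F G) (pair ψ.cls φ.cls) = (ψ.mul φ).cls := rfl

end Fam

end FamCells

namespace Fam

open Beta (PreHom)

open Bicategory in
/-- The lax functor sending `F : C ⇸ D` to the profunctor of classes of families of its elements. -/
def lax : LaxFunctor PROF.{w} PROF.{w} where
  obj C := ⟨Beta C.carrier⟩
  map F := prof F
  map₂ σ := map₂ σ
  map₂_id F := hom_ext fun Q P s => by
    induction s using Fam.ind with | _ φ
    rfl
  map₂_comp σ τ := hom_ext fun Q P s => by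
    induction s using Fam.ind with | _ φ
    rfl
  mapId C := mapId C.carrier
  mapComp F G := mapComp F G
  mapComp_naturality_left σ G := compHom_ext fun t s => by
    induction s using Fam.ind with | _ φ
    induction t using Fam.ind with | _ ψ
    rfl
  mapComp_naturality_right F _ _ σ := compHom_ext fun t s => by
    induction s using Fam.ind with | _ φ
    induction t using Fam.ind with | _ ψ
    rfl
  map₂_associator F G H := compHom_ext fun t s => by
    induction t using Fam.ind with | _ ψ
    induction s using pair_ind with | _ d u s
    induction s using Fam.ind with | _ φ
    induction u using Fam.ind with | _ χ
    rfl
  map₂_leftUnitor {C D} F := hom_ext fun Q P s => by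
    induction s using Fam.ind with | _ φ
    have h : ap (mapId C.carrier) (ident.mk (𝟙 P)) = (ofPre (PreHom.id P)).cls := 
      ap_mapId (PreHom.id P)
    exact (congrArg (fun u => ap (mapComp (ident C.carrier) F) (pair φ.cls u)) h).symm
  map₂_rightUnitor {C D} F := hom_ext fun Q P s => by
    induction s using Fam.ind with | _ φ
    have h : ap (mapId D.carrier) (ident.mk (𝟙 Q)) = (ofPre (PreHom.id Q)).cls := 
      ap_mapId (PreHom.id Q)
    exact (congrArg (fun u => ap (mapComp F (ident D.carrier)) (pair u φ.cls)) h).symm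

end Fam

/-! Transport of lax functors along isomorphisms of 1-cells -/

section Transport

open Bicategory

universe w₁ w₂ v₁ v₂ u₁ u₂

variable {B : Type u₁} [Bicategory.{w₁, v₁} B] {K : Type u₂} [Bicategory.{w₂, v₂} K]

/-- Replace the 1-cells of a lax functor by isomorphic ones. -/
def transportLax (L : LaxFunctor B K) (T : ∀ {a b : B}, (a ⟶ b) → (L.obj a ⟶ L.obj b))
    (i : ∀ {a b : B} (f : a ⟶ b), T f ≅ L.map f) : LaxFunctor B K where
  obj a := L.obj a
  map f := T f
  map₂ {_ _ f g} σ := (i f).hom ≫ L.map₂ σ ≫ (i g).inv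
  mapId a := L.mapId a ≫ (i (𝟙 a)).inv
  mapComp f g := (i f).hom ▷ T g ≫ L.map f ◁ (i g).hom ≫ L.mapComp f g ≫ (i (f ≫ g)).inv
  mapComp_naturality_left {a b c f f'} σ g := by
    simp [whisker_exchange_assoc, L.mapComp_naturality_left_assoc]
  mapComp_naturality_right f g g' σ := by
    simp [whisker_exchange_assoc, L.mapComp_naturality_right_assoc]
  map₂_associator f g h := by
    simp only [comp_whiskerRight, whisker_assoc, Category.assoc, Iso.inv_hom_id_assoc,
      Bicategory.inv_hom_whiskerRight_assoc, Bicategory.whiskerLeft_comp]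
    rw [← whisker_exchange_assoc (L.mapComp f g), L.map₂_associator_assoc]
    simp [whisker_exchange_assoc, -whiskerRight_comp, associator_naturality_left_assoc]
  map₂_leftUnitor f := by
    simp [← whisker_exchange_assoc (L.mapId _)]
  map₂_rightUnitor f := by
    simp [whisker_exchange_assoc, -whiskerRight_comp]

end Transport

/-! The unit, the multiplication and the companions, on classes of families -/

section FamTrans

variable {C D E : Type (w + 1)} [LargeCategory C] [LargeCategory D] [LargeCategory E]

theorem pair_companion {f : C ⥤ D} {G : Profunctor.{w + 1} D E} {e : E} {d : D} {c : C}
    (x : G.El e d) (y : (companion f).El d c) :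
    pair x y = pair (G.act (𝟙 e) (companion.arr y) x) (companion.mk (𝟙 (f.obj c))) := by
  have := pair_slide (F := companion f) (companion.arr y) x (companion.mk (𝟙 (f.obj c)))
  simpa using this.symm

/-- The transformation `g_⋄ ∘ F ⟹ G ∘ f_⋄` given by natural functions `F(d, c) → G(g d, f c)`. -/
def square {C' D' : Type (w + 1)} [LargeCategory C'] [LargeCategory D'] {F : Profunctor.{w + 1} C D}
    {G : Profunctor.{w + 1} C' D'} (f : C ⥤ C') (g : D ⥤ D')
    (φ : ∀ {d : D} {c : C}, F.El d c → G.El (g.obj d) (f.obj c))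
    (nat : ∀ {d d' : D} {c c' : C} (k : d' ⟶ d) (l : c ⟶ c') (s : F.El d c),
      φ (F.act k l s) = G.act (g.map k) (f.map l) (φ s)) :
    Profunctor.comp F (companion g) ⟶ Profunctor.comp (companion f) G :=
  compHom (fun k s => pair (G.act (companion.arr k) (𝟙 _) (φ s)) (companion.mk (𝟙 _)))
    (by
      intro Q d d' c h k s
      rw [nat, CategoryTheory.Functor.map_id, act_act]
      simp)
    (by
      intro Q Q' d c c' u v k s
      rw [nat, CategoryTheory.Functor.map_id, act_act, act_pair, act_act,
        pair_companion _ ((companion _).act _ _ _), act_act]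
      simp)

theorem ap_square {C' D' : Type (w + 1)} [LargeCategory C'] [LargeCategory D']
    {F : Profunctor.{w + 1} C D} {G : Profunctor.{w + 1} C' D'} (f : C ⥤ C') (g : D ⥤ D')
    (φ : ∀ {d : D} {c : C}, F.El d c → G.El (g.obj d) (f.obj c)) (nat) {e : D'} {d : D} {c : C}
    (k : (companion g).El e d) (s : F.El d c) :
    ap (square (G := G) f g φ nat) (pair k s) =
      pair (G.act (companion.arr k) (𝟙 _) (φ s)) (companion.mk (𝟙 _)) := rfl

namespace Fam

open Beta (rep PreHom)

/-- The family of one element, indexed by the point. -/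
def pt {F : Profunctor.{w + 1} C D} {d : D} {c : C} (s : F.El d c) :
    Fam F ((Beta.unit D).obj d) ((Beta.unit C).obj c) := ⟨fun y => ⟨y, s⟩, rfl⟩

/-- The oplax naturality cell of the unit. -/
def etaCell (F : Profunctor.{w + 1} C D) :
    Profunctor.comp F (companion (Beta.unit D)) ⟶
      Profunctor.comp (companion (Beta.unit C)) (prof F) :=
  square (Beta.unit C) (Beta.unit D) (fun s => (pt s).cls) fun {d d' c c'} k l s => (act_cls
    (PreHom.mk (P := (Beta.unit D).obj d') (Q := (Beta.unit D).obj d) (fun x => ⟨x, k⟩) rfl)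
    (PreHom.mk (P := (Beta.unit C).obj c) (Q := (Beta.unit C).obj c') (fun x => ⟨x, l⟩) rfl)
    (pt s)).symm

/-- A representative of a class of families. -/
def out {F : Profunctor.{w + 1} C D} {Q : Beta D} {P : Beta C} (s : (prof F).El Q P) : Fam F Q P :=
  Quotient.out (s := setoid F Q P) s

@[simp] theorem cls_out {F : Profunctor.{w + 1} C D} {Q : Beta D} {P : Beta C}
    (s : (prof F).El Q P) : (out s).cls = s := Quotient.out_eq (s := setoid F Q P) s

theorem out_cls {F : Profunctor.{w + 1} C D} {Q : Beta D} {P : Beta C} (φ : Fam F Q P) :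
    ∀ᶠ y in (P.ν : Filter P.X), (out φ.cls).toFun y = φ.toFun y := cls_eq.1 (cls_out _)

/-- The family on direct sums given by a family of classes of families. -/
def flat {F : Profunctor.{w + 1} C D} {Q : Beta (Beta D)} {P : Beta (Beta C)}
    (Φ : Fam (prof F) Q P) : Fam F ((Beta.mult D).obj Q) ((Beta.mult C).obj P) where
  toFun z := ⟨⟨(Φ.toFun z.1).1, ((out (Φ.toFun z.1).2).toFun z.2).1⟩,
    ((out (Φ.toFun z.1).2).toFun z.2).2⟩
  map_eq := Beta.sum_map_eq (ξ := fun x => (Q.fam x).ν) (ξ' := fun y => (P.fam y).ν)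
    (fun y => (Φ.toFun y).1) Φ.map_eq
    (fun y z => ((out (Φ.toFun y).2).toFun z).1) (fun y => (out (Φ.toFun y).2).map_eq)

theorem flat_congr {F : Profunctor.{w + 1} C D} {Q : Beta (Beta D)} {P : Beta (Beta C)}
    {Φ Ψ : Fam (prof F) Q P} (h : Φ ≈ Ψ) : Φ.flat ≈ Ψ.flat := by
  refine (Beta.eventually_sum _ _).2 ?_
  filter_upwards [h] with y hy
  refine Filter.Eventually.of_forall fun z => ?_
  simp only [flat]
  rw [hy]

theorem out_act {F : Profunctor.{w + 1} C D} {Q Q' : Beta D} {P P' : Beta C} (k : Q' ⟶ Q)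
    (l : P ⟶ P') (s : (prof F).El Q P) :
    ∀ᶠ y in (P'.ν : Filter P'.X), (out ((prof F).act k l s)).toFun y =
      ((out s).act (rep k) (rep l)).toFun y := by
  have h := act_cls (rep k) (rep l) (out s)
  rw [Beta.toHom_rep, Beta.toHom_rep, cls_out] at h
  exact cls_eq.1 ((cls_out _).trans h)

theorem flat_act {F : Profunctor.{w + 1} C D} {Q Q' : Beta (Beta D)} {P P' : Beta (Beta C)}
    (k : PreHom Q' Q) (l : PreHom P P') (Φ : Fam (prof F) Q P) :
    (Φ.act k l).flat ≈ Φ.flat.act k.sum l.sum := by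
  refine (Beta.eventually_sum _ _).2 (Filter.Eventually.of_forall fun y => ?_)
  filter_upwards [out_act (k.toFun (Φ.toFun (l.toFun y).1).1).2 (l.toFun y).2
    (Φ.toFun (l.toFun y).1).2] with z hz
  have key : ∀ s s' : (Σ x, F.El ((Q'.fam (k.toFun (Φ.toFun (l.toFun y).1).1).1).fam x)
      ((P'.fam y).fam z)), s = s' →
      (⟨⟨(k.toFun (Φ.toFun (l.toFun y).1).1).1, s.1⟩, s.2⟩ :
        Σ x : (Beta.sum Q').X, F.El ((Beta.sum Q').fam x) ((P'.fam y).fam z)) =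
        ⟨⟨(k.toFun (Φ.toFun (l.toFun y).1).1).1, s'.1⟩, s'.2⟩ := by
    rintro s _ rfl
    rfl
  exact key _ _ hz

/-- The oplax naturality cell of the multiplication. -/
def muCell (F : Profunctor.{w + 1} C D) :
    Profunctor.comp (prof (prof F)) (companion (Beta.mult D)) ⟶
      Profunctor.comp (companion (Beta.mult C)) (prof F) :=
  square (Beta.mult C) (Beta.mult D)
    (fun s => lift (fun Φ => Φ.flat.cls) (fun _ _ h => Quotient.sound (flat_congr h)) s) (by
      intro Q Q' P P' k l s
      induction s using Fam.ind with | _ Φ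
      induction k using Beta.hom_ind with | _ k
      induction l using Beta.hom_ind with | _ l
      rw [act_cls]
      exact (Quotient.sound (flat_act k l Φ)).trans (act_cls k.sum l.sum Φ.flat).symm)

open Bicategory

theorem mapId_unit {d c : C} (s : (ident C).El d c) :
    ap (mapId C) (ident.mk ((Beta.unit C).map (ident.arr s))) = (pt s).cls := ap_mapId _

open PROF in
theorem eta_naturality {F G : Profunctor.{w + 1} C D} (σ : F ⟶ G) :
    whiskerR σ (companion (Beta.unit D)) ≫ etaCell G =
      etaCell F ≫ whiskerL (companion (Beta.unit C)) (map₂ σ) := by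
  apply compHom_ext
  intro Q d c k s
  exact congrArg (fun u => pair u (companion.mk (𝟙 _)))
    (ap_act (map₂ σ) (companion.arr k) (𝟙 _) (pt s).cls).symm

open PROF in
theorem eta_id : whiskerR (𝟙 (ident C)) (companion (Beta.unit C)) ≫ etaCell (ident C) =
    (lunit (companion (Beta.unit C))).hom ≫ (runit _).inv ≫
      whiskerL (companion (Beta.unit C)) (mapId C) := by
  apply compHom_ext
  intro Q d c k s
  change pair ((prof _).act (companion.arr k) (𝟙 _) (pt s).cls) (companion.mk (𝟙 _)) =
    pair (ap (mapId C) (ident.mk (𝟙 Q))) ((companion _).act (𝟙 _) (ident.arr s) k)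
  rw [pair_companion (ap _ _), ← mapId_unit, ← ap_act, ← ap_act]
  simp

open PROF in
theorem eta_comp (F : Profunctor.{w + 1} C D) (G : Profunctor.{w + 1} D E) :
    whiskerR (𝟙 (Profunctor.comp F G)) (companion (Beta.unit E)) ≫ etaCell (Profunctor.comp F G) =
      assocHom F G _ ≫ whiskerL F (etaCell G) ≫ assocInv F _ _ ≫ whiskerR (etaCell F) (prof G) ≫
        assocHom _ (prof F) (prof G) ≫ whiskerL _ (mapComp F G) := by
  apply compHom_ext
  intro Q d c k s
  induction s using pair_ind with | _ d t u
  change pair ((prof _).act (companion.arr k) (𝟙 _) (pt (pair t u)).cls) (companion.mk (𝟙 _)) =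
    pair (ap (mapComp F G) (pair ((prof G).act (companion.arr k) (𝟙 _) (pt t).cls)
      ((prof F).act (𝟙 _) (𝟙 _) (pt u).cls))) (companion.mk (𝟙 _))
  rw [← act_pair, ap_act]
  rfl

/-- The unit of the extension of `𝛃`. -/
def etaTrans : Lax.OplaxTrans (LaxFunctor.id PROF.{w}) lax.{w} where
  app C := companion (Beta.unit C.carrier)
  naturality F := etaCell F
  naturality_naturality σ := eta_naturality σ
  naturality_id _ := eta_id
  naturality_comp F G := eta_comp F G

theorem ap_muCell {F : Profunctor.{w + 1} C D} {Q : Beta (Beta D)} {P : Beta (Beta C)} {R : Beta D}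
    (k : (companion (Beta.mult D)).El R Q) (Φ : Fam (prof F) Q P) :
    ap (muCell F) (pair k Φ.cls) =
      pair ((prof F).act (companion.arr k) (𝟙 _) Φ.flat.cls) (companion.mk (𝟙 _)) := rfl

theorem key_flat {F : Profunctor.{w + 1} C D} {Q : Beta (Beta D)} {x : Q.X} {c : C}
    {s s' : Σ y, F.El ((Q.fam x).fam y) c} (h : s = s') :
    (⟨⟨x, s.1⟩, s.2⟩ : Σ z : (Σ x, (Q.fam x).X), F.El ((Q.fam z.1).fam z.2) c) =
      ⟨⟨x, s'.1⟩, s'.2⟩ := by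
  rw [h]

theorem flat_push {F G : Profunctor.{w + 1} C D} (σ : F ⟶ G) {Q : Beta (Beta D)}
    {P : Beta (Beta C)} (Φ : Fam (prof F) Q P) : (Φ.push (map₂ σ)).flat ≈ Φ.flat.push σ := by
  refine (Beta.eventually_sum _ _).2 (Filter.Eventually.of_forall fun y => ?_)
  have h := cls_eq.1 ((cls_out (ap (map₂ σ) (Φ.toFun y).2)).trans
    (congrArg (ap (map₂ σ)) (cls_out (Φ.toFun y).2).symm))
  filter_upwards [h] with z hz
  exact key_flat hz

theorem flat_ofPre {Q P : Beta (Beta C)} (k : PreHom Q P) :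
    ((ofPre k).push (mapId C)).flat ≈ ofPre k.sum := by
  refine (Beta.eventually_sum _ _).2 (Filter.Eventually.of_forall fun y => ?_)
  have h := cls_eq.1 (cls_out (ap (mapId C) (ident.mk (k.toFun y).2)))
  filter_upwards [h] with z hz
  exact key_flat hz

theorem flat_mul {F : Profunctor.{w + 1} C D} {G : Profunctor.{w + 1} D E} {R : Beta (Beta E)}
    {Q : Beta (Beta D)} {P : Beta (Beta C)} (Ψ : Fam (prof G) R Q) (Φ : Fam (prof F) Q P) :
    ((Ψ.mul Φ).push (mapComp F G)).flat ≈ Ψ.flat.mul Φ.flat := by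
  refine (Beta.eventually_sum _ _).2 (Filter.Eventually.of_forall fun y => ?_)
  have h := cls_eq.1 ((cls_out (ap (mapComp F G) ((Ψ.mul Φ).toFun y).2)).trans
    (congrArg (ap (mapComp F G)) (congrArg₂ pair (cls_out (Ψ.toFun (Φ.toFun y).1).2).symm
      (cls_out (Φ.toFun y).2).symm)))
  filter_upwards [h] with z hz
  exact key_flat hz

open PROF in
theorem mu_naturality {F G : Profunctor.{w + 1} C D} (σ : F ⟶ G) :
    whiskerR (map₂ (map₂ σ)) (companion (Beta.mult D)) ≫ muCell G =
      muCell F ≫ whiskerL (companion (Beta.mult C)) (map₂ σ) := by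
  apply compHom_ext
  intro R Q P k s
  induction s using Fam.ind with | _ Φ
  have h : (Φ.push (map₂ σ)).flat.cls = ap (map₂ σ) Φ.flat.cls := Quotient.sound (flat_push σ Φ)
  change pair ((prof _).act (companion.arr k) (𝟙 _) (Φ.push (map₂ σ)).flat.cls)
      (companion.mk (f := Beta.mult C) (𝟙 ((Beta.mult C).obj P))) =
    pair (ap (map₂ σ) ((prof _).act (companion.arr k) (𝟙 _) Φ.flat.cls)) (companion.mk (f := Beta.mult C) (𝟙 _))
  rw [h, ap_act]

open PROF in
theorem mu_id : whiskerR (mapId (Beta C) ≫ map₂ (mapId C)) (companion (Beta.mult C)) ≫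
      muCell (ident C) =
    (lunit (companion (Beta.mult C))).hom ≫ (runit _).inv ≫
      whiskerL (companion (Beta.mult C)) (mapId C) := by
  apply compHom_ext
  intro R Q P k s
  obtain ⟨m, rfl⟩ : ∃ m', s = ident.mk m' := ⟨ident.arr s, rfl⟩
  induction m using Beta.hom_ind with | _ m
  have h : ((ofPre m).push (mapId C)).flat.cls =
      ap (mapId C) (ident.mk ((Beta.mult C).map m.toHom)) :=
    (Quotient.sound (flat_ofPre m)).trans (ap_mapId _).symm
  have h' : ap (whiskerR (mapId (Beta C) ≫ map₂ (mapId C)) (companion (Beta.mult C)) ≫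
      muCell (ident C)) (pair k (ident.mk m.toHom)) =
      pair ((prof _).act (companion.arr k) (𝟙 _) ((ofPre m).push (mapId C)).flat.cls)
      (companion.mk (f := Beta.mult C) (𝟙 ((Beta.mult C).obj P))) := 
    congrArg (fun u => ap (muCell (ident C)) (pair k (ap (map₂ (mapId C)) u))) (ap_mapId m)
  rw [h', h]
  change _ = 
    pair (ap (mapId C) (ident.mk (𝟙 R))) ((companion (Beta.mult C)).act (𝟙 R) m.toHom k)
  rw [pair_companion (ap _ _), ← ap_act, ← ap_act]
  simp

open PROF in
theorem mu_comp (F : Profunctor.{w + 1} C D) (G : Profunctor.{w + 1} D E) :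
    whiskerR (mapComp (prof F) (prof G) ≫ map₂ (mapComp F G)) (companion (Beta.mult E)) ≫
        muCell (Profunctor.comp F G) =
      assocHom _ _ _ ≫ whiskerL _ (muCell G) ≫ assocInv _ _ _ ≫ whiskerR (muCell F) (prof G) ≫
        assocHom _ (prof F) (prof G) ≫ whiskerL _ (mapComp F G) := by
  apply compHom_ext
  intro R Q P k s
  induction s using pair_ind with | _ d t u
  induction t using Fam.ind with | _ Ψ
  induction u using Fam.ind with | _ Φ
  have h : ((Ψ.mul Φ).push (mapComp F G)).flat.cls =
      ap (mapComp F G) (pair Ψ.flat.cls Φ.flat.cls) := Quotient.sound (flat_mul Ψ Φ)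
  change pair ((prof _).act (companion.arr k) (𝟙 _) ((Ψ.mul Φ).push (mapComp F G)).flat.cls)
      (companion.mk (f := Beta.mult C) (𝟙 ((Beta.mult C).obj P))) =
    pair (ap (mapComp F G) (pair ((prof G).act (companion.arr k) (𝟙 _) Ψ.flat.cls)
      ((prof F).act (𝟙 _) (𝟙 _) Φ.flat.cls))) (companion.mk (f := Beta.mult C) (𝟙 _))
  rw [← act_pair, ap_act, h]

/-- The multiplication of the extension of `𝛃`. -/
def muTrans : Lax.OplaxTrans (lax.{w}.comp lax.{w}) lax.{w} where
  app C := companion (Beta.mult C.carrier)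
  naturality F := muCell F
  naturality_naturality σ := mu_naturality σ
  naturality_id _ := mu_id
  naturality_comp F G := mu_comp F G

end Fam

end FamTrans

section TransportTrans

open Bicategory

universe w₁ w₂ v₁ v₂ u₁ u₂

section

variable {K : Type u₂} [Bicategory.{w₂, v₂} K] {X Y Z X' Y' Z' : K}

theorem target_comp {m : X ⟶ Y} {n : Y ⟶ Z} {mn : X ⟶ Z} {a : X ⟶ X'} {b : Y ⟶ Y'} {c : Z ⟶ Z'}
    {f f' : X' ⟶ Y'} {g g' : Y' ⟶ Z'} {k k' : X' ⟶ Z'} (i : f' ≅ f) (j : g' ≅ g) (l : k' ≅ k)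
    (nf : m ≫ b ⟶ a ≫ f) (ng : n ≫ c ⟶ b ≫ g) (nk : mn ≫ c ⟶ a ≫ k) (mc : m ≫ n ⟶ mn)
    (lc : f ≫ g ⟶ k)
    (h : mc ▷ c ≫ nk = (α_ m n c).hom ≫ m ◁ ng ≫ (α_ m b g).inv ≫ nf ▷ g ≫ (α_ a f g).hom ≫
      a ◁ lc) :
    mc ▷ c ≫ nk ≫ a ◁ l.inv = (α_ m n c).hom ≫ m ◁ (ng ≫ b ◁ j.inv) ≫ (α_ m b g').inv ≫
      (nf ≫ a ◁ i.inv) ▷ g' ≫ (α_ a f' g').hom ≫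
        a ◁ (i.hom ▷ g' ≫ f ◁ j.hom ≫ lc ≫ l.inv) := by
  rw [reassoc_of% h]
  simp only [Bicategory.whiskerLeft_comp, comp_whiskerRight, whisker_assoc, Category.assoc,
    Iso.inv_hom_id_assoc]
  have e1 : a ◁ i.inv ▷ g' ≫ a ◁ i.hom ▷ g' = 𝟙 _ := by
    rw [← Bicategory.whiskerLeft_comp, inv_hom_whiskerRight, Bicategory.whiskerLeft_id]
  have e2 : a ◁ f ◁ j.inv ≫ a ◁ f ◁ j.hom = 𝟙 _ := by
    rw [← Bicategory.whiskerLeft_comp, whiskerLeft_inv_hom, Bicategory.whiskerLeft_id]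
  rw [reassoc_of% e1, associator_inv_naturality_right_assoc, whisker_exchange_assoc,
    associator_naturality_right_assoc, reassoc_of% e2]

theorem source_comp {m m' : X ⟶ Y} {n n' : Y ⟶ Z} {mn mn' : X ⟶ Z} {a : X ⟶ X'} {b : Y ⟶ Y'}
    {c : Z ⟶ Z'} {f : X' ⟶ Y'} {g : Y' ⟶ Z'} {k : X' ⟶ Z'} (p : m' ⟶ m) (q : n' ⟶ n)
    (r : mn' ⟶ mn)
    (nf : m ≫ b ⟶ a ≫ f) (ng : n ≫ c ⟶ b ≫ g) (nk : mn ≫ c ⟶ a ≫ k) (mc : m ≫ n ⟶ mn)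
    (mc' : m' ≫ n' ⟶ mn') (lc : f ≫ g ⟶ k)
    (h : mc ▷ c ≫ nk = (α_ m n c).hom ≫ m ◁ ng ≫ (α_ m b g).inv ≫ nf ▷ g ≫ (α_ a f g).hom ≫
      a ◁ lc)
    (h' : mc' ≫ r = p ▷ n' ≫ m ◁ q ≫ mc) :
    mc' ▷ c ≫ r ▷ c ≫ nk = (α_ m' n' c).hom ≫ m' ◁ (q ▷ c ≫ ng) ≫ (α_ m' b g).inv ≫
      (p ▷ b ≫ nf) ▷ g ≫ (α_ a f g).hom ≫ a ◁ lc := by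
  rw [← comp_whiskerRight_assoc, h']
  simp only [comp_whiskerRight, Category.assoc]
  rw [h]
  simp only [associator_naturality_left_assoc, whisker_assoc, Category.assoc,
    Iso.inv_hom_id_assoc, Bicategory.whiskerLeft_comp]
  rw [← whisker_exchange_assoc, ← whisker_exchange_assoc, associator_inv_naturality_left_assoc]

theorem source_nat {m m' n n' : X ⟶ Y} {a : X ⟶ X'} {b : Y ⟶ Y'} {f g : X' ⟶ Y'} (p : m' ⟶ m)
    (q : n' ⟶ n) (σ : m ⟶ n) (σ' : m' ⟶ n') (nf : m ≫ b ⟶ a ≫ f) (ng : n ≫ b ⟶ a ≫ g) (τ : f ⟶ g)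
    (h : σ' ≫ q = p ≫ σ) (h' : σ ▷ b ≫ ng = nf ≫ a ◁ τ) :
    σ' ▷ b ≫ q ▷ b ≫ ng = (p ▷ b ≫ nf) ≫ a ◁ τ := by
  rw [← comp_whiskerRight_assoc, h, comp_whiskerRight_assoc, h', Category.assoc]

theorem source_id {m m' n : X ⟶ Y} {b : Y ⟶ Y'} {c : X ⟶ Y'} (p : m' ⟶ m) (u : n ⟶ m) (u' : n ⟶ m')
    (nf : m ≫ b ⟶ c) (h : u' ≫ p = u) : u' ▷ b ≫ p ▷ b ≫ nf = u ▷ b ≫ nf := by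
  rw [← comp_whiskerRight_assoc, h]

end

variable {B : Type u₁} [Bicategory.{w₁, v₁} B] {K : Type u₂} [Bicategory.{w₂, v₂} K]

theorem transport_isIso_mapComp (L : LaxFunctor B K)
    (T : ∀ {a b : B}, (a ⟶ b) → (L.obj a ⟶ L.obj b))
    (i : ∀ {a b : B} (f : a ⟶ b), T f ≅ L.map f) {a b c : B} (f : a ⟶ b) (g : b ⟶ c)
    (h : IsIso (L.mapComp f g)) : IsIso ((transportLax L T i).mapComp f g) := by
  change IsIso ((i f).hom ▷ T g ≫ L.map f ◁ (i g).hom ≫ L.mapComp f g ≫ (i (f ≫ g)).inv)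
  infer_instance

/-- Transport of the target of an oplax transformation. -/
def transportTarget {M L : LaxFunctor B K} (α : Lax.OplaxTrans M L)
    (T : ∀ {a b : B}, (a ⟶ b) → (L.obj a ⟶ L.obj b))
    (i : ∀ {a b : B} (f : a ⟶ b), T f ≅ L.map f) : Lax.OplaxTrans M (transportLax L T i) where
  app a := α.app a
  naturality {a b} f := α.naturality f ≫ α.app a ◁ (i f).inv
  naturality_naturality {a b f g} σ := by
    change M.map₂ σ ▷ α.app b ≫ α.naturality g ≫ α.app a ◁ (i g).inv =
      (α.naturality f ≫ α.app a ◁ (i f).inv) ≫ α.app a ◁ ((i f).hom ≫ L.map₂ σ ≫ (i g).inv)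
    rw [α.naturality_naturality_assoc]
    simp
  naturality_id a := by
    change M.mapId a ▷ α.app a ≫ α.naturality (𝟙 a) ≫ α.app a ◁ (i (𝟙 a)).inv =
      (λ_ (α.app a)).hom ≫ (ρ_ (α.app a)).inv ≫ α.app a ◁ (L.mapId a ≫ (i (𝟙 a)).inv)
    rw [α.naturality_id_assoc]
    simp
  naturality_comp f g := target_comp (i f) (i g) (i (f ≫ g)) (α.naturality f) (α.naturality g)
    (α.naturality (f ≫ g)) (M.mapComp f g) (L.mapComp f g) (α.naturality_comp f g)

/-- Transport of the source and the target of an oplax transformation from a square. -/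
def transportSquare {L : LaxFunctor B B} (α : Lax.OplaxTrans (L.comp L) L)
    (T : ∀ {a b : B}, (a ⟶ b) → (L.obj a ⟶ L.obj b))
    (i : ∀ {a b : B} (f : a ⟶ b), T f ≅ L.map f) :
    Lax.OplaxTrans ((transportLax L T i).comp (transportLax L T i)) (transportLax L T i) where
  app a := α.app a
  naturality {a b} f :=
    ((i (T f)).hom ≫ L.map₂ (i f).hom) ▷ α.app b ≫ α.naturality f ≫ α.app a ◁ (i f).inv
  naturality_naturality {a b f g} σ := by
    have h : ((i (T f)).hom ≫ L.map₂ ((i f).hom ≫ L.map₂ σ ≫ (i g).inv) ≫ (i (T g)).inv) ≫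
        ((i (T g)).hom ≫ L.map₂ (i g).hom) = ((i (T f)).hom ≫ L.map₂ (i f).hom) ≫
          L.map₂ (L.map₂ σ) := by
      simp only [Category.assoc, Iso.inv_hom_id_assoc, ← PrelaxFunctor.map₂_comp, Iso.inv_hom_id,
        Category.comp_id]
    exact source_nat _ _ ((L.comp L).map₂ σ) _ ((transportTarget α T i).naturality f)
      ((transportTarget α T i).naturality g) _ h ((transportTarget α T i).naturality_naturality σ)
  naturality_id a := by
    have h : ((L.mapId (L.obj a) ≫ (i (𝟙 (L.obj a))).inv) ≫ ((i (𝟙 (L.obj a))).hom ≫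
        L.map₂ (L.mapId a ≫ (i (𝟙 a)).inv) ≫ (i (T (𝟙 a))).inv)) ≫
        ((i (T (𝟙 a))).hom ≫ L.map₂ (i (𝟙 a)).hom) =
          L.mapId (L.obj a) ≫ L.map₂ (L.mapId a) := by
      simp only [Category.assoc, Iso.inv_hom_id_assoc, ← PrelaxFunctor.map₂_comp, Iso.inv_hom_id,
        Category.comp_id]
    exact (source_id _ ((L.comp L).mapId a) _ ((transportTarget α T i).naturality (𝟙 a)) h).trans
      ((transportTarget α T i).naturality_id a)
  naturality_comp {a b c} f g := by
    refine source_comp ((i (T f)).hom ≫ L.map₂ (i f).hom) ((i (T g)).hom ≫ L.map₂ (i g).hom)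
      ((i (T (f ≫ g))).hom ≫ L.map₂ (i (f ≫ g)).hom) ((transportTarget α T i).naturality f)
      ((transportTarget α T i).naturality g) ((transportTarget α T i).naturality (f ≫ g))
      ((L.comp L).mapComp f g) _ ((transportLax L T i).mapComp f g)
      ((transportTarget α T i).naturality_comp f g) ?_
    change (((i (T f)).hom ▷ T (T g) ≫ L.map (T f) ◁ (i (T g)).hom ≫ L.mapComp (T f) (T g) ≫
      (i (T f ≫ T g)).inv) ≫ (i (T f ≫ T g)).hom ≫ L.map₂ ((i f).hom ▷ T g ≫
        L.map f ◁ (i g).hom ≫ L.mapComp f g ≫ (i (f ≫ g)).inv) ≫ (i (T (f ≫ g))).inv) ≫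
          (i (T (f ≫ g))).hom ≫ L.map₂ (i (f ≫ g)).hom =
      ((i (T f)).hom ≫ L.map₂ (i f).hom) ▷ T (T g) ≫ L.map (L.map f) ◁ ((i (T g)).hom ≫
        L.map₂ (i g).hom) ≫ L.mapComp (L.map f) (L.map g) ≫ L.map₂ (L.mapComp f g)
    simp only [Category.assoc, Iso.inv_hom_id_assoc, ← PrelaxFunctor.map₂_comp, Iso.inv_hom_id,
      Category.comp_id]
    simp only [PrelaxFunctor.map₂_comp, comp_whiskerRight, Bicategory.whiskerLeft_comp,
      Category.assoc]
    rw [L.mapComp_naturality_left_assoc, L.mapComp_naturality_right_assoc, whisker_exchange_assoc]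

end TransportTrans

/-! Two-cells between representable profunctors -/

section Companions

variable {C D E : Type (w + 1)} [LargeCategory C] [LargeCategory D] [LargeCategory E]

/-- A transformation with pointwise inverses is an isomorphism. -/
def isoOfInv {F G : Profunctor.{w + 1} C D} (σ : F ⟶ G) (τ : ∀ (d : D) (c : C), G.El d c → F.El d c)
    (h : ∀ (d : D) (c : C) (x : F.El d c), τ d c (ap σ x) = x)
    (h' : ∀ (d : D) (c : C) (y : G.El d c), ap σ (τ d c y) = y) : F ≅ G where
  hom := σ
  inv := mkHom τ (by
    intro d' d c c' f g y
    rw [← h d' c' (F.act f g (τ d c y)), ap_act, h'])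
  hom_inv_id := hom_ext h
  inv_hom_id := hom_ext h'

/-- The transformation `f_⋄ ⟹ g_⋄` given by a natural transformation `f ⟹ g`. -/
def companionMap {f g : C ⥤ D} (α : f ⟶ g) : companion f ⟶ companion g :=
  mkHom (fun _ c k => companion.mk (companion.arr k ≫ α.app c)) (by intros; simp)

/-- `(1_C)_⋄` is the identity profunctor. -/
def companionId (C : Type (w + 1)) [LargeCategory C] : companion (𝟭 C) ≅ ident C where
  hom := mkHom (fun _ _ k => ident.mk (companion.arr k)) (by intros; simp)
  inv := mkHom (fun _ c k => companion.mk (f := 𝟭 C) (ident.arr (c := c) k)) (by intros; simp)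

/-- `(g ∘ f)_⋄` is the composite of `f_⋄` and `g_⋄`. -/
def companionComp (f : C ⥤ D) (g : D ⥤ E) :
    companion (f ⋙ g) ≅ Profunctor.comp (companion f) (companion g) where
  hom := mkHom (fun _ c k => pair (d := f.obj c) (companion.mk (companion.arr k))
      (companion.mk (𝟙 (f.obj c)))) (by
    intro d' d c c' u v k
    rw [act_pair, pair_companion _ ((companion f).act _ _ _)]
    simp
    rfl)
  inv := compHom (fun x y => companion.mk (f := f ⋙ g) (companion.arr x ≫ g.map (companion.arr y)))
    (by intros; simp) (by intros; simp)
  hom_inv_id := hom_ext fun _ c k => congrArg (companion.mk (f := f ⋙ g))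
    ((congrArg (companion.arr k ≫ ·) (g.map_id (f.obj c))).trans (Category.comp_id _))
  inv_hom_id := compHom_ext fun x y => by
    rw [pair_companion x y, act_companion, Category.id_comp]
    exact congrArg (fun u => pair (companion.mk u) (companion.mk (𝟙 _)))
      ((congrArg (_ ≫ ·) (g.map_id _)).trans (Category.comp_id _))

/-- The value at `(e, c)` of the isomorphism `G ∘ f_⋄ ≅ G(-, f -)`. -/
def evalCompanion {f : C ⥤ D} {G : Profunctor.{w + 1} D E} {e : E} {c : C} :
    (Profunctor.comp (companion f) G).El e c → G.El e (f.obj c) :=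
  pairLift (fun x y => G.act (𝟙 e) (companion.arr y) x) (by intros; simp)

@[simp] theorem evalCompanion_pair {f : C ⥤ D} {G : Profunctor.{w + 1} D E} {e : E} {d : D} {c : C}
    (x : G.El e d) (y : (companion f).El d c) :
    evalCompanion (pair x y) = G.act (𝟙 e) (companion.arr y) x := rfl

theorem pair_evalCompanion {f : C ⥤ D} {G : Profunctor.{w + 1} D E} {e : E} {c : C}
    (z : (Profunctor.comp (companion f) G).El e c) :
    pair (evalCompanion z) (companion.mk (𝟙 (f.obj c))) = z := by
  induction z using pair_ind with | _ d x y
  exact (pair_companion x y).symm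

namespace Fam

open Beta (rep PreHom)

/-- The pair given by a family of elements of `f_⋄`. -/
def toPre {f : C ⥤ D} {Q : Beta D} {P : Beta C} (φ : Fam (companion f) Q P) :
    PreHom Q ((Beta.map f).obj P) :=
  ⟨fun y => ⟨(φ.toFun y).1, companion.arr (φ.toFun y).2⟩, φ.map_eq⟩

/-- The family of elements of `f_⋄` given by a pair. -/
def fromPre {f : C ⥤ D} {Q : Beta D} {P : Beta C} (k : PreHom Q ((Beta.map f).obj P)) :
    Fam (companion f) Q P :=
  ⟨fun y => ⟨(k.toFun y).1, companion.mk (f := f) (k.toFun y).2⟩, k.map_eq⟩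

theorem toPre_congr {f : C ⥤ D} {Q : Beta D} {P : Beta C} {φ ψ : Fam (companion f) Q P}
    (h : φ ≈ ψ) : toPre φ ≈ toPre ψ := by
  filter_upwards [h] with y hy
  exact congrArg (fun u : Σ x : Q.X, (companion f).El (Q.fam x) (P.fam y) =>
    (⟨u.1, companion.arr u.2⟩ : Σ x : Q.X, Q.fam x ⟶ f.obj (P.fam y))) hy

theorem fromPre_congr {f : C ⥤ D} {Q : Beta D} {P : Beta C}
    {k l : PreHom Q ((Beta.map f).obj P)} (h : k ≈ l) : fromPre k ≈ fromPre l := by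
  filter_upwards [h] with y hy
  exact congrArg (fun u : Σ x : Q.X, Q.fam x ⟶ f.obj (P.fam y) =>
    (⟨u.1, companion.mk u.2⟩ : Σ x : Q.X, (companion f).El (Q.fam x) (P.fam y))) hy

/-- The extension of `f_⋄` is `(𝛃 f)_⋄`. -/
def companionIso (f : C ⥤ D) : prof (companion f) ≅ companion (Beta.map f) :=
  isoOfInv
    (mkHom (fun Q P => lift (fun φ => companion.mk (f := Beta.map f) (toPre φ).toHom)
      fun _ _ h => congrArg companion.mk (Quotient.sound (toPre_congr h))) (by
      intro Q' Q P P' k l s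
      induction s using Fam.ind with | _ φ
      induction k using Beta.hom_ind with | _ k
      induction l using Beta.hom_ind with | _ l
      rw [act_cls, act_companion]
      refine congrArg companion.mk (Beta.toHom_eq.2 (Filter.Eventually.of_forall fun y => ?_))
      exact congrArg (Sigma.mk _) (congrArg companion.arr (act_companion f _ _ _))))
    (fun _ _ k => (fromPre (rep (companion.arr k))).cls)
    (by
      intro Q P s
      induction s using Fam.ind with | _ φ
      exact Quotient.sound (fromPre_congr (rep_toHom (toPre φ))))
    (fun _ _ k => congrArg companion.mk (Beta.toHom_rep (companion.arr k)))

/-- The family of elements of `G` given by a family of elements of `G ∘ f_⋄`. -/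
def eval {f : C ⥤ D} {G : Profunctor.{w + 1} D E} {R : Beta E} {P : Beta C}
    (φ : Fam (Profunctor.comp (companion f) G) R P) : Fam G R ((Beta.map f).obj P) :=
  ⟨fun y => ⟨(φ.toFun y).1, evalCompanion (φ.toFun y).2⟩, φ.map_eq⟩

theorem eval_congr {f : C ⥤ D} {G : Profunctor.{w + 1} D E} {R : Beta E} {P : Beta C}
    {φ ψ : Fam (Profunctor.comp (companion f) G) R P} (h : φ ≈ ψ) : eval φ ≈ eval ψ := by
  filter_upwards [h] with y hy
  exact congrArg (fun u : Σ x : R.X, (Profunctor.comp (companion f) G).El (R.fam x) (P.fam y) =>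
    (⟨u.1, evalCompanion u.2⟩ : Σ x : R.X, G.El (R.fam x) (f.obj (P.fam y)))) hy

/-- The family of identities in `f_⋄`. -/
def one (f : C ⥤ D) (P : Beta C) : Fam (companion f) ((Beta.map f).obj P) P :=
  fromPre (PreHom.id _)

theorem pair_one {f : C ⥤ D} {G : Profunctor.{w + 1} D E} {R : Beta E} {Q : Beta D} {P : Beta C}
    (ψ : Fam G R Q) (φ : Fam (companion f) Q P) :
    (pair ψ.cls φ.cls : (Profunctor.comp (prof (companion f)) (prof G)).El R P) =
      pair (eval (ψ.mul φ)).cls (one f P).cls := by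
  have h := pair_slide (F := prof (companion f)) (G := prof G) (toPre φ).toHom ψ.cls (one f P).cls
  rw [act_id_cls, act_cls_id] at h
  have e1 : (ψ.act (PreHom.id R) (toPre φ)).cls = (eval (ψ.mul φ)).cls :=
    cls_eq.2 (Filter.Eventually.of_forall fun y => rfl)
  have e2 : ((one f P).act (toPre φ) (PreHom.id P)).cls = φ.cls :=
    cls_eq.2 (Filter.Eventually.of_forall fun y => congrArg (Sigma.mk _) (by
      refine (act_companion f _ _ _).trans ?_
      change companion.mk (companion.arr (φ.toFun y).2 ≫ 𝟙 _ ≫ f.map (𝟙 _)) = (φ.toFun y).2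
      simp))
  rw [← e1, h, e2]

/-- The comparison for a composite with a representable profunctor is invertible. -/
instance isIso_mapComp (f : C ⥤ D) (G : Profunctor.{w + 1} D E) :
    IsIso (mapComp (companion f) G) :=
  (isoOfInv (mapComp (companion f) G)
    (fun _ P => lift (fun φ => pair (eval φ).cls (one f P).cls) fun _ _ h =>
      congrArg (fun u => pair u (one f P).cls) (Quotient.sound (eval_congr h)))
    (by
      intro R P z
      induction z using pair_ind with | _ Q s t
      induction s using Fam.ind with | _ ψ
      induction t using Fam.ind with | _ φ
      exact (pair_one ψ φ).symm)
    (by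
      intro R P s
      induction s using Fam.ind with | _ φ
      exact cls_eq.2 (Filter.Eventually.of_forall fun y =>
        congrArg (Sigma.mk _) (pair_evalCompanion _)))).isIso_hom

end Fam

end Companions

/-! The extension of `𝛃` to the bicategory of profunctors -/

open Bicategory

/-- The extension of `𝛃` to profunctors, a lax functor whose value on `F : C ⇸ D` is
`(𝛃 dom)_⋄ ∘ (𝛃 cod)^⋄ : 𝛃 C ⇸ 𝛃 D`. -/
def betaLax : LaxFunctor PROF.{w} PROF.{w} :=
  transportLax Fam.lax (fun F => betaProf F) (fun F => BetaProf.famIso F)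

/-- The unit of the extension of `𝛃`, with components `η_⋄`. -/
def betaEta : Lax.OplaxTrans (LaxFunctor.id PROF.{w}) betaLax.{w} :=
  transportTarget Fam.etaTrans (fun F => betaProf F) (fun F => BetaProf.famIso F)

/-- The multiplication of the extension of `𝛃`, with components `μ_⋄`. -/
def betaMu : Lax.OplaxTrans (betaLax.{w}.comp betaLax.{w}) betaLax.{w} :=
  transportSquare Fam.muTrans (fun F => betaProf F) (fun F => BetaProf.famIso F)

namespace PROF

/-- The 1-cell `f_⋄ : C ⟶ D` of a functor `f`. -/
def dia {C D : PROF.{w}} (f : C.carrier ⥤ D.carrier) : C ⟶ D := companion f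

/-- The isomorphism between the extension of `f_⋄` and `(𝛃 f)_⋄`. -/
def betaDia {C D : PROF.{w}} (f : C.carrier ⥤ D.carrier) :
    betaLax.map (dia f) ≅ dia (C := betaLax.obj C) (D := betaLax.obj D) (Beta.map f) :=
  BetaProf.famIso (companion f) ≪≫ Fam.companionIso f

/-- The comparison of the extension for the composite of a representable 1-cell `f_⋄` with a 1-cell
`G` is invertible. -/
instance isIso_mapComp_dia {C D E : PROF.{w}} (f : C.carrier ⥤ D.carrier) (G : D ⟶ E) :
    IsIso (betaLax.mapComp (dia f) G) :=
  transport_isIso_mapComp Fam.lax _ _ (dia f) G (Fam.isIso_mapComp f G)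

/-- The 2-cell from the extension of `G ∘ f_⋄` to the composite of `(𝛃 f)_⋄` and the extension
of `G`. -/
def betaSplit {C D E : PROF.{w}} (f : C.carrier ⥤ D.carrier) (G : D ⟶ E) :
    betaLax.map (dia f ≫ G) ⟶
      dia (C := betaLax.obj C) (D := betaLax.obj D) (Beta.map f) ≫ betaLax.map G :=
  inv (betaLax.mapComp (dia f) G) ≫ (betaDia f).hom ▷ betaLax.map G

/-- The 1-cell `(𝛃 η)_⋄ : 𝛃 C ⟶ 𝛃 (𝛃 C)`. -/
def mapEta (C : PROF.{w}) : betaLax.obj C ⟶ betaLax.obj (betaLax.obj C) :=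
  companion (Beta.map (Beta.unit C.carrier))

/-- The 1-cell `(𝛃 μ)_⋄ : 𝛃 (𝛃 (𝛃 C)) ⟶ 𝛃 (𝛃 C)`. -/
def mapMu (C : PROF.{w}) :
    betaLax.obj (betaLax.obj (betaLax.obj C)) ⟶ betaLax.obj (betaLax.obj C) :=
  companion (Beta.map (Beta.mult C.carrier))

/-- The 2-cell from the extension of `a ∘ η` to the composite of `𝛃 η` and the extension of `a`. -/
def splitEta {C D : PROF.{w}} (a : betaLax.obj C ⟶ D) :
    betaLax.map (betaEta.app C ≫ a) ⟶ mapEta C ≫ betaLax.map a :=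
  betaSplit (D := betaLax.obj C) (Beta.unit C.carrier) a

/-- The 2-cell from the extension of `a ∘ μ` to the composite of `𝛃 μ` and the extension of `a`. -/
def splitMu {C D : PROF.{w}} (a : betaLax.obj C ⟶ D) :
    betaLax.map (betaMu.app C ≫ a) ⟶ mapMu C ≫ betaLax.map a :=
  betaSplit (C := betaLax.obj (betaLax.obj C)) (D := betaLax.obj C) (Beta.mult C.carrier) a

/-- `𝔩 : μ ∘ η 𝛃 ≅ 1`, as a 2-cell. -/
def lCell (C : PROF.{w}) : betaEta.app (betaLax.obj C) ≫ betaMu.app C ⟶ 𝟙 (betaLax.obj C) :=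
  (companionComp (Beta.unit (Beta C.carrier)) (Beta.mult C.carrier)).inv ≫
    companionMap (Beta.unitMult C.carrier).hom ≫ (companionId (Beta C.carrier)).hom

/-- `𝔯 : μ ∘ 𝛃 η ≅ 1`, as a 2-cell. -/
def rCell (C : PROF.{w}) : mapEta C ≫ betaMu.app C ⟶ 𝟙 (betaLax.obj C) :=
  (companionComp (Beta.map (Beta.unit C.carrier)) (Beta.mult C.carrier)).inv ≫
    companionMap (Beta.mapUnitMult C.carrier).hom ≫ (companionId (Beta C.carrier)).hom

/-- `𝔪 : μ ∘ 𝛃 μ ≅ μ ∘ μ 𝛃`, as a 2-cell. -/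
def mCell (C : PROF.{w}) :
    mapMu C ≫ betaMu.app C ⟶ betaMu.app (betaLax.obj C) ≫ betaMu.app C :=
  (companionComp (Beta.map (Beta.mult C.carrier)) (Beta.mult C.carrier)).inv ≫
    companionMap (Beta.multMult C.carrier).hom ≫
      (companionComp (Beta.mult (Beta C.carrier)) (Beta.mult C.carrier)).hom

/-- The naturality cell of `η` at `a : 𝛃 C ⟶ C`. -/
def natEta {C : PROF.{w}} (a : betaLax.obj C ⟶ C) :
    a ≫ betaEta.app C ⟶ betaEta.app (betaLax.obj C) ≫ betaLax.map a := betaEta.naturality a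

/-- The naturality cell of `μ` at `a : 𝛃 C ⟶ C`. -/
def natMu {C : PROF.{w}} (a : betaLax.obj C ⟶ C) :
    betaLax.map (betaLax.map a) ≫ betaMu.app C ⟶ betaMu.app (betaLax.obj C) ≫ betaLax.map a :=
  betaMu.naturality a

end PROF

/-- The structures of a lax algebra, for the extension of `𝛃`, on a 1-cell `a : 𝛃 A ⇸ A`. -/
@[ext] structure LaxAlgebra {A : PROF.{w}} (a : betaLax.obj A ⟶ A) where
  /-- The unitor `Γ : 1 ⟹ a ∘ η`. -/
  unitor : 𝟙 A ⟶ betaEta.app A ≫ a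
  /-- The multiplicator `Δ : a ∘ 𝛃 a ⟹ a ∘ μ`. -/
  multor : betaLax.map a ≫ a ⟶ betaMu.app A ≫ a
  /-- The pasting of `Γ`, the naturality of `η` at `a`, `Δ` and `𝔩` is the identity. -/
  unit_left :
    (ρ_ a).inv ≫ a ◁ unitor ≫ (α_ _ _ _).inv ≫ PROF.natEta a ▷ a ≫ (α_ _ _ _).hom ≫
      _ ◁ multor ≫ (α_ _ _ _).inv ≫ PROF.lCell A ▷ a ≫ (λ_ a).hom = 𝟙 a
  /-- The pasting of the extension of `Γ`, `Δ` and `𝔯` is the identity. -/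
  unit_right :
    (λ_ a).inv ≫ betaLax.mapId A ▷ a ≫ betaLax.map₂ unitor ▷ a ≫ PROF.splitEta a ▷ a ≫
      (α_ _ _ _).hom ≫ _ ◁ multor ≫ (α_ _ _ _).inv ≫ PROF.rCell A ▷ a ≫ (λ_ a).hom = 𝟙 a
  /-- The pasting of the extension of `Δ`, `Δ` and `𝔪` coincides with that of `Δ`, the naturality of
  `μ` at `a` and `Δ`. -/
  assoc :
    (α_ _ _ _).inv ≫ betaLax.mapComp (betaLax.map a) a ▷ a ≫ betaLax.map₂ multor ▷ a ≫
        PROF.splitMu a ▷ a ≫ (α_ _ _ _).hom ≫ _ ◁ multor ≫ (α_ _ _ _).inv ≫ PROF.mCell A ▷ a ≫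
          (α_ _ _ _).hom =
      _ ◁ multor ≫ (α_ _ _ _).inv ≫ PROF.natMu a ▷ a ≫ (α_ _ _ _).hom ≫ _ ◁ multor

/-! Small profunctors and ultraconvergence structures -/

section UC

/-- `F : C ⇸ D` is small if every presheaf `F(-, c)` is a small colimit of representables. -/
def IsSmallProfunctor {C D : Type (w + 1)} [LargeCategory C] [LargeCategory D]
    (F : Profunctor.{w} C D) : Prop :=
  ∀ c : C, ∃ (J : Type w) (_ : SmallCategory J) (K : J ⥤ D) (s : Limits.Cocone (K ⋙ yoneda)),
    Nonempty (Limits.IsColimit s) ∧ Nonempty (s.pt ≅ F.obj c)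

variable {A₀ : Type (w + 1)} [LargeCategory A₀]

namespace Beta

/-- The ultrafamily with the same indices and the same ultrafilter as `P`, and other members. -/
abbrev withFam {C D : Type (w + 1)} [LargeCategory C] [LargeCategory D] (P : Beta C)
    (c : P.X → D) : Beta D := ⟨P.X, c, P.ν⟩

/-- The ultrafamily `(Y, h ∘ g, ξ)`, for `P = (X, h, ν)` and `g : Y → X`. -/
abbrev pullFam {C : Type (w + 1)} [LargeCategory C] (P : Beta C) {Y : Type w} (ξ : Ultrafilter Y)
    (g : Y → P.X) : Beta C := ⟨Y, fun y => P.fam (g y), ξ⟩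

/-- The arrow `(X, h, ν) ⟶ (Y, h ∘ g, ξ)` given by a function `g : Y → X` with `g ξ = ν` and by
identities. -/
def pull {C : Type (w + 1)} [LargeCategory C] (P : Beta C) {Y : Type w} (ξ : Ultrafilter Y)
    (g : Y → P.X) (hg : ξ.map g = P.ν) : P ⟶ P.pullFam ξ g :=
  PreHom.toHom ⟨fun y => ⟨g y, 𝟙 (P.fam (g y))⟩, hg⟩

/-- The arrow `(X, c, ν) ⟶ (X, d, ν)` given by an ultrafamily of arrows `c x ⟶ d x`. -/
def famHom {C D : Type (w + 1)} [LargeCategory C] [LargeCategory D] (P : Beta C) {c d : P.X → D}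
    (k : ∀ x, c x ⟶ d x) : P.withFam c ⟶ P.withFam d :=
  PreHom.toHom ⟨fun x => ⟨x, k x⟩, rfl⟩

end Beta

/-- An ultraconvergence structure on `A`. An element `r` of `A.El a P` is an ultraconvergence arrow
from `a` to the ultrafamily `P`, and `r[g]` is `A.act (𝟙 a) g r`. -/
@[ext] structure UCStructure (A : Profunctor.{w} (Beta A₀) A₀) where
  /-- The identity arrow of `a`, with values in the ultrafamily `(1, a, 1)`. -/
  id (a : A₀) : A.El a ((Beta.unit A₀).obj a)
  /-- The composite of `r` with the ultrafamily `s` of arrows `s x` from `P.fam x` to `c x`, with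
  values in the direct sum of the ultrafamilies `c x`. -/
  comp {a : A₀} {P : Beta A₀} (r : A.El a P) {c : P.X → Beta A₀} (s : ∀ x, A.El (P.fam x) (c x)) :
    A.El a (Beta.sum (P.withFam c))
  /-- `(s (g y))_y · r[g] = ((s x)_x · r)[g ⊗ id]`, where `g ⊗ id` is the arrow of direct sums
  induced by `g` and identities. -/
  left_naturality {a : A₀} {P : Beta A₀} (r : A.El a P) {c : P.X → Beta A₀}
    (s : ∀ x, A.El (P.fam x) (c x)) {Y : Type w} (ξ : Ultrafilter Y) (g : Y → P.X)
    (hg : ξ.map g = P.ν) :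
    comp (A.act (𝟙 a) (P.pull ξ g hg) r) (fun y => s (g y)) =
      A.act (𝟙 a) ((Beta.mult A₀).map ((P.withFam c).pull ξ g hg)) (comp r s)
  /-- `((s x)[k x])_x · r = ((s x)_x · r)[id ⊗ (k x)_x]`, where `id ⊗ (k x)_x` is the arrow of direct
  sums induced by the arrows `k x`. -/
  right_naturality {a : A₀} {P : Beta A₀} (r : A.El a P) {c d : P.X → Beta A₀}
    (s : ∀ x, A.El (P.fam x) (c x)) (k : ∀ x, c x ⟶ d x) :
    comp r (fun x => A.act (𝟙 (P.fam x)) (k x) (s x)) =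
      A.act (𝟙 a) ((Beta.mult A₀).map (P.famHom k)) (comp r s)
  /-- `(r)_{* : 1} · id a = r`, up to the isomorphism from the direct sum of one ultrafamily. -/
  left_unit {a : A₀} {P : Beta A₀} (r : A.El a P) :
    A.act (𝟙 a) (Beta.sumUnitIso P).hom (comp (id a) (fun _ => r)) = r
  /-- `(id (b x))_x · r = r`, up to the isomorphism from the direct sum of points. -/
  right_unit {a : A₀} {P : Beta A₀} (r : A.El a P) :
    A.act (𝟙 a) (Beta.sumMapUnitIso P).hom (comp r (fun x => id (P.fam x))) = r
  /-- `(t x y)_{(x, y)} · ((s x)_x · r) = ((t x y)_y · s x)_x · r`, up to the isomorphism of iterated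
  direct sums. -/
  assoc {a : A₀} {P : Beta A₀} (r : A.El a P) {c : P.X → Beta A₀} (s : ∀ x, A.El (P.fam x) (c x))
    {d : ∀ x, (c x).X → Beta A₀} (t : ∀ x y, A.El ((c x).fam y) (d x y)) :
    comp (comp r s) (fun z => t z.1 z.2) =
      A.act (𝟙 a) (Beta.sumSumIso (P.withFam fun x => (c x).withFam (d x))).hom
        (comp r (fun x => comp (s x) (t x)))

/-- The 1-cell of the bicategory of profunctors given by a profunctor with small sets of elements. -/
def toPROF (A : Profunctor.{w} (Beta A₀) A₀) : betaLax.obj (PROF.mk A₀) ⟶ PROF.mk A₀ :=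
  Profunctor.ulift.{w + 1} A

/-- The element of `𝛃 A` at `((X, b, ν), (X, c, ν))`, for `P = (X, b, ν)`, represented by the
ultrafamily of the elements `s x` of `A(b x, c x)` and by two identities. -/
def hatEl {A : Profunctor.{w} (Beta A₀) A₀} {P : Beta A₀} {c : P.X → Beta A₀}
    (s : ∀ x, A.El (P.fam x) (c x)) :
    (betaProf (toPROF A)).El P (P.withFam c) :=
  pair (d := P.withFam fun x => TwoSided.mk (F := toPROF A) (P.fam x) (c x) ⟨s x⟩)
    (companion.mk (f := Beta.map (TwoSided.dom (toPROF A))) (𝟙 P))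
    (conjoint.mk (f := Beta.map (TwoSided.cod (toPROF A))) (𝟙 (P.withFam c)))

namespace LaxAlgebra

/-- The element of `A(a, η a)` given by the unitor at `a`. -/
def idEl {A : Profunctor.{w} (Beta A₀) A₀} (L : LaxAlgebra (toPROF A)) (a : A₀) :
    A.El a ((Beta.unit A₀).obj a) :=
  (evalCompanion (ap L.unitor (ident.mk (𝟙 a)))).down

/-- The element of `A(a, μ (X, c, ν))` given by the multiplicator at the pair of `r` and of the
ultrafamily `s`. -/
def compEl {A : Profunctor.{w} (Beta A₀) A₀} (L : LaxAlgebra (toPROF A)) {a : A₀} {P : Beta A₀}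
    (r : A.El a P) {c : P.X → Beta A₀} (s : ∀ x, A.El (P.fam x) (c x)) :
    A.El a (Beta.sum (P.withFam c)) :=
  (evalCompanion (f := Beta.mult A₀)
    (ap L.multor (pair (F := betaProf (toPROF A)) (G := toPROF A) (d := P) ⟨r⟩ (hatEl s)))).down

end LaxAlgebra

end UC

end

/-!
An element of the extension of a profunctor `F` is represented by a family `φ` of elements of `F`,
with underlying function `g`. In the coend `F ∘ 𝛃F`, the pair of `r` and `φ` equals the pair of
`r[g]` and of the same elements, now lying over the identity. Moreover `H ∘ f_⋄` is `H(-, f -)`.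
Hence a multiplicator is the same thing as an operation sending `r` and `(s x)_x` to an element over
the direct sum (`multor_ext`), and a unitor is the same thing as a family of identity elements
(`unitor_ext`).

Naturality of a multiplicator together with the coend relation gives the two naturality laws of the
operation (`compOf_slide`, `compOf_act`). Conversely, operations with these laws extend to families
by re-indexing (`CompOps.opFam`). The extension identifies families that agree almost everywhere:
both are restrictions of their disjoint union, along two arrows that agree almost everywhere
(`CompOps.opFam_congr`). It respects the coend relation because, over a discrete category, every
arrow of ultrafamilies is a re-indexing (`Beta.preHom_ind`). This is where discreteness enters.

It remains to compare the equations. The three pastings are evaluated at elements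
(`ap_unitLeftPasting`, `ap_unitRightPasting`, `ap_assocPasting`, `ap_assocPasting'`). The unit
equations become the unit laws at once. The associativity equation involves families of families
lying over arbitrary functions, and naturality reduces it to families over identities, where it is
the associativity law (`assocPasting_eq_iff_ofEls`).
-/

noncomputable section

open CategoryTheory.Profunctor Bicategory BetaProf

open Beta (PreHom)

/-! ### The extension of `𝛃` on families of elements -/

section Cells

variable {C D E : Type (w + 1)} [LargeCategory C] [LargeCategory D] [LargeCategory E]

theorem Fam.ext {F : Profunctor.{w + 1} C D} {Q : Beta D} {P : Beta C} {φ ψ : Fam F Q P}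
    (h : ∀ y, φ.toFun y = ψ.toFun y) : φ = ψ := by
  cases φ
  cases ψ
  obtain rfl := funext h
  rfl

/-- The family of elements `s x ∈ F(P.fam x, c x)`, lying over the identity of `P.X`. -/
def Fam.ofEls {F : Profunctor.{w + 1} C D} {P : Beta D} {c : P.X → C}
    (s : ∀ x, F.El (P.fam x) (c x)) : Fam F P (P.withFam c) := ⟨fun x => ⟨x, s x⟩, rfl⟩

/-- The element of the extension of `F` represented by a family of elements of `F`. -/
def Fam.hat {F : Profunctor.{w + 1} C D} {Q : Beta D} {P : Beta C} (φ : Fam F Q P) :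
    (betaProf F).El Q P := ofFamEl φ.cls

theorem Fam.hat_eq {F : Profunctor.{w + 1} C D} {Q : Beta D} {P : Beta C} {φ ψ : Fam F Q P}
    (h : ∀ᶠ y in (P.ν : Filter P.X), φ.toFun y = ψ.toFun y) : φ.hat = ψ.hat :=
  congrArg ofFamEl (Fam.cls_eq.2 h)

theorem Fam.exists_hat {F : Profunctor.{w + 1} C D} {Q : Beta D} {P : Beta C}
    (z : (betaProf F).El Q P) : ∃ φ : Fam F Q P, φ.hat = z :=
  ⟨Fam.out (ap (toFam F) z), (congrArg ofFamEl (Fam.cls_out _)).trans (ofFamEl_toFam z)⟩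

theorem Fam.toFam_hat {F : Profunctor.{w + 1} C D} {Q : Beta D} {P : Beta C} (φ : Fam F Q P) :
    ap (toFam F) φ.hat = φ.cls := toFam_ofFamEl _

theorem Fam.act_hat {F : Profunctor.{w + 1} C D} {Q' Q : Beta D} {P P' : Beta C}
    (k : PreHom Q' Q) (l : PreHom P P') (φ : Fam F Q P) :
    (betaProf F).act k.toHom l.toHom φ.hat = (φ.act k l).hat :=
  (ap_act (famIso F).inv k.toHom l.toHom φ.cls).symm.trans
    (congrArg ofFamEl (Fam.act_cls k l φ))

theorem Fam.act_id_hat {F : Profunctor.{w + 1} C D} {Q : Beta D} {P P' : Beta C}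
    (l : PreHom P P') (φ : Fam F Q P) :
    (betaProf F).act (𝟙 Q) l.toHom φ.hat = (φ.act (PreHom.id Q) l).hat :=
  Fam.act_hat (PreHom.id Q) l φ

theorem Fam.act_hat_id {F : Profunctor.{w + 1} C D} {Q' Q : Beta D} {P : Beta C}
    (k : PreHom Q' Q) (φ : Fam F Q P) :
    (betaProf F).act k.toHom (𝟙 P) φ.hat = (φ.act k (PreHom.id P)).hat :=
  Fam.act_hat k (PreHom.id P) φ

theorem ap_betaLax_map₂ {F G : Profunctor.{w + 1} C D} (σ : F ⟶ G) {Q : Beta D} {P : Beta C}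
    (φ : Fam F Q P) :
    ap (F := betaProf F) (G := betaProf G)
      (betaLax.map₂ (a := ⟨C⟩) (b := ⟨D⟩) (f := F) (g := G) σ) φ.hat = (φ.push σ).hat := by
  change ofFamEl (ap (Fam.map₂ σ) (ap (toFam F) φ.hat)) = _
  rw [Fam.toFam_hat]
  rfl

theorem ap_betaLax_mapId (P : Beta C) :
    ap (F := ident (Beta C)) (G := betaProf (ident C)) (betaLax.mapId ⟨C⟩) (ident.mk (𝟙 P)) =
      (Fam.ofPre (PreHom.id P)).hat :=
  congrArg ofFamEl (Fam.ap_mapId (PreHom.id P))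

theorem ap_betaLax_mapComp {F : Profunctor.{w + 1} C D} {G : Profunctor.{w + 1} D E} {R : Beta E}
    {Q : Beta D} {P : Beta C} (ψ : Fam G R Q) (φ : Fam F Q P) :
    ap (F := Profunctor.comp (betaProf F) (betaProf G)) (G := betaProf (Profunctor.comp F G))
      (betaLax.mapComp (a := ⟨C⟩) (b := ⟨D⟩) (c := ⟨E⟩) F G) (pair ψ.hat φ.hat) =
      (ψ.mul φ).hat := by
  change ofFamEl (ap (Fam.mapComp F G) (pair (ap (toFam G) ψ.hat) (ap (toFam F) φ.hat))) = _
  rw [Fam.toFam_hat, Fam.toFam_hat]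
  rfl

/-- A family of elements of `G ∘ f_⋄` splits into elements of `G` and identities. -/
theorem ap_betaSplit {f : C ⥤ D} {G : Profunctor.{w + 1} D E} {R : Beta E} {P : Beta C}
    (φ : Fam (Profunctor.comp (companion f) G) R P) :
    ap (F := betaProf (Profunctor.comp (companion f) G))
      (G := Profunctor.comp (companion (Beta.map f)) (betaProf G))
      (PROF.betaSplit (C := ⟨C⟩) (D := ⟨D⟩) (E := ⟨E⟩) f G) φ.hat =
      pair (Fam.eval φ).hat (companion.mk (f := Beta.map f) (𝟙 ((Beta.map f).obj P))) := by
  have h1 := ap_betaLax_mapComp (Fam.eval φ) (Fam.one f P)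
  have h2 : ((Fam.eval φ).mul (Fam.one f P)).hat = φ.hat :=
    Fam.hat_eq (Filter.Eventually.of_forall fun y => congrArg (Sigma.mk _) (pair_evalCompanion _))
  -- The comparison sends the family of evaluations and the family of identities back to `φ`.
  rw [← h2, ← h1]
  let μ := betaLax.mapComp (c := ⟨E⟩) (PROF.dia (C := ⟨C⟩) (D := ⟨D⟩) f) G
  let κ := (PROF.betaDia (C := ⟨C⟩) (D := ⟨D⟩) f).hom ▷
    betaLax.map (X := ⟨D⟩) (Y := ⟨E⟩) G
  have h3 := congrArg (fun σ => ap (F := Profunctor.comp (betaProf (companion f)) (betaProf G))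
    (G := Profunctor.comp (companion (Beta.map f)) (betaProf G)) σ
      (pair (Fam.eval φ).hat (Fam.one f P).hat)) (IsIso.hom_inv_id_assoc μ κ)
  refine h3.trans ?_
  change pair (Fam.eval φ).hat (ap (Fam.companionIso f).hom (ap (toFam _) (Fam.one f P).hat)) = _
  rw [Fam.toFam_hat]
  rfl

end Cells

/-! ### Evaluation of the pastings of a lax algebra -/

section Pastings

variable {C : Type (w + 1)} [LargeCategory C] {F : Profunctor.{w + 1} (Beta C) C}

/-- The identity elements given by a unitor `γ`: its values at identities, under
`F ∘ η_⋄ ≅ F(-, η -)`. -/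
def idOf (γ : ident C ⟶ Profunctor.comp (companion (Beta.unit C)) F) (c : C) :
    F.El c ((Beta.unit C).obj c) := evalCompanion (ap γ (ident.mk (𝟙 c)))

/-- The composite of an element with an element of the extension, given by a multiplicator `δ`: its
value at their pair, under `F ∘ μ_⋄ ≅ F(-, μ -)`. -/
def compOf (δ : Profunctor.comp (betaProf F) F ⟶ Profunctor.comp (companion (Beta.mult C)) F)
    {e : C} {Q : Beta C} {P : Beta (Beta C)} (r : F.El e Q) (s : (betaProf F).El Q P) :
    F.El e (Beta.sum P) := evalCompanion (f := Beta.mult C) (ap δ (pair r s))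

theorem ap_unitor (γ : ident C ⟶ Profunctor.comp (companion (Beta.unit C)) F) (c : C) :
    ap γ (ident.mk (𝟙 c)) = pair (idOf γ c) (companion.mk (𝟙 ((Beta.unit C).obj c))) :=
  (pair_evalCompanion _).symm

theorem ap_multor
    (δ : Profunctor.comp (betaProf F) F ⟶ Profunctor.comp (companion (Beta.mult C)) F)
    {e : C} {Q : Beta C} {P : Beta (Beta C)} (r : F.El e Q) (s : (betaProf F).El Q P) :
    ap δ (pair r s) = pair (compOf δ r s) (companion.mk (f := Beta.mult C) (𝟙 (Beta.sum P))) :=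
  (pair_evalCompanion (f := Beta.mult C) _).symm

theorem ap_natEta {e : C} {P : Beta C} (r : F.El e P) :
    ap (F := Profunctor.comp F (companion (Beta.unit C)))
      (G := Profunctor.comp (companion (Beta.unit (Beta C))) (betaProf F))
      (PROF.natEta (C := ⟨C⟩) F) (pair (companion.mk (𝟙 ((Beta.unit C).obj e))) r) =
      pair (Fam.pt r).hat (companion.mk (𝟙 ((Beta.unit (Beta C)).obj P))) := by
  change pair (ofFamEl ((Fam.prof F).act (𝟙 _) (𝟙 _) (Fam.pt r).cls)) (companion.mk (𝟙 _)) = _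
  rw [act_id]
  rfl

/-- The element of the twofold extension represented by a family of families. -/
def Fam.hatHat {F : Profunctor.{w + 1} (Beta C) C} {Q : Beta (Beta C)} {P : Beta (Beta (Beta C))}
    (Ψ : Fam (Fam.prof F) Q P) : (betaProf (betaProf F)).El Q P := (Ψ.push (famIso F).inv).hat

theorem ap_natMu {Q : Beta (Beta C)} {P : Beta (Beta (Beta C))} (Ψ : Fam (Fam.prof F) Q P) :
    ap (F := Profunctor.comp (betaProf (betaProf F)) (companion (Beta.mult C)))
      (G := Profunctor.comp (companion (Beta.mult (Beta C))) (betaProf F))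
      (PROF.natMu (C := ⟨C⟩) F)
      (pair (companion.mk (f := Beta.mult C) (𝟙 ((Beta.mult C).obj Q))) Ψ.hatHat) =
      pair Ψ.flat.hat
        (companion.mk (f := Beta.mult (Beta C)) (𝟙 ((Beta.mult (Beta C)).obj P))) := by
  have h : ap (Fam.map₂ (toFam F)) (ap (toFam (betaProf F)) Ψ.hatHat) = Ψ.cls := by
    refine (congrArg (ap (Fam.map₂ (toFam F))) (Fam.toFam_hat (Ψ.push (famIso F).inv))).trans ?_
    exact Fam.cls_eq.2 (Filter.Eventually.of_forall fun y =>
      congrArg (Sigma.mk _) (toFam_ofFamEl _))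
  change pair (ofFamEl ((Fam.prof F).act (𝟙 _) (𝟙 _) (Fam.lift (fun Φ => Φ.flat.cls)
    (fun _ _ h => Quotient.sound (Fam.flat_congr h))
    (ap (Fam.map₂ (toFam F)) (ap (toFam (betaProf F)) Ψ.hatHat))))) (companion.mk (𝟙 _)) = _
  rw [h, act_id]
  rfl

section

variable {C : PROF.{w}} {a : betaLax.obj C ⟶ C}

/-- The pasting of a unitor, the naturality of `η`, a multiplicator and `𝔩`. -/
def unitLeftPasting (γ : 𝟙 C ⟶ betaEta.app C ≫ a) (δ : betaLax.map a ≫ a ⟶ betaMu.app C ≫ a) :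
    a ⟶ a :=
  (ρ_ a).inv ≫ a ◁ γ ≫ (α_ _ _ _).inv ≫ PROF.natEta a ▷ a ≫ (α_ _ _ _).hom ≫
    _ ◁ δ ≫ (α_ _ _ _).inv ≫ PROF.lCell C ▷ a ≫ (λ_ a).hom

/-- The pasting of the extension of a unitor, a multiplicator and `𝔯`. -/
def unitRightPasting (γ : 𝟙 C ⟶ betaEta.app C ≫ a) (δ : betaLax.map a ≫ a ⟶ betaMu.app C ≫ a) :
    a ⟶ a :=
  (λ_ a).inv ≫ betaLax.mapId C ▷ a ≫ betaLax.map₂ γ ▷ a ≫ PROF.splitEta a ▷ a ≫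
    (α_ _ _ _).hom ≫ _ ◁ δ ≫ (α_ _ _ _).inv ≫ PROF.rCell C ▷ a ≫ (λ_ a).hom

/-- The pasting of the extension of a multiplicator, the multiplicator and `𝔪`. -/
def assocPasting (δ : betaLax.map a ≫ a ⟶ betaMu.app C ≫ a) :
    betaLax.map (betaLax.map a) ≫ betaLax.map a ≫ a ⟶
      betaMu.app (betaLax.obj C) ≫ betaMu.app C ≫ a :=
  (α_ _ _ _).inv ≫ betaLax.mapComp (betaLax.map a) a ▷ a ≫ betaLax.map₂ δ ▷ a ≫
    PROF.splitMu a ▷ a ≫ (α_ _ _ _).hom ≫ _ ◁ δ ≫ (α_ _ _ _).inv ≫ PROF.mCell C ▷ a ≫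
      (α_ _ _ _).hom

/-- The pasting of a multiplicator, the naturality of `μ` and the multiplicator. -/
def assocPasting' (δ : betaLax.map a ≫ a ⟶ betaMu.app C ≫ a) :
    betaLax.map (betaLax.map a) ≫ betaLax.map a ≫ a ⟶
      betaMu.app (betaLax.obj C) ≫ betaMu.app C ≫ a :=
  _ ◁ δ ≫ (α_ _ _ _).inv ≫ PROF.natMu a ▷ a ≫ (α_ _ _ _).hom ≫ _ ◁ δ

end

theorem ap_unitLeftPasting (γ : ident C ⟶ Profunctor.comp (companion (Beta.unit C)) F)
    (δ : Profunctor.comp (betaProf F) F ⟶ Profunctor.comp (companion (Beta.mult C)) F)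
    {e : C} {P : Beta C} (r : F.El e P) :
    ap (F := F) (G := F) (unitLeftPasting (C := ⟨C⟩) γ δ) r =
      F.act (𝟙 e) (Beta.sumUnitIso P).hom (compOf δ (idOf γ e) (Fam.pt r).hat) := by
  let a : betaLax.obj ⟨C⟩ ⟶ (⟨C⟩ : PROF.{w}) := F
  let δ' : betaLax.map a ≫ a ⟶ betaMu.app ⟨C⟩ ≫ a := δ
  -- `K1`, `K2` and `K3` are what remains of the pasting after `γ`, the cell of `η` and `δ`.
  let K3 : betaEta.app (betaLax.obj ⟨C⟩) ≫ betaMu.app ⟨C⟩ ≫ a ⟶ a :=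
    (α_ _ _ _).inv ≫ PROF.lCell ⟨C⟩ ▷ a ≫ (λ_ a).hom
  let K2 : (betaEta.app (betaLax.obj ⟨C⟩) ≫ betaLax.map a) ≫ a ⟶ a :=
    (α_ _ _ _).hom ≫ _ ◁ δ' ≫ K3
  let K1 : a ≫ betaEta.app ⟨C⟩ ≫ a ⟶ a := (α_ _ _ _).inv ≫ PROF.natEta a ▷ a ≫ K2
  have h1 := congrArg (fun u => ap (F := Profunctor.comp F
    (Profunctor.comp (companion (Beta.unit C)) F)) (G := F) K1 (pair u r)) (ap_unitor γ e)
  have h2 := congrArg (fun u => ap (F := Profunctor.comp (Profunctor.comp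
    (companion (Beta.unit (Beta C))) (betaProf F)) F) (G := F) K2 (pair (idOf γ e) u)) (ap_natEta r)
  have h3 := congrArg (fun u => ap (F := Profunctor.comp
    (companion (Beta.unit (Beta C))) (Profunctor.comp (companion (Beta.mult C)) F)) (G := F) K3
      (pair u (companion.mk (𝟙 _)))) (ap_multor δ (idOf γ e) (Fam.pt r).hat)
  refine h1.trans (h2.trans (h3.trans ?_))
  change F.act (𝟙 e) ((𝟙 _ ≫ (Beta.mult C).map (𝟙 _)) ≫ (Beta.sumUnitIso P).hom) _ = _
  rw [CategoryTheory.Functor.map_id, Category.id_comp]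
  exact congrArg (F.act (𝟙 e) · _) (Category.id_comp _)

theorem ap_unitRightPasting (γ : ident C ⟶ Profunctor.comp (companion (Beta.unit C)) F)
    (δ : Profunctor.comp (betaProf F) F ⟶ Profunctor.comp (companion (Beta.mult C)) F)
    {e : C} {P : Beta C} (r : F.El e P) :
    ap (F := F) (G := F) (unitRightPasting (C := ⟨C⟩) γ δ) r =
      F.act (𝟙 e) (Beta.sumMapUnitIso P).hom
        (compOf δ r (Fam.ofEls fun x => idOf γ (P.fam x)).hat) := by
  let a : betaLax.obj ⟨C⟩ ⟶ (⟨C⟩ : PROF.{w}) := F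
  let γ' : 𝟙 (⟨C⟩ : PROF.{w}) ⟶ betaEta.app ⟨C⟩ ≫ a := γ
  let δ' : betaLax.map a ≫ a ⟶ betaMu.app ⟨C⟩ ≫ a := δ
  let φ : Fam (ident C) P P := Fam.ofPre (PreHom.id P)
  let s : Fam F P ((Beta.map (Beta.unit C)).obj P) := Fam.ofEls fun x => idOf γ (P.fam x)
  -- `K1`, ..., `K4` are what remains of the pasting after the comparison of identities, the
  -- extension of `γ`, the splitting and `δ`.
  let K4 : PROF.mapEta ⟨C⟩ ≫ betaMu.app ⟨C⟩ ≫ a ⟶ a :=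
    (α_ _ _ _).inv ≫ PROF.rCell ⟨C⟩ ▷ a ≫ (λ_ a).hom
  let K3 : (PROF.mapEta ⟨C⟩ ≫ betaLax.map a) ≫ a ⟶ a := (α_ _ _ _).hom ≫ _ ◁ δ' ≫ K4
  let K2 : betaLax.map (betaEta.app ⟨C⟩ ≫ a) ≫ a ⟶ a := PROF.splitEta a ▷ a ≫ K3
  let K1 : betaLax.map (𝟙 (⟨C⟩ : PROF.{w})) ≫ a ⟶ a := betaLax.map₂ γ' ▷ a ≫ K2
  have h1 := congrArg (fun u => ap (F := Profunctor.comp (betaProf (ident C)) F) (G := F) K1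
    (pair r u)) (ap_betaLax_mapId P)
  have h2 := congrArg (fun u => ap (F := Profunctor.comp
    (betaProf (Profunctor.comp (companion (Beta.unit C)) F)) F) (G := F) K2 (pair r u))
      (ap_betaLax_map₂ γ φ)
  have h3 := congrArg (fun u => ap (F := Profunctor.comp
    (Profunctor.comp (companion (Beta.map (Beta.unit C))) (betaProf F)) F) (G := F) K3 (pair r u))
      (ap_betaSplit (φ.push γ))
  have h4 := congrArg (fun u => ap (F := Profunctor.comp
    (companion (Beta.map (Beta.unit C))) (Profunctor.comp (companion (Beta.mult C)) F)) (G := F) K4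
      (pair u (companion.mk (𝟙 _)))) (ap_multor δ r s.hat)
  refine h1.trans (h2.trans (h3.trans (h4.trans ?_)))
  change F.act (𝟙 e) ((𝟙 _ ≫ (Beta.mult C).map (𝟙 _)) ≫ (Beta.sumMapUnitIso P).hom) _ = _
  rw [CategoryTheory.Functor.map_id, Category.id_comp]
  exact congrArg (F.act (𝟙 e) · _) (Category.id_comp _)

/-- The family of the composites of the elements of `φ` with the families of a family `Ψ`. -/
def Fam.compBy (δ : Profunctor.comp (betaProf F) F ⟶ Profunctor.comp (companion (Beta.mult C)) F)
    {Q : Beta C} {P : Beta (Beta C)} {R : Beta (Beta (Beta C))} (φ : Fam F Q P)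
    (Ψ : Fam (Fam.prof F) P R) : Fam F Q ((Beta.map (Beta.mult C)).obj R) where
  toFun y := ⟨(φ.toFun (Ψ.toFun y).1).1,
    compOf δ (φ.toFun (Ψ.toFun y).1).2 (ofFamEl (Ψ.toFun y).2)⟩
  map_eq := by rw [← φ.map_eq, ← Ψ.map_eq]; rfl

theorem ap_assocPasting
    (δ : Profunctor.comp (betaProf F) F ⟶ Profunctor.comp (companion (Beta.mult C)) F)
    {e : C} {Q : Beta C} {P : Beta (Beta C)} {R : Beta (Beta (Beta C))} (r : F.El e Q)
    (φ : Fam F Q P) (Ψ : Fam (Fam.prof F) P R) :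
    ap (F := Profunctor.comp (betaProf (betaProf F)) (Profunctor.comp (betaProf F) F))
      (G := Profunctor.comp (companion (Beta.mult (Beta C)))
        (Profunctor.comp (companion (Beta.mult C)) F))
      (assocPasting (C := ⟨C⟩) (a := F) δ) (pair (pair r φ.hat) Ψ.hatHat) =
    pair (pair (F.act (𝟙 e) (Beta.sumSumIso R).hom (compOf δ r (φ.compBy δ Ψ).hat))
      (companion.mk (f := Beta.mult C) (𝟙 ((Beta.mult C).obj ((Beta.mult (Beta C)).obj R)))))
      (companion.mk (f := Beta.mult (Beta C)) (𝟙 ((Beta.mult (Beta C)).obj R))) := by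
  let a : betaLax.obj ⟨C⟩ ⟶ (⟨C⟩ : PROF.{w}) := F
  let δ' : betaLax.map a ≫ a ⟶ betaMu.app ⟨C⟩ ≫ a := δ
  let ψ : Fam (Profunctor.comp (betaProf F) F) Q R := φ.mul (Ψ.push (famIso F).inv)
  -- `K2`, ..., `K5` are what remains of the pasting after the comparison of composites, the
  -- extension of `δ`, the splitting and `δ`.
  let K5 : PROF.mapMu ⟨C⟩ ≫ betaMu.app ⟨C⟩ ≫ a ⟶
      betaMu.app (betaLax.obj ⟨C⟩) ≫ betaMu.app ⟨C⟩ ≫ a :=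
    (α_ _ _ _).inv ≫ PROF.mCell ⟨C⟩ ▷ a ≫ (α_ _ _ _).hom
  let K4 : (PROF.mapMu ⟨C⟩ ≫ betaLax.map a) ≫ a ⟶
      betaMu.app (betaLax.obj ⟨C⟩) ≫ betaMu.app ⟨C⟩ ≫ a := (α_ _ _ _).hom ≫ _ ◁ δ' ≫ K5
  let K3 : betaLax.map (betaMu.app ⟨C⟩ ≫ a) ≫ a ⟶
      betaMu.app (betaLax.obj ⟨C⟩) ≫ betaMu.app ⟨C⟩ ≫ a := PROF.splitMu a ▷ a ≫ K4
  let K2 : betaLax.map (betaLax.map a ≫ a) ≫ a ⟶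
      betaMu.app (betaLax.obj ⟨C⟩) ≫ betaMu.app ⟨C⟩ ≫ a := betaLax.map₂ δ' ▷ a ≫ K3
  have h1 := congrArg (fun u => ap (F := Profunctor.comp
    (betaProf (Profunctor.comp (betaProf F) F)) F) (G := Profunctor.comp
      (companion (Beta.mult (Beta C))) (Profunctor.comp (companion (Beta.mult C)) F)) K2
      (pair r u)) (ap_betaLax_mapComp φ (Ψ.push (famIso F).inv))
  have h2 := congrArg (fun u => ap (F := Profunctor.comp
    (betaProf (Profunctor.comp (companion (Beta.mult C)) F)) F) (G := Profunctor.comp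
      (companion (Beta.mult (Beta C))) (Profunctor.comp (companion (Beta.mult C)) F)) K3
      (pair r u)) (ap_betaLax_map₂ δ ψ)
  have h3 := congrArg (fun u => ap (F := Profunctor.comp
    (Profunctor.comp (companion (Beta.map (Beta.mult C))) (betaProf F)) F) (G := Profunctor.comp
      (companion (Beta.mult (Beta C))) (Profunctor.comp (companion (Beta.mult C)) F)) K4
      (pair r u)) (ap_betaSplit (ψ.push δ))
  have h4 := congrArg (fun u => ap (F := Profunctor.comp
    (companion (Beta.map (Beta.mult C))) (Profunctor.comp (companion (Beta.mult C)) F))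
      (G := Profunctor.comp
      (companion (Beta.mult (Beta C))) (Profunctor.comp (companion (Beta.mult C)) F)) K5
      (pair u (companion.mk (𝟙 _)))) (ap_multor δ r (φ.compBy δ Ψ).hat)
  refine h1.trans (h2.trans (h3.trans (h4.trans ?_)))
  change pair (pair _ (companion.mk (f := Beta.mult C)
    ((𝟙 _ ≫ (Beta.mult C).map (𝟙 _)) ≫ (Beta.sumSumIso R).hom)))
    (companion.mk (f := Beta.mult (Beta C)) (𝟙 (Beta.sum R))) = _
  rw [CategoryTheory.Functor.map_id, Category.id_comp]
  refine congrArg (fun u => pair u (companion.mk (f := Beta.mult (Beta C)) (𝟙 _)))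
    ((pair_companion _ _).trans ?_)
  exact congrArg (fun u => pair (F.act (𝟙 e) u (compOf δ r (φ.compBy δ Ψ).hat))
    (companion.mk (f := Beta.mult C) (𝟙 (Beta.sum (Beta.sum R))))) (Category.id_comp _)

theorem ap_assocPasting'
    (δ : Profunctor.comp (betaProf F) F ⟶ Profunctor.comp (companion (Beta.mult C)) F)
    {e : C} {Q : Beta C} {P : Beta (Beta C)} {R : Beta (Beta (Beta C))} (r : F.El e Q)
    (φ : Fam F Q P) (Ψ : Fam (Fam.prof F) P R) :
    ap (F := Profunctor.comp (betaProf (betaProf F)) (Profunctor.comp (betaProf F) F))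
      (G := Profunctor.comp (companion (Beta.mult (Beta C)))
        (Profunctor.comp (companion (Beta.mult C)) F))
      (assocPasting' (C := ⟨C⟩) (a := F) δ) (pair (pair r φ.hat) Ψ.hatHat) =
    pair (pair (compOf δ (compOf δ r φ.hat) Ψ.flat.hat)
      (companion.mk (f := Beta.mult C) (𝟙 ((Beta.mult C).obj ((Beta.mult (Beta C)).obj R)))))
      (companion.mk (f := Beta.mult (Beta C)) (𝟙 ((Beta.mult (Beta C)).obj R))) := by
  let a : betaLax.obj ⟨C⟩ ⟶ (⟨C⟩ : PROF.{w}) := F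
  let δ' : betaLax.map a ≫ a ⟶ betaMu.app ⟨C⟩ ≫ a := δ
  -- `K1` and `K2` are what remains of the pasting after the first `δ` and the cell of `μ`.
  let K2 : (betaMu.app (betaLax.obj ⟨C⟩) ≫ betaLax.map a) ≫ a ⟶
      betaMu.app (betaLax.obj ⟨C⟩) ≫ betaMu.app ⟨C⟩ ≫ a := (α_ _ _ _).hom ≫ _ ◁ δ'
  let K1 : betaLax.map (betaLax.map a) ≫ betaMu.app ⟨C⟩ ≫ a ⟶
      betaMu.app (betaLax.obj ⟨C⟩) ≫ betaMu.app ⟨C⟩ ≫ a :=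
    (α_ _ _ _).inv ≫ PROF.natMu a ▷ a ≫ K2
  have h1 := congrArg (fun u => ap (F := Profunctor.comp (betaProf (betaProf F))
    (Profunctor.comp (companion (Beta.mult C)) F)) (G := Profunctor.comp
      (companion (Beta.mult (Beta C))) (Profunctor.comp (companion (Beta.mult C)) F)) K1
      (pair u Ψ.hatHat)) (ap_multor δ r φ.hat)
  have h2 := congrArg (fun u => ap (F := Profunctor.comp
    (Profunctor.comp (companion (Beta.mult (Beta C))) (betaProf F)) F) (G := Profunctor.comp
      (companion (Beta.mult (Beta C))) (Profunctor.comp (companion (Beta.mult C)) F)) K2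
      (pair (compOf δ r φ.hat) u)) (ap_natMu Ψ)
  exact h1.trans (h2.trans (congrArg (fun u => pair u (companion.mk (𝟙 _)))
    (ap_multor δ (compOf δ r φ.hat) Ψ.flat.hat)))

end Pastings

/-! ### Multiplicators and unitors in terms of elements -/

section Compositions

variable {C : Type (w + 1)} [LargeCategory C] {F : Profunctor.{w + 1} (Beta C) C}

theorem Beta.pull_comp {P : Beta C} {Y Z : Type w} {ξ : Ultrafilter Y} {ζ : Ultrafilter Z}
    (g : Y → P.X) (hg : ξ.map g = P.ν) (h : Z → Y) (hh : ζ.map h = ξ) :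
    P.pull ξ g hg ≫ (P.pullFam ξ g).pull ζ h hh =
      P.pull ζ (fun z => g (h z)) (by rw [← hg, ← hh]; rfl) :=
  Beta.toHom_eq.2 (Filter.Eventually.of_forall fun _ =>
    congrArg (Sigma.mk _) (Category.comp_id _))

/-- Every arrow of ultrafamilies is a re-indexing followed by an ultrafamily of arrows. -/
theorem Beta.pull_famHom {P Q : Beta C} (l : PreHom P Q) :
    P.pull Q.ν (fun y => (l.toFun y).1) l.map_eq ≫
      Beta.famHom Q (c := fun y => P.fam (l.toFun y).1) (d := Q.fam) (fun y => (l.toFun y).2) =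
        l.toHom :=
  Beta.toHom_eq.2 (Filter.Eventually.of_forall fun _ =>
    congrArg (Sigma.mk _) (Category.id_comp _))

/-- Over a discrete category, arrows of ultrafamilies are re-indexings. -/
theorem Beta.preHom_ind [IsDiscrete C] {Q : Beta C} {p : ∀ {P : Beta C}, PreHom Q P → Prop}
    (h : ∀ {Y : Type w} (ξ : Ultrafilter Y) (g : Y → Q.X) (hg : ξ.map g = Q.ν),
      p (P := Q.pullFam ξ g) ⟨fun y => ⟨g y, 𝟙 (Q.fam (g y))⟩, hg⟩)
    {P : Beta C} (k : PreHom Q P) : p k := by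
  obtain ⟨Y, fam, ξ⟩ := P
  obtain ⟨f, hf⟩ := k
  obtain ⟨g, α, rfl⟩ : ∃ (g : Y → Q.X) (α : ∀ y, Q.fam (g y) ⟶ fam y), f = fun y => ⟨g y, α y⟩ :=
    ⟨fun y => (f y).1, fun y => (f y).2, rfl⟩
  obtain rfl : fam = fun y => Q.fam (g y) := funext fun y => (IsDiscrete.eq_of_hom (α y)).symm
  obtain rfl : α = fun y => 𝟙 (Q.fam (g y)) := funext fun y => Subsingleton.elim _ _
  exact h ξ g hf

section Multor

variable (δ : Profunctor.comp (betaProf F) F ⟶ Profunctor.comp (companion (Beta.mult C)) F)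

/-- The coend relation, for composites. -/
theorem compOf_slide {e : C} {Q Q' : Beta C} {P : Beta (Beta C)} (k : Q' ⟶ Q) (r : F.El e Q')
    (s : (betaProf F).El Q P) :
    compOf δ (F.act (𝟙 e) k r) s = compOf δ r ((betaProf F).act k (𝟙 P) s) :=
  congrArg (fun u => evalCompanion (f := Beta.mult C) (ap δ u)) (pair_slide k r s)

/-- Naturality of a multiplicator in the codomains. -/
theorem compOf_act {e : C} {Q : Beta C} {P P' : Beta (Beta C)} (l : P ⟶ P') (r : F.El e Q)
    (s : (betaProf F).El Q P) :
    compOf δ r ((betaProf F).act (𝟙 Q) l s) =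
      F.act (𝟙 e) ((Beta.mult C).map l) (compOf δ r s) := by
  have h := ap_act δ (𝟙 e) l (pair r s)
  rw [act_pair, act_id, ap_multor δ r s, act_pair, act_companion] at h
  refine (congrArg (evalCompanion (f := Beta.mult C)) h).trans ?_
  rw [evalCompanion_pair, act_act, Category.comp_id, companion.arr_mk, Category.id_comp,
    Category.id_comp]
  exact congrArg (F.act (𝟙 e) · _) (Category.id_comp _)

/-- The coend relation re-indexes `r` along the function of `φ`, so that the family lies over the
identity. -/
theorem compOf_hat {e : C} {Q : Beta C} {P : Beta (Beta C)} (r : F.El e Q) (φ : Fam F Q P) :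
    compOf δ r φ.hat = compOf δ
      (F.act (𝟙 e) (Q.pull P.ν (fun y => (φ.toFun y).1) φ.map_eq) r)
      (Fam.ofEls (P := Q.pullFam P.ν fun y => (φ.toFun y).1) (c := P.fam)
        fun y => (φ.toFun y).2).hat := by
  rw [compOf_slide]
  refine congrArg (compOf δ r) (Eq.symm ((Fam.act_hat_id _ _).trans (congrArg Fam.hat ?_)))
  exact Fam.ext fun y => congrArg (Sigma.mk _) (act_id F _)

/-- A multiplicator is determined by its values at families lying over the identity. -/
theorem multor_ext
    {δ δ' : Profunctor.comp (betaProf F) F ⟶ Profunctor.comp (companion (Beta.mult C)) F}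
    (h : ∀ {e : C} {P : Beta C} (r : F.El e P) {c : P.X → Beta C}
      (s : ∀ x, F.El (P.fam x) (c x)),
      compOf δ r (Fam.ofEls s).hat = compOf δ' r (Fam.ofEls s).hat) : δ = δ' := by
  apply compHom_ext
  intro e Q P r s
  obtain ⟨φ, rfl⟩ := Fam.exists_hat s
  rw [ap_multor, ap_multor, compOf_hat, compOf_hat δ']
  exact congrArg (fun u => pair u (companion.mk (f := Beta.mult C) (𝟙 (Beta.sum P)))) (h _ _)

theorem unitor_ext {γ γ' : ident C ⟶ Profunctor.comp (companion (Beta.unit C)) F}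
    (h : ∀ c, idOf γ c = idOf γ' c) : γ = γ' := by
  apply hom_ext
  intro d c k
  have e : k = (ident C).act (ident.arr k) (𝟙 c) (ident.mk (𝟙 c)) := by simp
  rw [e, ap_act, ap_act, ap_unitor, ap_unitor, h]

theorem unitLeftPasting_eq_id_iff (γ : ident C ⟶ Profunctor.comp (companion (Beta.unit C)) F) :
    unitLeftPasting (C := ⟨C⟩) (a := F) γ δ = 𝟙 _ ↔
      ∀ {e : C} {P : Beta C} (r : F.El e P),
        F.act (𝟙 e) (Beta.sumUnitIso P).hom
          (compOf δ (idOf γ e) (Fam.ofEls (P := (Beta.unit C).obj e) fun _ => r).hat) = r := by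
  constructor
  · intro h e P r
    exact (ap_unitLeftPasting γ δ r).symm.trans (congrArg (fun σ => ap (F := F) (G := F) σ r) h)
  · intro h
    exact hom_ext (F := F) (G := F) fun e P r => (ap_unitLeftPasting γ δ r).trans (h r)

theorem unitRightPasting_eq_id_iff (γ : ident C ⟶ Profunctor.comp (companion (Beta.unit C)) F) :
    unitRightPasting (C := ⟨C⟩) (a := F) γ δ = 𝟙 _ ↔
      ∀ {e : C} {P : Beta C} (r : F.El e P),
        F.act (𝟙 e) (Beta.sumMapUnitIso P).hom
          (compOf δ r (Fam.ofEls fun x => idOf γ (P.fam x)).hat) = r := by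
  constructor
  · intro h e P r
    exact (ap_unitRightPasting γ δ r).symm.trans (congrArg (fun σ => ap (F := F) (G := F) σ r) h)
  · intro h
    exact hom_ext (F := F) (G := F) fun e P r => (ap_unitRightPasting γ δ r).trans (h r)

theorem Fam.exists_hatHat {Q : Beta (Beta C)} {P : Beta (Beta (Beta C))}
    (z : (betaProf (betaProf F)).El Q P) : ∃ Ψ : Fam (Fam.prof F) Q P, Ψ.hatHat = z := by
  obtain ⟨Φ, rfl⟩ := Fam.exists_hat z
  exact ⟨Φ.push (toFam F), congrArg Fam.hat
    (Fam.ext fun y => congrArg (Sigma.mk _) (ofFamEl_toFam _))⟩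

theorem assocPasting_eq_iff :
    assocPasting (C := ⟨C⟩) (a := F) δ = assocPasting' (C := ⟨C⟩) (a := F) δ ↔
      ∀ {e : C} {Q : Beta C} {P : Beta (Beta C)} {R : Beta (Beta (Beta C))} (r : F.El e Q)
        (φ : Fam F Q P) (Ψ : Fam (Fam.prof F) P R),
        compOf δ (compOf δ r φ.hat) Ψ.flat.hat =
          F.act (𝟙 e) (Beta.sumSumIso R).hom (compOf δ r (φ.compBy δ Ψ).hat) := by
  constructor
  · intro h e Q P R r φ Ψ
    have h1 := (ap_assocPasting δ r φ Ψ).symm.trans ((congrArg (fun σ => ap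
      (F := Profunctor.comp (betaProf (betaProf F)) (Profunctor.comp (betaProf F) F))
      (G := Profunctor.comp (companion (Beta.mult (Beta C)))
        (Profunctor.comp (companion (Beta.mult C)) F)) σ (pair (pair r φ.hat) Ψ.hatHat)) h).trans
          (ap_assocPasting' δ r φ Ψ))
    have h2 := congrArg (fun z => evalCompanion (f := Beta.mult C)
      (evalCompanion (f := Beta.mult (Beta C)) z)) h1
    simp only [evalCompanion_pair, companion.arr_mk, act_id] at h2
    exact (act_id F _).symm.trans (h2.symm.trans (act_id F _))
  · intro h
    refine compHom_ext (F := betaProf (betaProf F)) (G := Profunctor.comp (betaProf F) F)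
      (H := Profunctor.comp (companion (Beta.mult (Beta C)))
        (Profunctor.comp (companion (Beta.mult C)) F)) fun {e P R} z t => ?_
    induction z using pair_ind with | _ Q r s
    obtain ⟨φ, rfl⟩ := Fam.exists_hat s
    obtain ⟨Ψ, rfl⟩ := Fam.exists_hatHat t
    refine (ap_assocPasting δ r φ Ψ).trans (Eq.trans ?_ (ap_assocPasting' δ r φ Ψ).symm)
    rw [h r φ Ψ]
    rfl

end Multor

end Compositions

/-! ### The associativity equation -/

section Associativity

variable {C : Type (w + 1)} [LargeCategory C] {F : Profunctor.{w + 1} (Beta C) C}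

/-- Every family is a re-indexing of a family lying over the identity. -/
theorem Fam.act_ofEls {F : Profunctor.{w + 1} (Beta C) C} {Q : Beta C} {P : Beta (Beta C)}
    (φ : Fam F Q P) :
    (Fam.prof F).act (Q.pull P.ν (fun y => (φ.toFun y).1) φ.map_eq) (𝟙 P)
      (Fam.ofEls (P := Q.pullFam P.ν fun y => (φ.toFun y).1) (c := P.fam)
        fun y => (φ.toFun y).2).cls = φ.cls :=
  (Fam.act_cls_id _ _).trans (congrArg Fam.cls
    (Fam.ext fun _ => congrArg (Sigma.mk _) (act_id F _)))

/-- A family of families lying over identities flattens to a family lying over the identity. -/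
theorem Fam.flat_ofEls {P : Beta C} {c : P.X → Beta C} {d : ∀ x, (c x).X → Beta C}
    (t : ∀ x y, F.El ((c x).fam y) (d x y)) :
    (Fam.ofEls (F := Fam.prof F) (P := P.withFam c) (c := fun x => (c x).withFam (d x))
      fun x => (Fam.ofEls (t x)).cls).flat.hat =
    (Fam.ofEls (P := Beta.sum (P.withFam c)) (c := fun z => d z.1 z.2)
      fun z => t z.1 z.2).hat := by
  refine Fam.hat_eq ((Beta.eventually_sum _ _).2 (Filter.Eventually.of_forall fun x => ?_))
  filter_upwards [Fam.out_cls (Fam.ofEls (t x))] with y hy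
  exact Fam.key_flat (Q := P.withFam c) hy

/-- The associativity equation can be checked on families lying over identities. -/
theorem assocPasting_eq_iff_ofEls
    (δ : Profunctor.comp (betaProf F) F ⟶ Profunctor.comp (companion (Beta.mult C)) F) :
    assocPasting (C := ⟨C⟩) (a := F) δ = assocPasting' (C := ⟨C⟩) (a := F) δ ↔
      ∀ {e : C} {P : Beta C} (r : F.El e P) {c : P.X → Beta C} (s : ∀ x, F.El (P.fam x) (c x))
        {d : ∀ x, (c x).X → Beta C} (t : ∀ x y, F.El ((c x).fam y) (d x y)),
        compOf δ (compOf δ r (Fam.ofEls s).hat) (Fam.ofEls (P := Beta.sum (P.withFam c))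
            (c := fun z => d z.1 z.2) fun z => t z.1 z.2).hat =
          F.act (𝟙 e) (Beta.sumSumIso (P.withFam fun x => (c x).withFam (d x))).hom
            (compOf δ r (Fam.ofEls fun x => compOf δ (s x) (Fam.ofEls (t x)).hat).hat) := by
  rw [assocPasting_eq_iff]
  constructor
  · intro h e P r c s d t
    rw [← Fam.flat_ofEls]
    exact h r (Fam.ofEls s) (Fam.ofEls (F := Fam.prof F) (P := P.withFam c)
      (c := fun x => (c x).withFam (d x)) fun x => (Fam.ofEls (t x)).cls)
  · intro h e Q P R r φ Ψ
    -- `Ψ` is the image, along the arrow `k` that re-indexes `P` and its members, of a family `Ψ'`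
    -- lying over the identity, with members lying over identities. By naturality `k` can be moved
    -- from `Ψ` to `φ`.
    let ψ (y : R.X) : Fam F (P.fam (Ψ.toFun y).1) (R.fam y) := Fam.out (Ψ.toFun y).2
    have hψ (y : R.X) : (ψ y).cls = (Ψ.toFun y).2 := Fam.cls_out _
    let P' : Beta (Beta C) := ⟨R.X, fun y => (P.fam (Ψ.toFun y).1).pullFam (R.fam y).ν
      fun z => ((ψ y).toFun z).1, R.ν⟩
    let k : PreHom P P' := ⟨fun y => ⟨(Ψ.toFun y).1, Beta.pull _ _ _ (ψ y).map_eq⟩, Ψ.map_eq⟩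
    let u (y : R.X) (z : (R.fam y).X) : F.El ((P'.fam y).fam z) ((R.fam y).fam z) :=
      ((ψ y).toFun z).2
    let Ψ' : Fam (Fam.prof F) P' R :=
      Fam.ofEls (F := Fam.prof F) (P := P') (c := R.fam) fun y => (Fam.ofEls (u y)).cls
    let φ' : Fam F Q P' := φ.act (PreHom.id Q) k
    have e1 : Ψ = Ψ'.act k (PreHom.id R) := Fam.ext fun y => Eq.symm
      (congrArg (Sigma.mk _) ((Fam.act_ofEls (ψ y)).trans (hψ y)))
    have e2 : Ψ.flat.hat = (betaProf F).act ((Beta.mult C).map k.toHom) (𝟙 _) Ψ'.flat.hat := by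
      rw [← CategoryTheory.Functor.map_id, e1]
      exact (Fam.hat_eq (Fam.flat_act k (PreHom.id R) Ψ')).trans
        (Fam.act_hat k.sum (PreHom.id R).sum Ψ'.flat).symm
    have e3 : φ.compBy δ Ψ = φ'.compBy δ Ψ' := Fam.ext fun y => congrArg (Sigma.mk _)
      ((congrArg (fun v => compOf δ (φ.toFun (Ψ.toFun y).1).2 (ofFamEl v)) (hψ y).symm).trans
        (compOf_hat δ (φ.toFun (Ψ.toFun y).1).2 (ψ y)))
    have e4 : (betaProf F).act (𝟙 Q) k.toHom φ.hat = φ'.hat := Fam.act_id_hat k φ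
    have e5 : compOf δ (compOf δ r φ.hat) Ψ.flat.hat =
        compOf δ (compOf δ r φ'.hat) Ψ'.flat.hat :=
      (congrArg (compOf δ (compOf δ r φ.hat)) e2).trans
        ((compOf_slide δ ((Beta.mult C).map k.toHom) (compOf δ r φ.hat) Ψ'.flat.hat).symm.trans
          (congrArg (compOf δ · Ψ'.flat.hat)
            ((compOf_act δ k.toHom r φ.hat).symm.trans (congrArg (compOf δ r) e4))))
    rw [e5, e3, compOf_hat δ r φ', compOf_hat δ r (φ'.compBy δ Ψ')]
    -- In the same way, the function of `φ'` is moved to `r`.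
    let Q' : Beta C := Q.pullFam R.ν fun y => (φ'.toFun y).1
    let r' : F.El e Q' := F.act (𝟙 e) (Q.pull R.ν (fun y => (φ'.toFun y).1) φ'.map_eq) r
    let s (y : R.X) : F.El (Q'.fam y) (P'.fam y) := (φ'.toFun y).2
    exact (congrArg (compOf δ (compOf δ r' (Fam.ofEls (P := Q') (c := P'.fam) s).hat))
      (Fam.flat_ofEls (P := Q') (c := P'.fam) (d := fun y => (R.fam y).fam) u)).trans
        (h (P := Q') r' (c := P'.fam) s (d := fun y => (R.fam y).fam) u)

end Associativity

/-! ### Transformations from operations on elements -/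

section Construction

variable {C : Type (w + 1)} [LargeCategory C] {F : Profunctor.{w + 1} (Beta C) C}

variable (F) in
/-- Operations composing an element with an ultrafamily of elements, natural in the indices and in
the codomains: the data of a multiplicator, restricted to families lying over identities. -/
structure CompOps where
  /-- The composite of an element with an ultrafamily of elements. -/
  op {a : C} {P : Beta C} (r : F.El a P) {c : P.X → Beta C} (s : ∀ x, F.El (P.fam x) (c x)) :
    F.El a (Beta.sum (P.withFam c))
  /-- Naturality in the indices. -/
  pull {a : C} {P : Beta C} (r : F.El a P) {c : P.X → Beta C} (s : ∀ x, F.El (P.fam x) (c x))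
    {Y : Type w} (ξ : Ultrafilter Y) (g : Y → P.X) (hg : ξ.map g = P.ν) :
    op (F.act (𝟙 a) (P.pull ξ g hg) r) (fun y => s (g y)) =
      F.act (𝟙 a) ((Beta.mult C).map ((P.withFam c).pull ξ g hg)) (op r s)
  /-- Naturality in the codomains. -/
  famHom {a : C} {P : Beta C} (r : F.El a P) {c d : P.X → Beta C}
    (s : ∀ x, F.El (P.fam x) (c x)) (k : ∀ x, c x ⟶ d x) :
    op r (fun x => F.act (𝟙 (P.fam x)) (k x) (s x)) =
      F.act (𝟙 a) ((Beta.mult C).map (P.famHom k)) (op r s)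

namespace CompOps

variable (m : CompOps F)

/-- The composite of an element with a family, after re-indexing the element along the family. -/
def opFam {a : C} {Q : Beta C} {P : Beta (Beta C)} (r : F.El a Q) (φ : Fam F Q P) :
    F.El a (Beta.sum P) :=
  m.op (F.act (𝟙 a) (Q.pull P.ν (fun y => (φ.toFun y).1) φ.map_eq) r) (c := P.fam)
    fun y => (φ.toFun y).2

/-- Composites with families are natural in the codomains: an arrow `l` factors as a re-indexing
followed by an ultrafamily of arrows. -/
theorem opFam_act {a : C} {Q : Beta C} {P P' : Beta (Beta C)} (l : PreHom P P') (r : F.El a Q)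
    (φ : Fam F Q P) :
    m.opFam r (φ.act (PreHom.id Q) l) = F.act (𝟙 a) ((Beta.mult C).map l.toHom) (m.opFam r φ) := by
  let g (y : P.X) : Q.X := (φ.toFun y).1
  have h1 := m.famHom (F.act (𝟙 a) (Q.pull P'.ν (fun y => g (l.toFun y).1)
      (φ.act (PreHom.id Q) l).map_eq) r) (c := fun y => P.fam (l.toFun y).1) (d := P'.fam)
    (fun y => (φ.toFun (l.toFun y).1).2) (fun y => (l.toFun y).2)
  have h2 := m.pull (F.act (𝟙 a) (Q.pull P.ν g φ.map_eq) r) (c := P.fam)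
    (fun y => (φ.toFun y).2) P'.ν (fun y => (l.toFun y).1) l.map_eq
  rw [act_act, Category.id_comp, Beta.pull_comp] at h2
  refine h1.trans ((congrArg _ h2).trans ((act_act F _ _ _ _ _).trans ?_))
  refine congrArg₂ (fun f k => F.act f k (m.opFam r φ)) (Category.id_comp (𝟙 a)) ?_
  exact ((Beta.mult C).map_comp _ _).symm.trans
    (congrArg (Beta.mult C).map (Beta.pull_famHom l))

open Classical in
/-- Composites depend only on the class of a family: two families that agree almost everywhere are
re-indexings of their disjoint union along arrows that agree almost everywhere. -/
theorem opFam_congr {a : C} {Q : Beta C} {P : Beta (Beta C)} (r : F.El a Q) {φ ψ : Fam F Q P}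
    (h : φ ≈ ψ) : m.opFam r φ = m.opFam r ψ := by
  -- Restricting to the set where `φ` and `ψ` agree would not do: that arrow has no inverse in
  -- general, as representatives of arrows are defined at all indices.
  let T : Beta (Beta C) := ⟨P.X × Bool, fun z => P.fam z.1, P.ν.map fun y => (y, true)⟩
  let χ : Fam F Q T := ⟨fun z => bif z.2 then φ.toFun z.1 else ψ.toFun z.1, φ.map_eq⟩
  let i : PreHom T P := ⟨fun y => ⟨(y, true), 𝟙 _⟩, rfl⟩
  let j : PreHom T P := ⟨fun y => if φ.toFun y = ψ.toFun y then ⟨(y, true), 𝟙 (P.fam y)⟩ else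
    ⟨(y, false), 𝟙 (P.fam y)⟩, by
      apply Ultrafilter.coe_injective
      refine Filter.map_congr ?_
      filter_upwards [h] with y hy
      exact congrArg Sigma.fst (if_pos hy)⟩
  have e1 : φ = χ.act (PreHom.id Q) i :=
    Fam.ext fun y => congrArg (Sigma.mk _) (act_id F _).symm
  have e2 : ψ = χ.act (PreHom.id Q) j := Fam.ext fun y => by
    have key (v : Σ z : T.X, T.fam z ⟶ P.fam y) (b : Bool)
        (hv : v = ⟨(y, b), 𝟙 (P.fam y)⟩) (hw : χ.toFun (y, b) = ψ.toFun y) :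
        (⟨(χ.toFun v.1).1, F.act (𝟙 _) v.2 (χ.toFun v.1).2⟩ : Σ x, F.El (Q.fam x) (P.fam y)) =
          ψ.toFun y := by
      subst hv
      refine Eq.trans ?_ hw
      exact congrArg (Sigma.mk _) (act_id F _)
    by_cases hy : φ.toFun y = ψ.toFun y
    · exact (key (j.toFun y) true (if_pos hy) hy).symm
    · exact (key (j.toFun y) false (if_neg hy) rfl).symm
  have e3 : i.toHom = j.toHom := Beta.toHom_eq.2 (by
    filter_upwards [h] with y hy
    exact (if_pos hy).symm)
  rw [e1, e2, opFam_act, opFam_act, e3]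

variable [IsDiscrete C]

/-- Composites respect the coend relation, because `k` is a re-indexing. -/
theorem opFam_slide {a : C} {Q Q' : Beta C} {P : Beta (Beta C)} (k : PreHom Q' Q) (r : F.El a Q')
    (φ : Fam F Q P) :
    m.opFam (F.act (𝟙 a) k.toHom r) φ = m.opFam r (φ.act k (PreHom.id P)) := by
  induction k using Beta.preHom_ind with | _ ξ g hg
  let φ' : Fam F Q' P := ⟨fun y => ⟨g (φ.toFun y).1, (φ.toFun y).2⟩,
    (congrArg (Ultrafilter.map g) φ.map_eq).trans hg⟩
  have e : φ' = φ.act ⟨fun y => ⟨g y, 𝟙 (Q'.fam (g y))⟩, hg⟩ (PreHom.id P) :=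
    Fam.ext fun y => congrArg (Sigma.mk _) (act_id F _).symm
  rw [← e]
  refine congrArg (fun u => m.op (P := Q'.pullFam P.ν fun y => g (φ.toFun y).1) u (c := P.fam)
    fun y => (φ.toFun y).2) ?_
  refine (act_act F _ _ _ _ _).trans
    (congrArg₂ (fun f k => F.act f k r) (Category.id_comp (𝟙 a)) ?_)
  exact Beta.pull_comp g hg (fun y => (φ.toFun y).1) φ.map_eq

/-- The multiplicator given by composition operations. -/
def multor : Profunctor.comp (betaProf F) F ⟶ Profunctor.comp (companion (Beta.mult C)) F :=
  compHom (fun {_ _ P} r s => pair (d := Beta.sum P)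
      (Fam.lift (m.opFam r) (fun _ _ => m.opFam_congr r) (ap (toFam F) s))
      (companion.mk (f := Beta.mult C) (𝟙 (Beta.sum P))))
    (by
      intro e Q Q' P k r s
      obtain ⟨φ, rfl⟩ := Fam.exists_hat s
      induction k using Beta.hom_ind with | _ k
      rw [Fam.act_hat_id, Fam.toFam_hat, Fam.toFam_hat]
      exact congrArg (fun u => pair u (companion.mk (f := Beta.mult C) (𝟙 (Beta.sum P))))
        (m.opFam_slide k r φ))
    (by
      intro e e' Q P P' f l r s
      obtain rfl := IsDiscrete.eq_of_hom f
      obtain rfl : f = 𝟙 _ := Subsingleton.elim _ _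
      obtain ⟨φ, rfl⟩ := Fam.exists_hat s
      induction l using Beta.hom_ind with | _ l
      rw [Fam.act_id_hat, Fam.toFam_hat, Fam.toFam_hat, act_id, act_pair, act_id]
      refine Eq.trans ?_ (pair_companion _ _).symm
      refine congrArg (fun u => pair u (companion.mk (f := Beta.mult C) (𝟙 (Beta.sum P')))) ?_
      refine (m.opFam_act l r φ).trans (congrArg (F.act (𝟙 _) · (m.opFam r φ)) ?_)
      rw [act_companion]
      exact ((Category.id_comp _).trans (Category.id_comp _)).symm)

theorem compOf_multor {a : C} {P : Beta C} (r : F.El a P) {c : P.X → Beta C}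
    (s : ∀ x, F.El (P.fam x) (c x)) : compOf m.multor r (Fam.ofEls s).hat = m.op r s := by
  refine (act_id F _).trans ((congrArg (Fam.lift (m.opFam r) fun _ _ => m.opFam_congr r)
    (Fam.toFam_hat (Fam.ofEls s))).trans ?_)
  exact congrArg (fun u => m.op u s) (act_id F r)

end CompOps

/-- The unitor given by identity elements. -/
def unitorOf [IsDiscrete C] (i : ∀ c, F.El c ((Beta.unit C).obj c)) :
    ident C ⟶ Profunctor.comp (companion (Beta.unit C)) F :=
  mkHom (fun _ c k => pair (F.act (ident.arr k) (𝟙 _) (i c)) (companion.mk (𝟙 _))) (by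
    intro d' d c c' f g k
    obtain rfl := IsDiscrete.eq_of_hom g
    obtain rfl : g = 𝟙 _ := Subsingleton.elim _ _
    simp)

theorem idOf_unitorOf [IsDiscrete C] (i : ∀ c, F.El c ((Beta.unit C).obj c)) (c : C) :
    idOf (unitorOf i) c = i c := by
  change F.act (𝟙 c) (𝟙 _) (F.act (𝟙 c) (𝟙 _) (i c)) = i c
  simp

namespace CompOps

variable (m : CompOps F) [IsDiscrete C]

theorem unitLeftPasting_eq_id_iff (i : ∀ c, F.El c ((Beta.unit C).obj c)) :
    unitLeftPasting (C := ⟨C⟩) (a := F) (unitorOf i) m.multor = 𝟙 _ ↔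
      ∀ {e : C} {P : Beta C} (r : F.El e P),
        F.act (𝟙 e) (Beta.sumUnitIso P).hom
          (m.op (i e) (c := fun _ => P) fun _ => r) = r := by
  rw [_root_.unitLeftPasting_eq_id_iff]
  refine forall_congr' fun e => forall_congr' fun P => forall_congr' fun r => ?_
  rw [idOf_unitorOf]
  exact Eq.congr_left (congrArg (F.act (𝟙 e) (Beta.sumUnitIso P).hom)
    (m.compOf_multor (i e) fun _ => r))

theorem unitRightPasting_eq_id_iff (i : ∀ c, F.El c ((Beta.unit C).obj c)) :
    unitRightPasting (C := ⟨C⟩) (a := F) (unitorOf i) m.multor = 𝟙 _ ↔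
      ∀ {e : C} {P : Beta C} (r : F.El e P),
        F.act (𝟙 e) (Beta.sumMapUnitIso P).hom (m.op r fun x => i (P.fam x)) = r := by
  rw [_root_.unitRightPasting_eq_id_iff]
  refine forall_congr' fun e => forall_congr' fun P => forall_congr' fun r => ?_
  simp only [idOf_unitorOf]
  exact Eq.congr_left (congrArg (F.act (𝟙 e) (Beta.sumMapUnitIso P).hom)
    (m.compOf_multor r fun x => i (P.fam x)))

theorem assocPasting_eq_iff :
    assocPasting (C := ⟨C⟩) (a := F) m.multor = assocPasting' (C := ⟨C⟩) (a := F) m.multor ↔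
      ∀ {e : C} {P : Beta C} (r : F.El e P) {c : P.X → Beta C} (s : ∀ x, F.El (P.fam x) (c x))
        {d : ∀ x, (c x).X → Beta C} (t : ∀ x y, F.El ((c x).fam y) (d x y)),
        m.op (m.op r s) (fun z => t z.1 z.2) =
          F.act (𝟙 e) (Beta.sumSumIso (P.withFam fun x => (c x).withFam (d x))).hom
            (m.op r fun x => m.op (s x) (t x)) := by
  rw [assocPasting_eq_iff_ofEls]
  simp only [compOf_multor]
  refine forall_congr' fun e => forall_congr' fun P => forall_congr' fun r => forall_congr' fun c =>
    forall_congr' fun s => forall_congr' fun d => forall_congr' fun t => ?_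
  exact Eq.congr (m.compOf_multor (m.op r s) fun z => t z.1 z.2)
    (congrArg (F.act (𝟙 e) (Beta.sumSumIso (P.withFam fun x => (c x).withFam (d x))).hom)
      (m.compOf_multor r fun x => m.op (s x) (t x)))

end CompOps

end Construction

/-! ### The correspondence -/

section Equivalence

variable {A₀ : Type (w + 1)} [LargeCategory A₀] {A : Profunctor.{w} (Beta A₀) A₀}

/-- The ultraconvergence structure of a lax algebra. By definition, `L.idEl` and `L.compEl` are
`idOf` and `compOf` of its cells, the latter at families lying over identities. -/
def LaxAlgebra.toUC (L : LaxAlgebra (toPROF A)) : UCStructure A where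
  id a := L.idEl a
  comp r _ s := L.compEl r s
  left_naturality {a P} r c s Y ξ g hg := by
    have h1 := compOf_slide (F := toPROF A) L.multor (P.pull ξ g hg) ⟨r⟩
      (Fam.ofEls (F := toPROF A) (P := P.pullFam ξ g) (c := fun y => c (g y))
        fun y => ⟨s (g y)⟩).hat
    have h2 := compOf_act (F := toPROF A) L.multor ((P.withFam c).pull ξ g hg) ⟨r⟩
      (Fam.ofEls (F := toPROF A) (P := P) (c := c) fun x => ⟨s x⟩).hat
    refine congrArg ULift.down (h1.trans (Eq.trans
      (congrArg (compOf (F := toPROF A) L.multor ⟨r⟩) ?_) h2))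
    refine (Fam.act_hat_id _ _).trans (Eq.trans (congrArg Fam.hat ?_) (Fam.act_id_hat _ _).symm)
    exact Fam.ext fun y => rfl
  right_naturality {a P} r c d s k := by
    have h2 := compOf_act (F := toPROF A) L.multor (P.famHom k) ⟨r⟩
      (Fam.ofEls (F := toPROF A) (P := P) (c := c) fun x => ⟨s x⟩).hat
    exact congrArg ULift.down
      ((congrArg (compOf (F := toPROF A) L.multor ⟨r⟩) (Fam.act_id_hat _ _).symm).trans h2)
  left_unit {a P} r := congrArg ULift.down
    ((unitLeftPasting_eq_id_iff (F := toPROF A) L.multor L.unitor).1 L.unit_left ⟨r⟩)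
  right_unit {a P} r := congrArg ULift.down
    ((unitRightPasting_eq_id_iff (F := toPROF A) L.multor L.unitor).1 L.unit_right ⟨r⟩)
  assoc {a P} r c s d t := congrArg ULift.down
    ((assocPasting_eq_iff_ofEls (F := toPROF A) L.multor).1 L.assoc ⟨r⟩ (fun x => ⟨s x⟩)
      (fun x y => ⟨t x y⟩))

/-- The composition operations of an ultraconvergence structure. -/
def UCStructure.compOps (U : UCStructure A) : CompOps (toPROF A) where
  op r _ s := ⟨U.comp r.down fun x => (s x).down⟩
  pull r _ s _ ξ g hg := congrArg ULift.up (U.left_naturality r.down (fun x => (s x).down) ξ g hg)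
  famHom r _ _ s k := congrArg ULift.up (U.right_naturality r.down (fun x => (s x).down) k)

variable [IsDiscrete A₀]

/-- The lax algebra of an ultraconvergence structure. -/
def UCStructure.toLax (U : UCStructure A) : LaxAlgebra (toPROF A) where
  unitor := unitorOf (F := toPROF A) fun a => ⟨U.id a⟩
  multor := U.compOps.multor
  unit_left := (U.compOps.unitLeftPasting_eq_id_iff _).2 fun r =>
    congrArg ULift.up (U.left_unit r.down)
  unit_right := (U.compOps.unitRightPasting_eq_id_iff _).2 fun r =>
    congrArg ULift.up (U.right_unit r.down)
  assoc := U.compOps.assocPasting_eq_iff.2 fun r _ s _ t =>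
    congrArg ULift.up (U.assoc r.down (fun x => (s x).down) (fun x y => (t x y).down))

variable (A) in
/-- Lax algebra structures and ultraconvergence structures on `A` correspond to each other. -/
def laxAlgebraEquivUC : LaxAlgebra (toPROF A) ≃ UCStructure A where
  toFun L := L.toUC
  invFun U := U.toLax
  left_inv L := by
    apply LaxAlgebra.ext
    · exact unitor_ext (F := toPROF A) fun a => idOf_unitorOf (F := toPROF A) _ a
    · exact multor_ext (F := toPROF A) fun r c s => CompOps.compOf_multor L.toUC.compOps r s
  right_inv U := by
    apply UCStructure.ext
    · funext a
      exact congrArg ULift.down (idOf_unitorOf (F := toPROF A) (fun a => ⟨U.id a⟩) a)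
    · funext a P r c s
      exact congrArg ULift.down (CompOps.compOf_multor U.compOps ⟨r⟩ (c := c) fun x => ⟨s x⟩)

end Equivalence

end

theorem mainTheorem6 {A₀ : Type (w + 1)} [LargeCategory A₀] [IsDiscrete A₀]
    (A : Profunctor.{w} (Beta A₀) A₀) (hA : IsSmallProfunctor A) :
    ∃ e : LaxAlgebra (toPROF A) ≃ UCStructure A,
      (∀ (L : LaxAlgebra (toPROF A)) (a : A₀), (e L).id a = L.idEl a) ∧
      ∀ (L : LaxAlgebra (toPROF A)) (a : A₀) (P : Beta A₀) (r : A.El a P) (c : P.X → Beta A₀)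
        (s : ∀ x, A.El (P.fam x) (c x)), (e L).comp r s = L.compEl r s :=
  ⟨laxAlgebraEquivUC A, fun _ _ => rfl, fun _ _ _ _ _ _ => rfl⟩
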